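/- **Theorem.** *Graphs.* A series-parallel (SP) graph with source $s$ and sink $t$ is a single directed edge $(s,t)$ with $s\ne t$, or a series composition of two SP graphs (the sink of the first identified with the source of the second), or a parallel composition of two SP graphs (sources identified, sinks identified, parallel edges merged). A starborescence is an SP graph $G$ with source $s$ and sink $t$ such that $G-s$ is an in-tree rooted at $t$ (its underlying undirected graph is a tree and every vertex has at most one out-neighbour). *Memory model.* A computation graph is a DAG $(V,E)$ with functions $\mathrm{size}:V\to\mathbb R_{\ge0}$ and $\mathrm{scratch}:V\to\mathbb R$ such that $\mathrm{scratch}(v)\ge-\mathrm{size}(v)$ and $\mathrm{scratch}(v)\ge-\sum_{u:\,\delta^+(u)=\{v\}}\mathrm{size}(u)$ for all $v$, where $\delta^+(u)$ is the set of out-neighbours of $u$. For a schedule (topological ordering) $\sigma=(\sigma_1,\dots,\sigma_n)$ let $$D_i=\sum_{j<i:\ \delta^+(\sigma_j)\cap\{\sigma_i,\dots,\sigma_n\}\neq\emptyset}\mathrm{size}(\sigma_j)+\mathrm{size}(\sigma_i)+\mathrm{scratch}(\sigma_i),\qquad A_i=\sum_{j\le i:\ \delta^+(\sigma_j)\cap\{\sigma_{i+1},\dots,\sigma_n\}\ne\emptyset}\mathrm{size}(\sigma_j)$$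 be the memory during and after the $i$-th operation. The memory profile of $\sigma$ is $(0,D_1,A_1,\dots,D_n,A_n)$, and its internal memory profile is $(A_1,D_2,A_2,\dots,A_{n-1},D_n,\mathrm{size}(\sigma_n))$. *Dominance.* A sequence $X$ dominates a sequence $Y$ if two pointers, initially at the first entries of $X$ and $Y$, can be advanced to the last entries, one pointer by one position in each step, such that at all times the entry pointed at in $X$ is at most the entry pointed at in $Y$. A schedule of a graph with one source and one sink is dominant if its internal memory profile dominates the internal memory profile of every schedule and its memory profile dominates the memory profile of every schedule. (For SP graphs the first condition implies the second.) *Algorithms.* Algorithms are programs for a unit-cost real random access machine (arrays of natural numbers with addition, truncated subtraction and comparison; arrays of real numbers with field operations and comparison; indirect addressing; loops; and procedure calls with a private, zero-initialized memory and arguments and results passed by copying, at one step per copied cell). A computation graph on the vertices $0,\dots,n-1$ is given by an arbitrary list of its edges and by the values of $\mathrm{size}$ and $\mathrm{scratch}$. *Claim.* There is an absolute constant $C$ such that the following holds for every function $f:\mathbb N^2\to\mathbb N$ that is nondecreasing in both arguments. If there is an algorithm that finds, for every computation graph that is a starborescence with $n$ vertices and maximum out-degree $d$, a dominant schedule within $f(n,d)$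 steps, then there is an algorithm that finds, for every computation graph that is an SP graph with $n$ vertices and maximum out-degree $d$, a dominant schedule within $C\,(n^2+n\,f(n,d))$ steps. -/

import Mathlib

/-! ### Series-parallel graphs and starborescences -/

namespace PeakMem

/-- `IsSPOn U D s t`: the digraph with vertex set `U` and edges `D` is series-parallel with source
`s` and sink `t`.  Identifying terminals of two graphs means that their vertex sets, taken inside
one ambient type, share exactly these terminals; the union of the edge sets keeps only one copy
of parallel edges. -/
inductive IsSPOn {V : Type*} : Set V → Digraph V → V → V → Prop
  | edge (s t : V) (hst : s ≠ t) : IsSPOn {s, t} ⟨fun a b => a = s ∧ b = t⟩ s t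
  | series (U₁ U₂ : Set V) (D₁ D₂ : Digraph V) (s m t : V)
      (h₁ : IsSPOn U₁ D₁ s m) (h₂ : IsSPOn U₂ D₂ m t) (h : U₁ ∩ U₂ = {m}) :
      IsSPOn (U₁ ∪ U₂) (D₁ ⊔ D₂) s t
  | parallel (U₁ U₂ : Set V) (D₁ D₂ : Digraph V) (s t : V)
      (h₁ : IsSPOn U₁ D₁ s t) (h₂ : IsSPOn U₂ D₂ s t) (h : U₁ ∩ U₂ = {s, t}) :
      IsSPOn (U₁ ∪ U₂) (D₁ ⊔ D₂) s t

/-- A series-parallel graph on the whole vertex type. -/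
def IsSeriesParallel {V : Type*} (D : Digraph V) : Prop :=
  ∃ s t : V, IsSPOn Set.univ D s t

/-- The subgraph induced by a set of vertices. -/
def inducedDigraph {V : Type*} (D : Digraph V) (U : Set V) : Digraph U :=
  ⟨fun a b => D.Adj a b⟩

/-- In-trees rooted at `t`: the underlying undirected graph is a tree, every vertex has at most
one out-neighbour, and the root has none. -/
structure IsInTree {V : Type*} (D : Digraph V) (t : V) : Prop where
  isTree : (SimpleGraph.fromRel D.Adj).IsTree
  out_le_one : ∀ u v w, D.Adj u v → D.Adj u w → v = w
  root : ∀ w, ¬ D.Adj t w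

/-- Starborescences: series-parallel graphs that become an in-tree rooted at the sink when the
source is removed. -/
def IsStarborescence {V : Type*} (D : Digraph V) : Prop :=
  ∃ s t : V, IsSPOn Set.univ D s t ∧
    ∃ ht : t ∈ ({s}ᶜ : Set V), IsInTree (inducedDigraph D {s}ᶜ) ⟨t, ht⟩

/-- The maximum out-degree. -/
noncomputable def maxOutDegree {V : Type*} [Fintype V] (D : Digraph V) : ℕ :=
  Finset.univ.sup fun v => Set.ncard {w | D.Adj v w}

/-! ### The computation graph memory model -/

open Classical in
/-- Computation graphs. -/
structure CompGraph (V : Type*) [Fintype V] where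
  graph : Digraph V
  acyclic : ∀ v, ¬ Relation.TransGen graph.Adj v v
  size : V → ℝ
  scratch : V → ℝ
  size_nonneg : ∀ v, 0 ≤ size v
  neg_size_le_scratch : ∀ v, -size v ≤ scratch v
  neg_release_le_scratch : ∀ v,
    -(∑ u with {w | graph.Adj u w} = {v}, size u) ≤ scratch v

namespace CompGraph

variable {V : Type*} [Fintype V] (G : CompGraph V)

/-- Schedules: topological orderings of all vertices. -/
structure IsSchedule (σ : List V) : Prop where
  nodup : σ.Nodup
  complete : ∀ v, v ∈ σ
  topological : σ.Pairwise fun u v => ¬ G.graph.Adj v u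

open Classical in
/-- Total size of the outputs of the vertices in `pre` that are needed by a vertex in `post`. -/
noncomputable def held (pre post : List V) : ℝ :=
  ((pre.filter fun v => ∃ w ∈ post, G.graph.Adj v w).map G.size).sum

/-- Memory during the operation in (zero-based) position `i`. -/
noncomputable def memDuring (σ : List V) (i : Fin σ.length) : ℝ :=
  G.held (σ.take i) (σ.drop i) + G.size σ[i] + G.scratch σ[i]

/-- Memory after the operation in (zero-based) position `i`. -/
noncomputable def memAfter (σ : List V) (i : Fin σ.length) : ℝ :=
  G.held (σ.take (i + 1)) (σ.drop (i + 1))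

/-- The memory profile `(0, during σ₁, after σ₁, …, during σₙ, after σₙ)`. -/
noncomputable def profile (σ : List V) : List ℝ :=
  0 :: (List.finRange σ.length).flatMap fun i => [G.memDuring σ i, G.memAfter σ i]

/-- The internal memory profile `(after σ₁, during σ₂, after σ₂, …, during σₙ, size σₙ)`: it starts
when the source has been executed and ends when the output of the sink is still in memory. -/
noncomputable def internalProfile (σ : List V) : List ℝ :=
  ((G.profile σ).drop 2).dropLast ++ (σ.getLast?.map G.size).toList

end CompGraph

/-- Dominance of sequences by pointer advancement (with zero-based positions): both pointers start
at the first entries, in every step exactly one of them advances by one, they end at the last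
entries, and the entry of `A` never exceeds that of `B`. -/
def Dominates (A B : List ℝ) : Prop :=
  ∃ p : ℕ → ℕ × ℕ,
    p 0 = (0, 0) ∧
    p (A.length + B.length - 2) = (A.length - 1, B.length - 1) ∧
    (∀ i < A.length + B.length - 2,
      p (i + 1) = ((p i).1 + 1, (p i).2) ∨ p (i + 1) = ((p i).1, (p i).2 + 1)) ∧
    ∀ i ≤ A.length + B.length - 2,
      ∃ (ha : (p i).1 < A.length) (hb : (p i).2 < B.length), A[(p i).1] ≤ B[(p i).2]

/-- Dominant schedules (of graphs with one source and one sink): the schedule dominates every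
schedule, both with respect to the internal and with respect to the full memory profile. (For the
series-parallel graphs considered here the former implies the latter.) -/
structure CompGraph.IsDominant {V : Type*} [Fintype V] (G : CompGraph V) (σ : List V) :
    Prop where
  isSchedule : G.IsSchedule σ
  internal : ∀ τ, G.IsSchedule τ → Dominates (G.internalProfile σ) (G.internalProfile τ)
  full : ∀ τ, G.IsSchedule τ → Dominates (G.profile σ) (G.profile τ)

/-! ### Algorithms: structured programs for a real random access machine with a step count

The memory consists of arrays of natural numbers and arrays of real numbers. A program names
finitely many of them; cells are addressed by computed indices. Scalars are cells with a constant
index. -/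

/-- A memory: cell `i` of the array `a` is `nat a i`, respectively `real a i`. -/
structure Mem where
  nat : ℕ → ℕ → ℕ
  real : ℕ → ℕ → ℝ

/-- The memory in which all cells are zero. -/
noncomputable def Mem.zero : Mem := ⟨fun _ _ => 0, fun _ _ => 0⟩

/-- Expressions for natural numbers (subtraction is truncated). -/
inductive NExp
  | const (c : ℕ)
  | get (a : ℕ) (i : NExp)
  | add (x y : NExp)
  | sub (x y : NExp)

/-- Expressions for real numbers (division by zero gives zero). -/
inductive RExp
  | const (q : ℚ)
  | get (a : ℕ) (i : NExp)
  | add (x y : RExp)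
  | sub (x y : RExp)
  | mul (x y : RExp)
  | div (x y : RExp)

/-- Tests. -/
inductive BExp
  | natEq (x y : NExp)
  | natLt (x y : NExp)
  | realEq (x y : RExp)
  | realLt (x y : RExp)
  | not (b : BExp)
  | and (b c : BExp)

/-- The value of an expression. -/
def NExp.eval (M : Mem) : NExp → ℕ
  | .const c => c
  | .get a i => M.nat a (i.eval M)
  | .add x y => x.eval M + y.eval M
  | .sub x y => x.eval M - y.eval M

/-- The number of steps for evaluating an expression: its number of constants, memory accesses
and operations. -/
def NExp.cost : NExp → ℕ
  | .const _ => 1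
  | .get _ i => 1 + i.cost
  | .add x y => 1 + x.cost + y.cost
  | .sub x y => 1 + x.cost + y.cost

/-- The value of an expression. -/
noncomputable def RExp.eval (M : Mem) : RExp → ℝ
  | .const q => q
  | .get a i => M.real a (i.eval M)
  | .add x y => x.eval M + y.eval M
  | .sub x y => x.eval M - y.eval M
  | .mul x y => x.eval M * y.eval M
  | .div x y => x.eval M / y.eval M

/-- The number of steps for evaluating an expression. -/
def RExp.cost : RExp → ℕ
  | .const _ => 1
  | .get _ i => 1 + i.cost
  | .add x y => 1 + x.cost + y.cost
  | .sub x y => 1 + x.cost + y.cost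
  | .mul x y => 1 + x.cost + y.cost
  | .div x y => 1 + x.cost + y.cost

/-- The truth value of a test. -/
def BExp.eval (M : Mem) : BExp → Prop
  | .natEq x y => x.eval M = y.eval M
  | .natLt x y => x.eval M < y.eval M
  | .realEq x y => x.eval M = y.eval M
  | .realLt x y => x.eval M < y.eval M
  | .not b => ¬ b.eval M
  | .and b c => b.eval M ∧ c.eval M

/-- The number of steps for evaluating a test. -/
def BExp.cost : BExp → ℕ
  | .natEq x y => 1 + x.cost + y.cost
  | .natLt x y => 1 + x.cost + y.cost
  | .realEq x y => 1 + x.cost + y.cost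
  | .realLt x y => 1 + x.cost + y.cost
  | .not b => 1 + b.cost
  | .and b c => 1 + b.cost + c.cost

/-- A parameter of a procedure call: copy the first `len` cells of the array `src` of the sender
to the array `dst` of the receiver. The length is computed by the caller. -/
structure Transfer where
  src : ℕ
  dst : ℕ
  len : NExp

/-- Programs. -/
inductive Cmd
  | skip
  | setNat (a : ℕ) (i e : NExp)
  | setReal (a : ℕ) (i : NExp) (e : RExp)
  | seq (c d : Cmd)
  | ite (b : BExp) (c d : Cmd)
  | while (b : BExp) (c : Cmd)
  | call (body : Cmd) (natIn realIn natOut realOut : List Transfer)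

/-- Store a natural number. -/
def Mem.storeNat (M : Mem) (a i x : ℕ) : Mem :=
  { M with nat := fun a' i' => if a' = a ∧ i' = i then x else M.nat a' i' }

/-- Store a real number. -/
noncomputable def Mem.storeReal (M : Mem) (a i : ℕ) (x : ℝ) : Mem :=
  { M with real := fun a' i' => if a' = a ∧ i' = i then x else M.real a' i' }

/-- Copy blocks of natural numbers from `src` to `dst`; the lengths are evaluated in `env`. -/
def copyNat (env src : Mem) (l : List Transfer) (dst : Mem) : Mem :=
  l.foldl (fun M x => { M with nat := fun a i =>
    if a = x.dst ∧ i < x.len.eval env then src.nat x.src i else M.nat a i }) dst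

/-- Copy blocks of real numbers from `src` to `dst`; the lengths are evaluated in `env`. -/
noncomputable def copyReal (env src : Mem) (l : List Transfer) (dst : Mem) : Mem :=
  l.foldl (fun M x => { M with real := fun a i =>
    if a = x.dst ∧ i < x.len.eval env then src.real x.src i else M.real a i }) dst

/-- The number of steps for copying: one per cell, besides computing the lengths. -/
def copyCost (env : Mem) (l : List Transfer) : ℕ :=
  (l.map fun x => 1 + x.len.cost + x.len.eval env).sum

/-- `Exec c M k M'`: started in the memory `M`, the program `c` halts after `k` steps in the
memory `M'`. A procedure call runs its body in a private memory, all of whose cells are zero except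
for the arguments, which are copied by value; then the results are copied back. -/
inductive Exec : Cmd → Mem → ℕ → Mem → Prop
  | skip (M : Mem) : Exec .skip M 1 M
  | setNat (a : ℕ) (i e : NExp) (M : Mem) :
      Exec (.setNat a i e) M (1 + i.cost + e.cost) (M.storeNat a (i.eval M) (e.eval M))
  | setReal (a : ℕ) (i : NExp) (e : RExp) (M : Mem) :
      Exec (.setReal a i e) M (1 + i.cost + e.cost) (M.storeReal a (i.eval M) (e.eval M))
  | seq (c d : Cmd) (M₁ M₂ M₃ : Mem) (k l : ℕ) (hc : Exec c M₁ k M₂) (hd : Exec d M₂ l M₃) :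
      Exec (.seq c d) M₁ (k + l) M₃
  | ite_true (b : BExp) (c d : Cmd) (M M' : Mem) (k : ℕ) (hb : b.eval M) (hc : Exec c M k M') :
      Exec (.ite b c d) M (1 + b.cost + k) M'
  | ite_false (b : BExp) (c d : Cmd) (M M' : Mem) (k : ℕ) (hb : ¬ b.eval M)
      (hd : Exec d M k M') : Exec (.ite b c d) M (1 + b.cost + k) M'
  | while_true (b : BExp) (c : Cmd) (M₁ M₂ M₃ : Mem) (k l : ℕ) (hb : b.eval M₁)
      (hc : Exec c M₁ k M₂) (hw : Exec (.while b c) M₂ l M₃) :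
      Exec (.while b c) M₁ (1 + b.cost + k + l) M₃
  | while_false (b : BExp) (c : Cmd) (M : Mem) (hb : ¬ b.eval M) :
      Exec (.while b c) M (1 + b.cost) M
  | call (body : Cmd) (natIn realIn natOut realOut : List Transfer) (M M' : Mem) (k : ℕ)
      (hbody : Exec body (copyReal M M realIn (copyNat M M natIn Mem.zero)) k M') :
      Exec (.call body natIn realIn natOut realOut) M
        (1 + copyCost M natIn + copyCost M realIn + k + copyCost M natOut + copyCost M realOut)
        (copyReal M M' realOut (copyNat M M' natOut M))

/-! ### The scheduling problem -/

/-- The input memory for a computation graph with vertices `0, …, n - 1` whose edges are listed in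
`es`: the natural array `0` holds `n` and the number of edges, the natural arrays `1` and `2` hold
the tails and the heads of the edges, the real arrays `0` and `1` hold the sizes and the scratch
sizes of the vertices; all other cells are zero. -/
noncomputable def inputMem {n : ℕ} (G : CompGraph (Fin n)) (es : List (Fin n × Fin n)) : Mem where
  nat := fun a i =>
    if a = 0 then [n, es.length].getD i 0
    else if a = 1 then (es.map fun e => (e.1 : ℕ)).getD i 0
    else if a = 2 then (es.map fun e => (e.2 : ℕ)).getD i 0
    else 0
  real := fun a i =>
    if h : i < n then
      if a = 0 then G.size ⟨i, h⟩ else if a = 1 then G.scratch ⟨i, h⟩ else 0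
    else 0

/-- The list `es` lists every edge of the graph exactly once. -/
def ListsEdges {n : ℕ} (D : Digraph (Fin n)) (es : List (Fin n × Fin n)) : Prop :=
  es.Nodup ∧ ∀ u v, (u, v) ∈ es ↔ D.Adj u v

/-- The program `A` finds a dominant schedule of every computation graph whose underlying graph is
in the class `P`, within `T n d` steps if the graph has `n` vertices and maximum out-degree `d`.
The graph is given by any list of its edges. The schedule is returned in the natural array `3`. -/
def FindsDominant (P : ∀ n : ℕ, Digraph (Fin n) → Prop) (A : Cmd) (T : ℕ → ℕ → ℕ) : Prop :=
  ∀ (n : ℕ) (G : CompGraph (Fin n)) (es : List (Fin n × Fin n)),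
    P n G.graph → ListsEdges G.graph es →
      ∃ (k : ℕ) (M : Mem) (σ : List (Fin n)),
        Exec A (inputMem G es) k M ∧ k ≤ T n (maxOutDegree G.graph) ∧
        G.IsDominant σ ∧ ∀ i : Fin σ.length, M.nat 3 i = (σ[i] : ℕ)

end PeakMem

/-! The vertices are processed from the sink backwards, each after all its out-neighbours, and the
graph is rewritten on the way. The invariant `Reduced` says that processed vertices have at most one
out-neighbour, so that a single path leads from each of them to the sink. When `v` is next, the
paths from its out-neighbours have a first common vertex `p` (`Reduced.exists_merge`), and the
vertices strictly between `v` and `p` exchange edges with the rest of the graph only through `v` and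
`p` (`Reduced.isBlock`). The last point is where series-parallelism enters, in the form `SPAt`. The
block is a starborescence (`Reduced.isStar`, `IsStar.isStarborescence`), so the given algorithm
orders it, and the block is replaced by a path in this order. Once every vertex is processed, the
graph is a path, and its only schedule is dominant for the original graph.

Why the replacement is harmless: while `v` has been executed and `p` has not, the memory is the sum
of a part that depends only on the rest of the graph and a part that depends only on the progress
inside the block (`mem_eq_restMem_add`). If `σ` is an order of the block at least as good as all
others (`IsBest`), then in any schedule each operation of the block can be replaced by a bunch of
consecutive operations of `σ` without using more memory (`subst_dom`). Every vertex of the path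
receives as its size the memory that the block uses at that moment, and its scratch is corrected so
that size plus scratch is unchanged; hence all schedules of the new graph keep their profiles
(`CompGraph.mem_relink`). Together these facts give `CompGraph.exists_relink`: the new graph refines
the old one, and `CompGraph.Refines` is transitive.

That a dominant schedule of the block yields such an order `σ` needs weights at its ends for which
the internal profile starts and ends properly (`IsBlockGraph`); a pair of pointers then translates
into counts of operations (`exists_index`, `IsBlockGraph.isBest`).

Running time: there is at most one call of the given algorithm per vertex, on a graph with at most
`n` vertices and maximum out-degree at most `d`, so monotonicity of `f` bounds it by `f n d`. A
merge vertex is found by walking along the paths from the out-neighbours, which costs O(n) per edge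
of the original graph; everything else costs a number of steps linear in the numbers of vertices and
edges per vertex. A series-parallel graph has fewer than `2 n` edges (`IsSPOn.ncard_edges`), so the
overhead is O(n²). -/

namespace PeakMem

/-! ### Dominance as an inductive relation -/

/-- Inductive form of dominance by pointer advancement. -/
inductive Dom : List ℝ → List ℝ → Prop
  | single {a b : ℝ} (h : a ≤ b) : Dom [a] [b]
  | left {a b : ℝ} {X Y : List ℝ} (h : a ≤ b) (hd : Dom X (b :: Y)) : Dom (a :: X) (b :: Y)
  | right {a b : ℝ} {X Y : List ℝ} (h : a ≤ b) (hd : Dom (a :: X) Y) : Dom (a :: X) (b :: Y)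

theorem Dom.ne_nil_left {X Y : List ℝ} (h : Dom X Y) : X ≠ [] := by cases h <;> simp

theorem Dom.ne_nil_right {X Y : List ℝ} (h : Dom X Y) : Y ≠ [] := by cases h <;> simp

/-- The two pointer walks are merged along `Y`: moves of the pointers in `X` and in `Z` are copied,
and when both walks are about to advance in `Y` they do so together, which costs no step of the
combined walk. That case makes the total length of the three lists the right induction parameter. -/
theorem Dom.trans : ∀ {X Y Z : List ℝ}, Dom X Y → Dom Y Z → Dom X Z := by
  suffices H : ∀ N, ∀ X Y Z : List ℝ, X.length + Y.length + Z.length ≤ N →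
      Dom X Y → Dom Y Z → Dom X Z from fun {X Y Z} => H _ X Y Z le_rfl
  intro N
  induction N with
  | zero =>
    intro X Y Z hN h
    exact absurd (List.length_eq_zero_iff.1 (by omega)) h.ne_nil_left
  | succ N ih =>
    intro X Y Z hN h1 h2
    cases h1 with
    | single h =>
      cases h2 with
      | single h' => exact .single (h.trans h')
      | left h' hd => exact absurd rfl hd.ne_nil_left
      | right h' hd =>
        exact .right (h.trans h') (ih _ _ _ (by simp at hN ⊢; omega) (.single h) hd)
    | left h hd =>
      have hh := hd
      cases h2 with
      | single h' =>
        exact .left (h.trans h') (ih _ _ _ (by simp at hN ⊢; omega) hd (.single h'))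
      | left h' hd' =>
        exact .left (h.trans h') (ih _ _ _ (by simp at hN ⊢; omega) hd (.left h' hd'))
      | right h' hd' =>
        exact .left (h.trans h') (ih _ _ _ (by simp at hN ⊢; omega) hd (.right h' hd'))
    | right h hd =>
      cases h2 with
      | single h' => exact absurd rfl hd.ne_nil_right
      | left h' hd' => exact ih _ _ _ (by simp at hN ⊢; omega) hd hd'
      | right h' hd' =>
        exact .right (h.trans h') (ih _ _ _ (by simp at hN ⊢; omega) (.right h hd) hd')

theorem Dominates.dom {A B : List ℝ} (h : Dominates A B) : Dom A B := by
  obtain ⟨p, h0, hN, hs, hle⟩ := h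
  obtain ⟨hA, hB, -⟩ := hle 0 (by omega)
  rw [h0] at hA hB
  simp only at hA hB
  -- Backward induction: `j` steps remain, and the rest of the walk certifies dominance between the
  -- two suffixes at the pointers.
  have key : ∀ j i, i + j = A.length + B.length - 2 →
      Dom (A.drop (p i).1) (B.drop (p i).2) := by
    intro j
    induction j with
    | zero =>
      intro i hi
      obtain ⟨ha, hb, h⟩ := hle i (by omega)
      rw [List.drop_eq_getElem_cons ha, List.drop_eq_getElem_cons hb]
      have : i = A.length + B.length - 2 := by omega
      have e1 : (p i).1 + 1 = A.length := by rw [this, hN]; simp; omega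
      have e2 : (p i).2 + 1 = B.length := by rw [this, hN]; simp; omega
      rw [e1, e2, List.drop_length, List.drop_length]
      exact .single h
    | succ j ih =>
      intro i hi
      obtain ⟨ha, hb, h⟩ := hle i (by omega)
      have hd := ih (i + 1) (by omega)
      rcases hs i (by omega) with e | e
      · rw [e] at hd
        simp only at hd
        rw [List.drop_eq_getElem_cons hb] at hd
        rw [List.drop_eq_getElem_cons ha, List.drop_eq_getElem_cons hb]
        exact .left h hd
      · rw [e] at hd
        simp only at hd
        rw [List.drop_eq_getElem_cons ha] at hd
        rw [List.drop_eq_getElem_cons ha, List.drop_eq_getElem_cons hb]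
        exact .right h hd
  have := key _ 0 (Nat.zero_add _)
  rwa [h0] at this

theorem Dom.dominates {A B : List ℝ} (h : Dom A B) : Dominates A B := by
  induction h with
  | single h => exact ⟨fun _ => (0, 0), by simp, by simp, by simp, by simpa using h⟩
  | @left a b X Y h hd ih =>
    obtain ⟨p, h0, hN, hs, hle⟩ := ih
    have hX : 0 < X.length := List.length_pos_iff.2 hd.ne_nil_left
    refine ⟨fun i => if i = 0 then (0, 0) else ((p (i - 1)).1 + 1, (p (i - 1)).2), by simp, ?_, ?_, ?_⟩
    · have e : (a :: X).length + (b :: Y).length - 2 = (X.length + (b :: Y).length - 2) + 1 := by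
        simp; omega
      rw [e]
      simp only [Nat.add_eq_zero_iff, one_ne_zero, and_false, if_false, Nat.add_sub_cancel, hN]
      simp; omega
    · intro i hi
      rcases i with _ | i
      · left; simp [h0]
      · have := hs i (by simp at hi ⊢; omega)
        simp only [Nat.add_eq_zero_iff, one_ne_zero, and_false, if_false, Nat.add_sub_cancel]
        rcases this with e | e <;> rw [e] <;> simp
    · intro i hi
      rcases i with _ | i
      · exact ⟨by simp, by simp, by simpa using h⟩
      · obtain ⟨ha, hb, h'⟩ := hle i (by simp at hi ⊢; omega)
        refine ⟨by simpa using ha, by simpa using hb, ?_⟩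
        simpa using h'
  | @right a b X Y h hd ih =>
    obtain ⟨p, h0, hN, hs, hle⟩ := ih
    have hY : 0 < Y.length := List.length_pos_iff.2 hd.ne_nil_right
    refine ⟨fun i => if i = 0 then (0, 0) else ((p (i - 1)).1, (p (i - 1)).2 + 1), by simp, ?_, ?_, ?_⟩
    · have e : (a :: X).length + (b :: Y).length - 2 = ((a :: X).length + Y.length - 2) + 1 := by
        simp; omega
      rw [e]
      simp only [Nat.add_eq_zero_iff, one_ne_zero, and_false, if_false, Nat.add_sub_cancel, hN]
      simp; omega
    · intro i hi
      rcases i with _ | i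
      · right; simp [h0]
      · have := hs i (by simp at hi ⊢; omega)
        simp only [Nat.add_eq_zero_iff, one_ne_zero, and_false, if_false, Nat.add_sub_cancel]
        rcases this with e | e <;> rw [e] <;> simp
    · intro i hi
      rcases i with _ | i
      · exact ⟨by simp, by simp, by simpa using h⟩
      · obtain ⟨ha, hb, h'⟩ := hle i (by simp at hi ⊢; omega)
        refine ⟨by simpa using ha, by simpa using hb, ?_⟩
        simpa using h'

/-- While the second pointer is at `j`, the first one moves from `c j` to `c (j + 1)`. -/
theorem Dom.exists_breaks {X Y : List ℝ} (h : Dom X Y) :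
    ∃ c : ℕ → ℕ, c 0 = 0 ∧ Monotone c ∧ c Y.length = X.length - 1 ∧
      ∀ j < Y.length, ∀ i, c j ≤ i → i ≤ c (j + 1) → X.getD i 0 ≤ Y.getD j 0 := by
  induction h with
  | single h => exact ⟨fun _ => 0, rfl, fun _ _ _ => le_rfl, by simp, by simpa using h⟩
  | @left a b X Y h hd ih =>
    obtain ⟨c, c0, cm, cl, hc⟩ := ih
    have hX : 0 < X.length := List.length_pos_iff.2 hd.ne_nil_left
    -- The additional head of the first list is compared with the head of the second only, so every
    -- break except the initial one moves by one.
    refine ⟨fun j => if j = 0 then 0 else c j + 1, by simp, ?_, ?_, ?_⟩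
    · intro i j hij
      have := cm hij
      simp only
      split_ifs <;> omega
    · simp at cl ⊢; omega
    · intro j hj i h1 h2
      simp only [Nat.add_eq_zero_iff, one_ne_zero, and_false, if_false] at h2
      rcases i with _ | i
      · have : j = 0 := by
          by_contra hj; simp [hj] at h1
        subst this; simpa using h
      · rw [List.getD_cons_succ]
        refine hc j hj i ?_ (by omega)
        simp only at h1
        split_ifs at h1 with h3
        · subst h3; omega
        · omega
  | @right a b X Y h hd ih =>
    obtain ⟨c, c0, cm, cl, hc⟩ := ih
    -- The first pointer rests while the second one stands at the additional head, so the break `0`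
    -- occurs twice.
    refine ⟨fun j => c (j - 1), by simpa using c0, fun i j hij => cm (by omega), by simpa using cl, ?_⟩
    intro j hj i h1 h2
    rcases j with _ | j
    · simp only [Nat.zero_add, Nat.sub_self, c0, Nat.le_zero] at h2
      subst h2; simpa using h
    · simp only [Nat.add_sub_cancel] at h1 h2
      rw [List.getD_cons_succ]
      exact hc j (by simpa using hj) i h1 h2

end PeakMem

/-! ### Memory profiles as functions of the set of executed vertices -/

namespace PeakMem

section Profiles

variable {V : Type*}

/-- Topological orderings of all vertices of an irreflexive relation. -/
structure Topo (Adj : V → V → Prop) (σ : List V) : Prop where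
  irrefl : ∀ v, ¬ Adj v v
  nodup : σ.Nodup
  complete : ∀ v, v ∈ σ
  topological : σ.Pairwise fun u v => ¬ Adj v u

theorem Topo.mem_pre {Adj : V → V → Prop} {pre post : List V} {x u : V}
    (h : Topo Adj (pre ++ x :: post)) (hu : Adj u x) : u ∈ pre := by
  have hc := h.complete u
  have ht := h.topological
  rw [List.pairwise_append, List.pairwise_cons] at ht
  rcases List.mem_append.1 hc with hc | hc
  · exact hc
  · rcases List.mem_cons.1 hc with rfl | hc
    · exact absurd hu (h.irrefl _)
    · exact absurd hu (ht.2.1.1 u hc)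

open Classical in
/-- The memory in use when exactly the vertices in `P` have been executed and the outputs of the
vertices satisfying `K` are kept forever. -/
noncomputable def mem (Adj : V → V → Prop) (K : V → Prop) (size : V → ℝ) (P : Finset V) : ℝ :=
  ∑ u ∈ P with (K u ∨ ∃ w, w ∉ P ∧ Adj u w), size u

/-- The sequence of memory values along a list of operations executed after those in `P`. -/
def prof [DecidableEq V] (m : Finset V → ℝ) (w : V → ℝ) : Finset V → List V → List ℝ
  | P, [] => [m P]
  | P, x :: l => m P :: (m P + w x) :: prof m w (insert x P) l

variable [DecidableEq V]

theorem prof_congr {m m' : Finset V → ℝ} {w w' : V → ℝ} (hw : ∀ x, w x = w' x) :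
    ∀ (l : List V) (P : Finset V),
      (∀ pre post, l = pre ++ post → m (P ∪ pre.toFinset) = m' (P ∪ pre.toFinset)) →
      prof m w P l = prof m' w' P l := by
  intro l
  induction l with
  | nil => intro P h; simpa [prof] using h [] [] rfl
  | cons x l ih =>
    intro P h
    have h0 := h [] (x :: l) rfl
    simp only [List.toFinset_nil, Finset.union_empty] at h0
    rw [prof, prof, h0, hw x, ih]
    intro pre post e
    have := h (x :: pre) post (by rw [e]; rfl)
    rwa [List.toFinset_cons, Finset.union_insert, ← Finset.insert_union] at this

theorem prof_concat (m : Finset V → ℝ) (w : V → ℝ) (x : V) :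
    ∀ (l : List V) (P : Finset V), prof m w P (l ++ [x]) =
      prof m w P l ++ [m (P ∪ l.toFinset) + w x, m (insert x (P ∪ l.toFinset))] := by
  intro l
  induction l with
  | nil => intro P; simp [prof]
  | cons y l ih =>
    intro P
    simp only [List.cons_append, prof, ih, List.toFinset_cons, Finset.insert_union,
      Finset.union_insert]

theorem prof_eq_flatMap (m : Finset V → ℝ) (w : V → ℝ) :
    ∀ (l : List V) (P : Finset V), prof m w P l =
      m P :: (List.finRange l.length).flatMap fun i : Fin l.length =>
        [m (P ∪ (l.take i).toFinset) + w l[i], m (P ∪ (l.take (i + 1)).toFinset)] := by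
  intro l
  induction l with
  | nil => intro P; simp [prof]
  | cons x l ih =>
    intro P
    have e : (x :: l).length = l.length + 1 := rfl
    rw [prof, ih]
    simp only [List.length_cons, List.finRange_succ, List.flatMap_cons, List.flatMap_map,
      Fin.val_zero, List.take_zero, List.toFinset_nil, Finset.union_empty, Fin.val_succ,
      List.take_succ_cons, List.toFinset_cons, Finset.insert_union, Finset.union_insert]
    simp

theorem prof_length (m : Finset V → ℝ) (w : V → ℝ) :
    ∀ (l : List V) (P : Finset V), (prof m w P l).length = 2 * l.length + 1 := by
  intro l
  induction l with
  | nil => intro P; simp [prof]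
  | cons x l ih => intro P; simp [prof, ih]; ring

theorem prof_getD (m : Finset V → ℝ) (w : V → ℝ) :
    ∀ (l : List V) (P : Finset V) (i : ℕ), i ≤ l.length →
      (prof m w P l).getD (2 * i) 0 = m (P ∪ (l.take i).toFinset) := by
  intro l
  induction l with
  | nil => intro P i hi; simp at hi; subst hi; simp [prof]
  | cons x l ih =>
    intro P i hi
    rcases i with _ | i
    · simp [prof]
    · rw [prof, show 2 * (i + 1) = 2 * i + 1 + 1 by ring, List.getD_cons_succ, List.getD_cons_succ,
        ih _ i (by simpa using hi)]
      simp

theorem prof_getD_odd (m : Finset V → ℝ) (w : V → ℝ) :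
    ∀ (l : List V) (P : Finset V) (i : ℕ) (hi : i < l.length),
      (prof m w P l).getD (2 * i + 1) 0 = m (P ∪ (l.take i).toFinset) + w l[i] := by
  intro l
  induction l with
  | nil => intro P i hi; simp at hi
  | cons x l ih =>
    intro P i hi
    rcases i with _ | i
    · simp [prof]
    · rw [prof, show 2 * (i + 1) + 1 = 2 * i + 1 + 1 + 1 by ring, List.getD_cons_succ,
        List.getD_cons_succ, ih _ i (by simpa using hi)]
      simp

variable [Fintype V]

/-- Memory after an operation never exceeds memory during it; this is the purpose of the second
condition on `scratch`. The outputs whose only consumer is `x` are in memory before `x` and freed by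
it, and `hK` prevents them from being among the outputs kept forever. -/
theorem mem_insert_le {Adj : V → V → Prop} {K : V → Prop} {size : V → ℝ} {P : Finset V} {x : V}
    {c : ℝ} (h0 : ∀ v, 0 ≤ size v) (hK : ∀ u, K u → ∀ w, ¬ Adj u w)
    (hpre : ∀ u, Adj u x → u ∈ P) (hx : x ∉ P)
    (hc : open Classical in -(∑ u with {w | Adj u w} = {x}, size u) ≤ c) :
    mem Adj K size (insert x P) ≤ mem Adj K size P + (size x + c) := by
  classical
  have e : ∀ u, ({w | Adj u w} : Set V) = {x} → ∀ w, Adj u w ↔ w = x := by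
    intro u hu w
    exact Set.ext_iff.1 hu w
  set S : Finset V := Finset.univ.filter fun u => ({w | Adj u w} : Set V) = {x} with hS
  set R : Finset V := P.filter fun u => K u ∨ ∃ w, w ∉ insert x P ∧ Adj u w with hR
  have hd : Disjoint R S := by
    rw [Finset.disjoint_left]
    intro u hu hu'
    simp only [hR, hS, Finset.mem_filter, Finset.mem_univ, true_and] at hu hu'
    rcases hu.2 with hk | ⟨w, hw, ha⟩
    · exact hK u hk x ((e u hu' x).2 rfl)
    · exact hw (by rw [(e u hu' w).1 ha]; simp)
  have hsub : R ∪ S ⊆ P.filter fun u => K u ∨ ∃ w, w ∉ P ∧ Adj u w := by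
    intro u hu
    rcases Finset.mem_union.1 hu with hu | hu
    · simp only [hR, Finset.mem_filter] at hu ⊢
      refine ⟨hu.1, hu.2.imp_right ?_⟩
      rintro ⟨w, hw, ha⟩
      exact ⟨w, fun h => hw (Finset.mem_insert_of_mem h), ha⟩
    · simp only [hS, Finset.mem_filter, Finset.mem_univ, true_and] at hu ⊢
      have := (e u hu x).2 rfl
      exact ⟨hpre u this, Or.inr ⟨x, hx, this⟩⟩
  have h1 : ∑ u ∈ R, size u + ∑ u ∈ S, size u ≤
      ∑ u ∈ P.filter fun u => K u ∨ ∃ w, w ∉ P ∧ Adj u w, size u := by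
    rw [← Finset.sum_union hd]
    exact Finset.sum_le_sum_of_subset_of_nonneg hsub fun u _ _ => h0 u
  have h2 : ∑ u ∈ (insert x P).filter fun u => K u ∨ ∃ w, w ∉ insert x P ∧ Adj u w, size u ≤
      size x + ∑ u ∈ R, size u := by
    rw [Finset.filter_insert]
    split_ifs
    · rw [Finset.sum_insert (by simp [hx])]
    · have := h0 x
      linarith
  have hc' : -(∑ u ∈ S, size u) ≤ c := by convert hc
  have h3 : mem Adj K size (insert x P) ≤ size x + ∑ u ∈ R, size u := by
    unfold mem; convert h2
  have h4 : ∑ u ∈ R, size u + ∑ u ∈ S, size u ≤ mem Adj K size P := by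
    unfold mem; convert h1
  linarith

theorem mem_univ_of_forall_not {Adj : V → V → Prop} {size : V → ℝ} {t : V} :
    mem Adj (· = t) size Finset.univ = size t := by
  classical
  unfold mem
  rw [← Finset.sum_singleton size t]
  refine Finset.sum_congr ?_ fun _ _ => rfl
  ext u; simp

end Profiles

namespace CompGraph

theorem isSchedule_iff {V : Type*} [Fintype V] (G : CompGraph V) {σ : List V} : G.IsSchedule σ ↔ Topo G.graph.Adj σ :=
  ⟨fun h => ⟨fun v hv => G.acyclic v (.single hv), h.nodup, h.complete, h.topological⟩,
    fun h => ⟨h.nodup, h.complete, h.topological⟩⟩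

variable {V : Type*} [Fintype V] [DecidableEq V] (G : CompGraph V)

theorem held_eq {pre post : List V} (hn : (pre ++ post).Nodup) (hc : ∀ v, v ∈ pre ++ post) :
    G.held pre post = mem G.graph.Adj (fun _ => False) G.size pre.toFinset := by
  classical
  unfold held mem
  rw [← List.sum_toFinset]
  · refine Finset.sum_congr ?_ fun _ _ => rfl
    ext u
    simp only [List.mem_toFinset, List.mem_filter, decide_eq_true_eq, Finset.mem_filter, false_or]
    refine and_congr_right fun _ => exists_congr fun w => and_congr_left fun _ => ?_
    have := hc w
    rw [List.mem_append] at this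
    have hd := (List.nodup_append.1 hn).2.2
    constructor
    · intro h h'; exact hd w h' w h rfl
    · intro h; exact this.resolve_left h
  · exact ((List.nodup_append.1 hn).1).filter _

theorem profile_eq {σ : List V} (h : Topo G.graph.Adj σ) :
    G.profile σ = prof (mem G.graph.Adj (fun _ => False) G.size)
      (fun x => G.size x + G.scratch x) ∅ σ := by
  rw [prof_eq_flatMap, profile]
  refine congr_arg₂ List.cons ?_ ?_
  · simp [mem]
  · refine List.flatMap_congr fun i _ => ?_
    have h1 : ∀ j, G.held (σ.take j) (σ.drop j) =
        mem G.graph.Adj (fun _ => False) G.size (σ.take j).toFinset := fun j =>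
      G.held_eq (by rw [List.take_append_drop]; exact h.nodup)
        (by rw [List.take_append_drop]; exact h.complete)
    simp only [memDuring, memAfter, h1, Finset.empty_union, add_assoc]

/-- Keeping the output of the sink `t` forever changes nothing as long as `t` has not been executed,
and makes the last entry `size t`. So the internal profile is an ordinary `prof` started after the
source, and one exchange argument, run for two choices of `K`, serves both kinds of profile. -/
theorem internalProfile_eq {s t : V} {l : List V} (h : Topo G.graph.Adj (s :: (l ++ [t]))) :
    G.internalProfile (s :: (l ++ [t])) = prof (mem G.graph.Adj (· = t) G.size)
      (fun x => G.size x + G.scratch x) {s} (l ++ [t]) := by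
  classical
  have hn := h.nodup
  rw [internalProfile, profile_eq G h, prof]
  rw [show insert s (∅ : Finset V) = {s} from rfl, prof_concat, prof_concat]
  have e : (s :: (l ++ [t])).getLast? = some t := by
    rw [← List.cons_append, List.getLast?_append]; simp
  rw [e]
  have key : ∀ pre : List V, t ∉ ({s} ∪ pre.toFinset : Finset V) →
      mem G.graph.Adj (fun _ => False) G.size ({s} ∪ pre.toFinset) =
        mem G.graph.Adj (· = t) G.size ({s} ∪ pre.toFinset) := by
    intro pre ht
    unfold mem
    refine Finset.sum_congr ?_ fun _ _ => rfl
    ext u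
    simp only [Finset.mem_filter]
    refine and_congr_right fun hu => ?_
    have : u ≠ t := fun h => ht (h ▸ hu)
    simp [this]
  have ht : t ∉ ({s} ∪ l.toFinset : Finset V) := by
    simp only [List.nodup_cons, List.nodup_append] at hn
    simp only [Finset.mem_union, Finset.mem_singleton, List.mem_toFinset, not_or]
    refine ⟨fun h => hn.1 (by simp [h]), fun h => hn.2.2.2 t h t (by simp) rfl⟩
  have hu : insert t ({s} ∪ l.toFinset : Finset V) = Finset.univ := by
    ext v
    have := h.complete v
    simp at this ⊢
    tauto
  rw [hu, mem_univ_of_forall_not, key l ht]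
  have : prof (mem G.graph.Adj (fun _ => False) G.size) (fun x => G.size x + G.scratch x) {s} l =
      prof (mem G.graph.Adj (· = t) G.size) (fun x => G.size x + G.scratch x) {s} l := by
    refine prof_congr (fun _ => rfl) _ _ fun pre post e => key pre fun hm => ht ?_
    subst e
    rw [List.toFinset_append, ← Finset.union_assoc]
    exact Finset.mem_union_left _ hm
  rw [this]
  simp [List.dropLast_append_of_ne_nil]

end CompGraph

end PeakMem

/-! ### Blocks and the splitting of memory into block and rest -/

namespace PeakMem

section Exchange

variable {V : Type*}

/-- `v` and `p` enclose the set `I`: all edges at vertices in `I` stay between `v` and `p`. -/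
structure IsBlock (Adj : V → V → Prop) (v p : V) (I : Finset V) : Prop where
  v_notMem : v ∉ I
  p_notMem : p ∉ I
  ne : v ≠ p
  out_v : ∀ w, Adj v w → w ∈ I ∨ w = p
  out_mem : ∀ x ∈ I, ∀ w, Adj x w → w ∈ I ∨ w = p
  in_mem : ∀ x ∈ I, ∀ u, Adj u x → u ∈ I ∨ u = v
  reach_v : ∀ x ∈ I, Relation.TransGen Adj v x
  reach_p : ∀ x ∈ I, Relation.TransGen Adj x p
  reach : Relation.TransGen Adj v p

/-- Topological enumerations of a finite set. -/
structure IsOrder (Adj : V → V → Prop) (I : Finset V) (l : List V) : Prop where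
  nodup : l.Nodup
  mem_iff : ∀ x, x ∈ l ↔ x ∈ I
  topological : l.Pairwise fun u v => ¬ Adj v u

/-- `a` is followed by `b` in `L`. -/
def Consec (L : List V) (a b : V) : Prop := ∃ i, L[i]? = some a ∧ L[i + 1]? = some b

/-- Replace the edges leaving `v` and the vertices of `I` by the path `v, σ, p`. -/
def relink (Adj : V → V → Prop) (v p : V) (I : Finset V) (σ : List V) (a b : V) : Prop :=
  (a ∉ I ∧ a ≠ v ∧ Adj a b) ∨ Consec (v :: (σ ++ [p])) a b

theorem Topo.mem_of_transGen {Adj : V → V → Prop} {pre post : List V} (h : Topo Adj (pre ++ post))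
    {x u : V} (hx : x ∈ pre) (hu : Relation.TransGen Adj u x) : u ∈ pre := by
  have key : ∀ x ∈ pre, ∀ u, Adj u x → u ∈ pre := by
    intro x hx u hu
    obtain ⟨a, b, rfl⟩ := List.append_of_mem hx
    have h' : Topo Adj (a ++ x :: (b ++ post)) := by simpa using h
    exact List.mem_append_left _ (h'.mem_pre hu)
  induction hu using Relation.TransGen.head_induction_on with
  | single hu => exact key _ hx _ hu
  | head hu _ ih => exact key _ ih _ hu

theorem Topo.of_mem_pre {Adj : V → V → Prop} {σ : List V} (hn : σ.Nodup) (hc : ∀ v, v ∈ σ)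
    (h : ∀ pre x post, σ = pre ++ x :: post → ∀ u, Adj u x → u ∈ pre) : Topo Adj σ := by
  refine ⟨fun v hv => ?_, hn, hc, ?_⟩
  · obtain ⟨a, b, rfl⟩ := List.append_of_mem (hc v)
    have h1 := h a v b rfl v hv
    exact (List.nodup_append.1 hn).2.2 v h1 v (by simp) rfl
  · rw [List.pairwise_iff_getElem]
    intro i j hi hj hij hA
    have e : σ = σ.take i ++ σ[i] :: σ.drop (i + 1) := by
      rw [← List.drop_eq_getElem_cons, List.take_append_drop]
    have h1 := h _ _ _ e _ hA
    obtain ⟨k, hk, hk'⟩ := List.mem_iff_getElem.1 h1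
    rw [List.getElem_take] at hk'
    have := (List.Nodup.getElem_inj_iff hn).1 hk'
    simp at hk
    omega

theorem mem_add (Adj : V → V → Prop) (K : V → Prop) (s s' : V → ℝ) (P : Finset V) :
    mem Adj K (fun u => s u + s' u) P = mem Adj K s P + mem Adj K s' P := by
  unfold mem; rw [Finset.sum_add_distrib]

/-- Only vertices of nonzero size matter. With sizes set to zero outside some set of vertices, two
states or two graphs need to be compared on that set alone; this is how memory is localised to the
block or to its complement. -/
theorem mem_congr_of_ne {Adj Adj' : V → V → Prop} {K K' : V → Prop} {size size' : V → ℝ}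
    {P P' : Finset V} (hs : ∀ u ∈ P, size u ≠ 0 → size' u = size u)
    (hs' : ∀ u ∈ P', size' u ≠ 0 → size' u = size u)
    (h : ∀ u, size u ≠ 0 → ((u ∈ P ∧ (K u ∨ ∃ w, w ∉ P ∧ Adj u w)) ↔
      (u ∈ P' ∧ (K' u ∨ ∃ w, w ∉ P' ∧ Adj' u w)))) :
    mem Adj K size P = mem Adj' K' size' P' := by
  classical
  unfold mem
  rw [← Finset.sum_filter_ne_zero, ← Finset.sum_filter_ne_zero (f := size')]
  refine Finset.sum_congr ?_ fun u hu => ?_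
  · ext u
    simp only [Finset.mem_filter]
    constructor
    · rintro ⟨hu, h0⟩
      exact ⟨(h u h0).1 hu, by rw [hs u hu.1 h0]; exact h0⟩
    · rintro ⟨hu, h0⟩
      have h0' := h0
      rw [hs' u hu.1 h0] at h0
      exact ⟨(h u h0).2 hu, h0⟩
  · simp only [Finset.mem_filter] at hu
    exact (hs' u hu.1.1 hu.2).symm

variable [DecidableEq V]

/-- Memory of the block after its first `i` operations in the order `l`. -/
noncomputable def blockMem (Adj : V → V → Prop) (size : V → ℝ) (v : V) (l : List V) (i : ℕ) : ℝ :=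
  mem Adj (fun _ => False) size ({v} ∪ (l.take i).toFinset)

/-- The order `σ` of the block is at least as good as every other one: if `j` operations have been
executed in the other order, `g j` operations are executed in `σ`. -/
def IsBest (Adj : V → V → Prop) (size w : V → ℝ) (v : V) (I : Finset V) (σ : List V) : Prop :=
  ∀ l, IsOrder Adj I l → ∃ g : ℕ → ℕ, Monotone g ∧ g 0 = 0 ∧ g I.card = I.card ∧
    (∀ j ≤ I.card, blockMem Adj size v σ (g j) ≤ blockMem Adj size v l j) ∧
    ∀ j (hj : j < l.length) i (hi : i < σ.length), g j ≤ i → i < g (j + 1) →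
      blockMem Adj size v σ i + w σ[i] ≤ blockMem Adj size v l j + w l[j]

theorem IsOrder.length {Adj : V → V → Prop} {I : Finset V} {l : List V} (h : IsOrder Adj I l) :
    l.length = I.card := by
  rw [← List.toFinset_card_of_nodup h.nodup]
  congr 1
  ext x
  simp [h.mem_iff]

theorem IsOrder.of_topo {Adj : V → V → Prop} {I : Finset V} {τ : List V} (h : Topo Adj τ) :
    IsOrder Adj I (τ.filter (· ∈ I)) :=
  ⟨h.nodup.filter _, fun x => by simp [h.complete x], h.topological.filter _⟩

/-- Memory used by the outputs of vertices not in the block. -/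
noncomputable def restMem (Adj : V → V → Prop) (K : V → Prop) (size : V → ℝ) (v : V) (I : Finset V)
    (P : Finset V) : ℝ := mem Adj K (fun u => if u ∈ I ∨ u = v then 0 else size u) P

/-- By `in_mem`, a vertex outside the block other than `v` has no out-neighbour in `I`, so the
progress inside `I` does not decide whether its output is still needed. -/
theorem restMem_congr {Adj : V → V → Prop} {K : V → Prop} {size : V → ℝ} {v p : V} {I : Finset V}
    (hI : IsBlock Adj v p I) {P P' : Finset V} (h : ∀ u ∉ I, u ∈ P ↔ u ∈ P') :
    restMem Adj K size v I P = restMem Adj K size v I P' := by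
  refine mem_congr_of_ne (fun _ _ _ => rfl) (fun _ _ _ => rfl) fun u hu => ?_
  have hu : ¬ (u ∈ I ∨ u = v) := fun h => hu (if_pos h)
  have key : ∀ {P P' : Finset V}, (∀ u ∉ I, u ∈ P ↔ u ∈ P') →
      (u ∈ P ∧ (K u ∨ ∃ w, w ∉ P ∧ Adj u w)) → (u ∈ P' ∧ (K u ∨ ∃ w, w ∉ P' ∧ Adj u w)) := by
    intro P P' h hu'
    refine ⟨(h u (fun hi => hu (Or.inl hi))).1 hu'.1, hu'.2.imp_right ?_⟩
    rintro ⟨w, hw, ha⟩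
    have hwI : w ∉ I := fun hwI => hu (hI.in_mem w hwI u ha)
    exact ⟨w, fun hw' => hw ((h w hwI).2 hw'), ha⟩
  exact ⟨key h, key fun u hu => (h u hu).symm⟩

theorem mem_split (Adj : V → V → Prop) (K : V → Prop) (size : V → ℝ) (v : V) (I P : Finset V) :
    mem Adj K size P =
      mem Adj K (fun u => if u ∈ I ∨ u = v then size u else 0) P + restMem Adj K size v I P := by
  rw [restMem, ← mem_add]
  congr 1
  ext u
  by_cases h : u ∈ I ∨ u = v
  · rw [if_pos h, if_pos h, add_zero]
  · rw [if_neg h, if_neg h, zero_add]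

/-- Before `v` the block has produced nothing, and after `p` everything it produced is released,
because all consumers of outputs of `v` and of `I` lie in `I` or are `p`. -/
theorem mem_eq_restMem {Adj : V → V → Prop} {K : V → Prop} {size : V → ℝ} {v p : V} {I : Finset V}
    (hI : IsBlock Adj v p I) (hK : ∀ u, K u → ∀ w, ¬ Adj u w) {P : Finset V}
    (h : (v ∉ P ∧ ∀ x ∈ I, x ∉ P) ∨ (p ∈ P ∧ ∀ x ∈ I, x ∈ P)) :
    mem Adj K size P = restMem Adj K size v I P := by
  have hz : mem Adj K (fun u => if u ∈ I ∨ u = v then size u else 0) P = 0 := by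
    unfold mem
    refine Finset.sum_eq_zero fun u hu => ?_
    simp only [Finset.mem_filter] at hu
    refine if_neg fun hu' => ?_
    rcases h with ⟨h1, h2⟩ | ⟨h1, h2⟩
    · rcases hu' with h3 | rfl
      · exact h2 u h3 hu.1
      · exact h1 hu.1
    · rcases hu.2 with hk | ⟨w, hw, ha⟩
      · rcases hu' with h3 | rfl
        · obtain ⟨w, hw, -⟩ := Relation.TransGen.head'_iff.1 (hI.reach_p u h3)
          exact hK u hk w hw
        · obtain ⟨w, hw, -⟩ := Relation.TransGen.head'_iff.1 hI.reach
          exact hK u hk w hw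
      · have : w ∈ I ∨ w = p := by
          rcases hu' with h3 | rfl
          · exact hI.out_mem u h3 w ha
          · exact hI.out_v w ha
        rcases this with h3 | rfl
        · exact hw (h2 w h3)
        · exact hw h1
  rw [mem_split Adj K size v I, hz, zero_add]

/-- While the block is running, the outputs of `v` and of `I` are consumed only in `I` and by the
pending `p`. Their contribution is therefore a function of the executed part of `I`, whatever has
happened elsewhere. -/
theorem mem_eq_restMem_add {Adj : V → V → Prop} {K : V → Prop} {size : V → ℝ} {v p : V}
    {I : Finset V} (hI : IsBlock Adj v p I) (hK : ∀ u, K u → ∀ w, ¬ Adj u w) {P : Finset V}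
    (hv : v ∈ P) (hp : p ∉ P) {l : List V} {j : ℕ} (hl : ∀ x, x ∈ l.take j ↔ x ∈ P ∧ x ∈ I) :
    mem Adj K size P = restMem Adj K size v I P + blockMem Adj size v l j := by
  have hz : mem Adj K (fun u => if u ∈ I ∨ u = v then size u else 0) P =
      blockMem Adj size v l j := by
    refine mem_congr_of_ne ?_ ?_ fun u hu => ?_
    · intro u _ hu
      split_ifs with h
      · rfl
      · exact absurd (if_neg h) hu
    · intro u hu _
      simp only [Finset.mem_union, Finset.mem_singleton, List.mem_toFinset, hl] at hu
      rw [if_pos]; tauto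
    · have hu : u ∈ I ∨ u = v := by
        by_contra h; exact hu (if_neg h)
      simp only [Finset.mem_union, Finset.mem_singleton, List.mem_toFinset, hl, false_or]
      refine and_congr ?_ ?_
      · rcases hu with h | rfl
        · exact ⟨fun h' => Or.inr ⟨h', h⟩, fun h' => h'.elim (fun h => h ▸ hv) fun h => h.1⟩
        · simp [hv]
      · have : ¬ K u := by
          intro hk
          rcases hu with h3 | rfl
          · obtain ⟨w, hw, -⟩ := Relation.TransGen.head'_iff.1 (hI.reach_p u h3)
            exact hK u hk w hw
          · obtain ⟨w, hw, -⟩ := Relation.TransGen.head'_iff.1 hI.reach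
            exact hK u hk w hw
        simp only [this, false_or]
        refine exists_congr fun w => and_congr_left fun ha => not_congr ?_
        have : w ∈ I ∨ w = p := by
          rcases hu with h3 | rfl
          · exact hI.out_mem u h3 w ha
          · exact hI.out_v w ha
        rcases this with h | rfl
        · constructor
          · intro h'; exact Or.inr ⟨h', h⟩
          · rintro (rfl | h'); exacts [hv, h'.1]
        · constructor
          · intro h'; exact absurd h' hp
          · rintro (h | h'); exacts [absurd h.symm hI.ne, h'.1]
  rw [mem_split Adj K size v I, hz, add_comm]

theorem prof_head (m : Finset V → ℝ) (w : V → ℝ) (P : Finset V) (l : List V) :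
    ∃ X, prof m w P l = m P :: X := by
  cases l <;> exact ⟨_, rfl⟩

/-- One operation is simulated by a block of operations. -/
theorem dom_block {m : Finset V → ℝ} {w : V → ℝ} {D : ℝ} {Y rest : List V} {Q : Finset V} :
    ∀ (blk : List V) (P : Finset V), m P ≤ D →
      (∀ b₁ y b₂, blk = b₁ ++ y :: b₂ →
        m (P ∪ b₁.toFinset) + w y ≤ D ∧ m (insert y (P ∪ b₁.toFinset)) ≤ D) →
      Dom (prof m w (P ∪ blk.toFinset) rest) (prof m w Q Y) →
      Dom (prof m w P (blk ++ rest)) (D :: prof m w Q Y) := by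
  intro blk
  induction blk with
  | nil =>
    intro P hP _ hd
    rw [List.toFinset_nil, Finset.union_empty] at hd
    rw [List.nil_append]
    obtain ⟨X, hX⟩ := prof_head m w P rest
    rw [hX] at hd ⊢
    exact .right hP hd
  | cons y blk ih =>
    intro P hP hD hd
    have h0 := hD [] y blk rfl
    simp only [List.toFinset_nil, Finset.union_empty] at h0
    rw [List.cons_append, prof]
    refine .left hP (.left h0.1 (ih _ h0.2 ?_ ?_))
    · intro b₁ z b₂ e
      have := hD (y :: b₁) z b₂ (by rw [e]; rfl)
      simpa only [List.toFinset_cons, Finset.union_insert, Finset.insert_union] using this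
    · simpa only [List.toFinset_cons, Finset.union_insert, Finset.insert_union] using hd

end Exchange
end PeakMem

/-! ### Exchanging the order of a block inside a schedule -/

namespace PeakMem

section Exchange

variable {V : Type*}

theorem IsBlock.v_mem {Adj : V → V → Prop} {v p : V} {I : Finset V} (hI : IsBlock Adj v p I)
    {pre post : List V} (h : Topo Adj (pre ++ post)) {x : V} (hx : x ∈ pre) (hxI : x ∈ I) :
    v ∈ pre := h.mem_of_transGen hx (hI.reach_v x hxI)

theorem IsBlock.mem_of_p {Adj : V → V → Prop} {v p : V} {I : Finset V} (hI : IsBlock Adj v p I)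
    {pre post : List V} (h : Topo Adj (pre ++ post)) (hp : p ∈ pre) {x : V} (hxI : x ∈ I) :
    x ∈ pre := h.mem_of_transGen hp (hI.reach_p x hxI)

theorem getElem?_path {v p : V} {σ : List V} (i : ℕ) :
    (v :: (σ ++ [p]))[i]? = if i = 0 then some v else if h : i - 1 < σ.length then some σ[i - 1]
      else if i = σ.length + 1 then some p else none := by
  rcases i with _ | i
  · simp
  · simp only [List.getElem?_cons_succ, Nat.add_eq_zero_iff, one_ne_zero, and_false, if_false,
      Nat.add_sub_cancel]
    split_ifs with h1 h2
    · rw [List.getElem?_append_left h1, List.getElem?_eq_getElem h1]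
    · have : i = σ.length := by omega
      subst this; simp
    · rw [List.getElem?_append_right (by omega)]
      rw [List.getElem?_eq_none]
      simp; omega

/-- The edges of the path `v, σ, p`. -/
theorem consec_path {v p : V} {σ : List V} (hn : (v :: (σ ++ [p])).Nodup) {a b : V} :
    Consec (v :: (σ ++ [p])) a b →
    ((a = v ∨ a ∈ σ) ∧ (b = p ∨ b ∈ σ)) ∧
    (∀ i (hi : i < σ.length), b = σ[i] → a = v ∨ a ∈ σ.take i) := by
  rintro ⟨i, ha, hb⟩
  have hinj : ∀ j, (v :: (σ ++ [p]))[j]? = some b → j = i + 1 := by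
    intro j hj
    obtain ⟨h1, h2⟩ := List.getElem?_eq_some_iff.1 hj
    obtain ⟨h3, h4⟩ := List.getElem?_eq_some_iff.1 hb
    exact (List.Nodup.getElem_inj_iff hn).1 (h2.trans h4.symm)
  constructor
  · rw [getElem?_path] at ha hb
    constructor
    · split_ifs at ha with h1 h2 h3
      · left; simpa using ha.symm
      · right
        rw [← Option.some.inj ha]
        exact List.getElem_mem _
      · simp only [Nat.add_eq_zero_iff, one_ne_zero, and_false, if_false] at hb
        rw [dif_neg (by omega), if_neg (by omega)] at hb
        exact absurd hb (by simp)
    · simp only [Nat.add_eq_zero_iff, one_ne_zero, and_false, if_false] at hb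
      split_ifs at hb with h1 h2
      · right
        rw [← Option.some.inj hb]
        exact List.getElem_mem _
      · left; simpa using hb.symm
  · intro k hk e
    have := hinj (k + 1) (by
      rw [getElem?_path, if_neg (by omega), dif_pos (by simpa using hk), e]; simp)
    obtain rfl : k = i := by omega
    rw [getElem?_path] at ha
    split_ifs at ha with h1 h2 h3
    · left; simpa using ha.symm
    · right
      rw [← Option.some.inj ha]
      rw [List.mem_take_iff_getElem]
      exact ⟨k - 1, by omega, rfl⟩
    · omega

theorem IsBlock.nodup_path {Adj : V → V → Prop} {v p : V} {I : Finset V} (hI : IsBlock Adj v p I)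
    {σ : List V} (hσ : IsOrder Adj I σ) : (v :: (σ ++ [p])).Nodup := by
  have hv := hI.v_notMem
  have hp := hI.p_notMem
  simp only [List.nodup_cons, List.mem_append, List.mem_singleton, hσ.mem_iff, List.nodup_append,
    hσ.nodup, hI.ne, hv]
  simp only [or_self, not_false_eq_true, List.not_mem_nil, List.nodup_nil, and_self, true_and]
  rintro a ha b rfl rfl
  exact hp ha

variable [DecidableEq V]

/-- Replace the `j`-th element of `l` by the elements of `σ` in the positions from `g j` up to
`g (j + 1)`. -/
def subst (I : Finset V) (l σ : List V) (g : ℕ → ℕ) (x : V) : List V :=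
  if x ∈ I then (σ.take (g (l.idxOf x + 1))).drop (g (l.idxOf x)) else [x]

/-- The stretches of `σ` from `g j` to `g (j + 1)` follow one another without gaps because `g` is
monotone and starts at `0`; vertices outside `I` are copied unchanged. -/
theorem subst_filter {Adj : V → V → Prop} {I : Finset V} {σ τ : List V} {g : ℕ → ℕ}
    (hg : Monotone g) (h0 : g 0 = 0) (hσ : IsOrder Adj I σ) (hn : τ.Nodup) :
    ∀ pre post, τ = pre ++ post →
      (pre.flatMap (subst I (τ.filter (· ∈ I)) σ g)).filter (· ∈ I) =
        σ.take (g (pre.filter (· ∈ I)).length) ∧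
      (pre.flatMap (subst I (τ.filter (· ∈ I)) σ g)).filter (· ∉ I) = pre.filter (· ∉ I) := by
  intro pre
  induction pre using List.reverseRecOn with
  | nil => intro post _; simp [h0]
  | append_singleton pre x ih =>
    intro post e
    have ih := ih (x :: post) (by rw [e]; simp)
    simp only [List.flatMap_append, List.flatMap_singleton, List.filter_append]
    rw [ih.1, ih.2]
    by_cases hx : x ∈ I
    · have hidx : (τ.filter (· ∈ I)).idxOf x = (pre.filter (· ∈ I)).length := by
        rw [e, List.filter_append, List.filter_append, List.append_assoc, List.idxOf_append_of_notMem]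
        · simp [hx]
        · intro h
          rw [e] at hn
          have := List.nodup_append.1 (List.nodup_append.1 hn).1
          exact this.2.2 x (List.mem_of_mem_filter h) x (by simp) rfl
      have hsub : subst I (τ.filter (· ∈ I)) σ g x =
          (σ.take (g ((pre.filter (· ∈ I)).length + 1))).drop (g (pre.filter (· ∈ I)).length) := by
        rw [subst, if_pos hx, hidx]
      rw [hsub]
      set j := (pre.filter (· ∈ I)).length
      have hmem : ∀ y ∈ (σ.take (g (j + 1))).drop (g j), y ∈ I := fun y hy =>
        (hσ.mem_iff y).1 (List.mem_of_mem_take (List.mem_of_mem_drop hy))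
      have hnil : ((σ.take (g (j + 1))).drop (g j)).filter (· ∉ I) = [] :=
        List.filter_eq_nil_iff.2 (by simpa using hmem)
      rw [List.filter_eq_self.2 (by simpa using hmem), hnil]
      constructor
      · have h1 : σ.take (g j) = (σ.take (g (j + 1))).take (g j) := by
          rw [List.take_take, min_eq_left (hg (Nat.le_succ j))]
        have h2 : ([x].filter (· ∈ I)) = [x] := by simp [hx]
        rw [h1, List.take_append_drop, h2, List.length_append]
        rfl
      · simp [hx]
    · simp [subst, hx]

theorem subst_mem {Adj : V → V → Prop} {I : Finset V} {σ τ : List V} {g : ℕ → ℕ}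
    (hg : Monotone g) (h0 : g 0 = 0) (hσ : IsOrder Adj I σ) (hn : τ.Nodup) {pre post : List V}
    (e : τ = pre ++ post) {u : V} :
    u ∈ pre.flatMap (subst I (τ.filter (· ∈ I)) σ g) ↔
      (u ∈ I ∧ u ∈ σ.take (g (pre.filter (· ∈ I)).length)) ∨ (u ∉ I ∧ u ∈ pre) := by
  have h := subst_filter hg h0 hσ hn pre post e
  by_cases hu : u ∈ I
  · have := congrArg (u ∈ ·) h.1
    simp [hu] at this
    simp [hu, this]
  · have := congrArg (u ∈ ·) h.2
    simp [hu] at this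
    simp [hu, this]

/-- Elements of `I` are inserted only in places where `τ` has elements of `I`, hence between `v` and
`p`, and they occur in the order `σ`. So all edges of the path are respected. The surviving old
edges that end outside `I` keep their order, and none ends in `I`, because edges into `I` start in
`I` or at `v`. -/
theorem subst_topo {Adj : V → V → Prop} {v p : V} {I : Finset V} (hI : IsBlock Adj v p I)
    {σ τ : List V} {g : ℕ → ℕ} (hg : Monotone g) (h0 : g 0 = 0) (h1 : g I.card = I.card)
    (hσ : IsOrder Adj I σ) (hτ : Topo Adj τ) :
    Topo (relink Adj v p I σ) (τ.flatMap (subst I (τ.filter (· ∈ I)) σ g)) := by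
  set B := subst I (τ.filter (· ∈ I)) σ g with hB
  have hf := subst_filter hg h0 hσ hτ.nodup
  have hl : IsOrder Adj I (τ.filter (· ∈ I)) := .of_topo hτ
  have hperm : (τ.flatMap B).Perm τ := by
    have e := hf τ [] (by simp)
    have h2 : ((τ.flatMap B).filter (· ∈ I)).Perm (τ.filter (· ∈ I)) := by
      rw [e.1, hl.length, h1, ← hσ.length, List.take_length]
      exact (List.perm_ext_iff_of_nodup hσ.nodup hl.nodup).2 fun a => by rw [hσ.mem_iff, hl.mem_iff]
    have h3 := (List.filter_append_perm (· ∈ I) (τ.flatMap B)).symm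
    have h4 := (List.filter_append_perm (· ∈ I) τ)
    refine h3.trans (List.Perm.trans ?_ h4)
    have e2 := e.2
    simp only [decide_not] at e2
    rw [e2]
    exact h2.append_right _
  refine Topo.of_mem_pre (hperm.nodup_iff.2 hτ.nodup) (fun u => hperm.mem_iff.2 (hτ.complete u)) ?_
  have hnp := hI.nodup_path hσ
  -- prefixes which are unions of blocks are closed
  have key : ∀ pre post, τ = pre ++ post → ∀ a x b, pre.flatMap B = a ++ x :: b →
      ∀ u, relink Adj v p I σ u x → u ∈ a := by
    intro pre
    induction pre using List.reverseRecOn with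
    | nil => intro post _ a x b h; simp at h
    | append_singleton pre y ih =>
      intro post e a x b h u hu
      have e' : τ = pre ++ y :: post := by rw [e]; simp
      rw [List.flatMap_append, List.flatMap_singleton] at h
      have hcase : (∃ c, a = pre.flatMap B ++ c ∧ B y = c ++ x :: b) ∨
          ∃ c, pre.flatMap B = a ++ x :: c := by
        rcases List.append_eq_append_iff.1 h with ⟨c, hc, hc'⟩ | ⟨c, hc, hc'⟩
        · exact Or.inl ⟨c, hc, hc'⟩
        · rcases c with _ | ⟨z, c⟩
          · exact Or.inl ⟨[], by simpa using hc.symm, by simpa using hc'.symm⟩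
          · simp only [List.cons_append, List.cons.injEq] at hc'
            exact Or.inr ⟨c, by rw [hc'.1]; exact hc⟩
      rcases hcase with ⟨c, hc, hc'⟩ | ⟨c, hc⟩
      · -- `x` lies in the last block
        have hpre : ∀ z ∈ pre.flatMap B, z ∈ a := fun z hz => by rw [hc]; simp [hz]
        have hm := fun {u} => subst_mem (u := u) hg h0 hσ hτ.nodup e'
        by_cases hy : y ∈ I
        · have hvpre : v ∈ pre := by
            have : v ∈ pre ++ [y] := hI.v_mem (e ▸ hτ) (by simp) hy
            rcases List.mem_append.1 this with h | h
            · exact h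
            · rw [List.mem_singleton.1 h] at hI; exact absurd hy hI.v_notMem
          have hva : v ∈ a := hpre _ (hm.2 (Or.inr ⟨hI.v_notMem, hvpre⟩))
          have hxI : x ∈ σ := by
            have : x ∈ B y := by rw [hc']; simp
            rw [hB, subst, if_pos hy] at this
            exact List.mem_of_mem_take (List.mem_of_mem_drop this)
          have hu' : Consec (v :: (σ ++ [p])) u x := by
            rcases hu with ⟨h1, h2, h3⟩ | h
            · exact absurd (hI.in_mem x ((hσ.mem_iff x).1 hxI) u h3) (by tauto)
            · exact h
          -- the elements of `I` in `a ++ [x]` form an initial segment of `σ`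
          have hfil := (hf (pre ++ [y]) post e).1
          rw [List.flatMap_append, List.flatMap_singleton, h, List.filter_append,
            List.filter_cons_of_pos (by simpa using (hσ.mem_iff x).1 hxI)] at hfil
          obtain ⟨r, hr⟩ : ∃ r, σ = a.filter (· ∈ I) ++ x :: r := by
            have h7 := (List.take_append_drop (g ((pre ++ [y]).filter (· ∈ I)).length) σ).symm
            rw [← hfil, List.append_assoc, List.cons_append] at h7
            exact ⟨_, h7⟩
          have hlen : (a.filter (· ∈ I)).length < σ.length := by
            conv_rhs => rw [hr]
            simp
          have := (consec_path hnp hu').2 _ hlen (by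
            simp only [hr]
            rw [List.getElem_append_right (by simp)]
            simp)
          rcases this with rfl | h
          · exact hva
          · have e3 : σ.take (a.filter (· ∈ I)).length = a.filter (· ∈ I) := by
              conv_lhs => rw [hr]
              simp
            rw [e3] at h
            exact List.mem_of_mem_filter h
        · have hBy : B y = [y] := by rw [hB, subst, if_neg hy]
          rw [hBy] at hc'
          obtain ⟨rfl, rfl⟩ : c = [] ∧ x = y := by
            rcases c with _ | ⟨z, c⟩
            · simp at hc'; exact ⟨rfl, hc'.1.symm⟩
            · simp at hc'
          refine hpre _ (hm.2 ?_)
          have hadj : Adj u x → u ∈ pre := fun h => (e' ▸ hτ).mem_pre h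
          rcases hu with ⟨h1, h2, h3⟩ | h
          · exact Or.inr ⟨h1, hadj h3⟩
          · obtain ⟨⟨h1, h2⟩, -⟩ := consec_path hnp h
            rw [hσ.mem_iff] at h1 h2
            obtain rfl := h2.resolve_right hy
            have htr : ∀ u, Relation.TransGen Adj u x → u ∈ pre := by
              intro u hu
              have hmem : u ∈ pre ++ [x] := (e ▸ hτ).mem_of_transGen (by simp) hu
              rcases List.mem_append.1 hmem with h | h
              · exact h
              · obtain rfl := List.mem_singleton.1 h
                obtain ⟨z, hz1, hz⟩ := Relation.TransGen.tail'_iff.1 hu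
                have h1 : z ∈ pre := (e' ▸ hτ).mem_pre hz
                rcases hz1.cases_head with rfl | ⟨z', hz', -⟩
                · exact h1
                · have h5 : Relation.TransGen Adj u z := by
                    rcases Relation.reflTransGen_iff_eq_or_transGen.1 hz1 with h | h
                    · rw [h] at hz; exact absurd hz (hτ.irrefl _)
                    · exact h
                  exact (e' ▸ hτ).mem_of_transGen h1 h5
            rcases h1 with rfl | h1
            · exact Or.inr ⟨hI.v_notMem, htr _ hI.reach⟩
            · refine Or.inl ⟨h1, ?_⟩
              have hall : pre.filter (· ∈ I) = τ.filter (· ∈ I) := by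
                have : (x :: post).filter (· ∈ I) = [] := by
                  rw [List.filter_eq_nil_iff]
                  intro z hz hzI
                  simp only [decide_eq_true_eq] at hzI
                  have h6 := htr z (hI.reach_p z hzI)
                  exact (List.nodup_append.1 (e' ▸ hτ.nodup)).2.2 z h6 z hz rfl
                conv_rhs => rw [e']
                rw [List.filter_append, this, List.append_nil]
              rw [hall, hl.length, ‹g I.card = I.card›, ← hσ.length, List.take_length, hσ.mem_iff]
              exact h1
      · exact ih _ e' a _ c hc u hu
  intro a x b h
  exact key τ [] (by simp) a x b h

/-- The inequality `mem_insert_le` applied to the block alone. It is applicable because the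
in-neighbours of `σ[i]` are `v` or earlier members of `σ`. -/
theorem blockMem_succ_le [Fintype V] (G : CompGraph V) {v p : V} {I : Finset V}
    (hI : IsBlock G.graph.Adj v p I) {σ : List V} (hσ : IsOrder G.graph.Adj I σ) {i : ℕ}
    (hi : i < σ.length) : blockMem G.graph.Adj G.size v σ (i + 1) ≤
      blockMem G.graph.Adj G.size v σ i + (G.size σ[i] + G.scratch σ[i]) := by
  have e5 : ({v} ∪ (σ.take (i + 1)).toFinset : Finset V) =
      insert σ[i] ({v} ∪ (σ.take i).toFinset) := by
    ext u
    simp only [Finset.mem_union, Finset.mem_singleton, List.mem_toFinset,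
      List.take_succ_eq_append_getElem hi, List.mem_append, Finset.mem_insert, List.mem_singleton]
    tauto
  have hyI : σ[i] ∈ I := (hσ.mem_iff _).1 (List.getElem_mem _)
  rw [blockMem, blockMem, e5]
  have hsplit : σ = σ.take i ++ σ[i] :: σ.drop (i + 1) := by
    rw [← List.drop_eq_getElem_cons, List.take_append_drop]
  generalize σ[i] = y at *
  have hynot : y ∉ σ.take i := by
    intro h
    have := hσ.nodup
    rw [hsplit] at this
    exact (List.nodup_append.1 this).2.2 y h y (by simp) rfl
  refine mem_insert_le G.size_nonneg (by simp) (fun u hu => ?_) ?_ ?_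
  · simp only [Finset.mem_union, Finset.mem_singleton, List.mem_toFinset]
    rcases hI.in_mem y hyI u hu with h | h
    · right
      rw [← hσ.mem_iff] at h
      have htop := hσ.topological
      rw [hsplit] at h htop
      rw [List.pairwise_append, List.pairwise_cons] at htop
      rcases List.mem_append.1 h with h | h
      · exact h
      · rcases List.mem_cons.1 h with rfl | h
        · exact absurd (.single hu) (G.acyclic _)
        · exact absurd hu (htop.2.1.1 u h)
    · exact Or.inl h
  · simp only [Finset.mem_union, Finset.mem_singleton, List.mem_toFinset, hynot, or_false]
    rintro rfl; exact hI.v_notMem hyI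
  · convert G.neg_release_le_scratch y

/-- The simulation goes operation by operation. A vertex outside `I` is simulated by itself. For the
`j`-th vertex of `I` in `τ`, the bunch of `σ` from `g j` to `g (j + 1)` is executed while the
pointer of `τ` stands at the entry during that vertex: the rest contributes the same amount
throughout, and `hD` bounds the block part. Between operations `hA` compares the states. The set `K`
is left open to cover the full and the internal profile. -/
theorem subst_dom [Fintype V] (G : CompGraph V) {v p : V} {I : Finset V}
    (hI : IsBlock G.graph.Adj v p I) {σ τ : List V} {g : ℕ → ℕ} (hg : Monotone g) (h0 : g 0 = 0)
    (h1 : g I.card = I.card) (hσ : IsOrder G.graph.Adj I σ) (hτ : Topo G.graph.Adj τ)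
    (hA : ∀ j ≤ I.card, blockMem G.graph.Adj G.size v σ (g j) ≤
      blockMem G.graph.Adj G.size v (τ.filter (· ∈ I)) j)
    (hD : ∀ j (hj : j < (τ.filter (· ∈ I)).length) i (hi : i < σ.length), g j ≤ i → i < g (j + 1) →
      blockMem G.graph.Adj G.size v σ i + (G.size σ[i] + G.scratch σ[i]) ≤
        blockMem G.graph.Adj G.size v (τ.filter (· ∈ I)) j +
          (G.size (τ.filter (· ∈ I))[j] + G.scratch (τ.filter (· ∈ I))[j]))
    (K : V → Prop) (hK : ∀ u, K u → ∀ w, ¬ G.graph.Adj u w) :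
    ∀ post pre, τ = pre ++ post →
      Dom (prof (mem G.graph.Adj K G.size) (fun x => G.size x + G.scratch x)
          (pre.flatMap (subst I (τ.filter (· ∈ I)) σ g)).toFinset
          (post.flatMap (subst I (τ.filter (· ∈ I)) σ g)))
        (prof (mem G.graph.Adj K G.size) (fun x => G.size x + G.scratch x) pre.toFinset post) := by
  set l := τ.filter (· ∈ I) with hl'
  have hl : IsOrder G.graph.Adj I l := .of_topo hτ
  set B := subst I l σ g with hB
  set m := mem G.graph.Adj K G.size with hm
  set w : V → ℝ := fun x => G.size x + G.scratch x with hw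
  have hw0 : ∀ x, 0 ≤ w x := fun x => by
    have := G.neg_size_le_scratch x
    simp only [hw]; linarith
  have hmem : ∀ {pre post}, τ = pre ++ post → ∀ u, u ∈ pre.flatMap B ↔
      (u ∈ I ∧ u ∈ σ.take (g (pre.filter (· ∈ I)).length)) ∨ (u ∉ I ∧ u ∈ pre) :=
    fun e u => subst_mem hg h0 hσ hτ.nodup e
  have hlt : ∀ {pre post}, τ = pre ++ post → ∀ u,
      u ∈ l.take (pre.filter (· ∈ I)).length ↔ u ∈ pre ∧ u ∈ I := by
    intro pre post e u
    rw [hl', e, List.filter_append, List.take_left']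
    · simp
    · rfl
  have hcnt : ∀ {pre post}, τ = pre ++ post → (pre.filter (· ∈ I)).length ≤ I.card := by
    intro pre post e
    rw [← hl.length, hl', e, List.filter_append, List.length_append]
    omega
  have hrest : ∀ {pre post}, τ = pre ++ post → ∀ P : Finset V,
      (∀ u ∉ I, u ∈ P ↔ u ∈ pre) →
      restMem G.graph.Adj K G.size v I P = restMem G.graph.Adj K G.size v I pre.toFinset := by
    intro pre post e P h
    exact restMem_congr hI fun u hu => by rw [h u hu, List.mem_toFinset]
  -- Comparison at corresponding times. Before `v` and after `p` only the rest counts and the two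
  -- sides are equal; in between, the block parts are compared by `hA`.
  have hmle : ∀ {pre post}, τ = pre ++ post → m (pre.flatMap B).toFinset ≤ m pre.toFinset := by
    intro pre post e
    have hr := hrest e (pre.flatMap B).toFinset fun u hu => by
      rw [List.mem_toFinset, hmem e]; tauto
    by_cases hv : v ∈ pre
    · by_cases hp : p ∈ pre
      · rw [hm, mem_eq_restMem hI hK (Or.inr ⟨?_, ?_⟩), mem_eq_restMem hI hK (Or.inr ⟨?_, ?_⟩), hr]
        · rw [List.mem_toFinset]; exact hp
        · intro x hx
          rw [List.mem_toFinset]; exact hI.mem_of_p (e ▸ hτ) hp hx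
        · rw [List.mem_toFinset, hmem e]; exact Or.inr ⟨hI.p_notMem, hp⟩
        · intro x hx
          rw [List.mem_toFinset, hmem e]
          refine Or.inl ⟨hx, ?_⟩
          have hall : pre.filter (· ∈ I) = l := by
            have : post.filter (· ∈ I) = [] := by
              rw [List.filter_eq_nil_iff]
              intro z hz hzI
              simp only [decide_eq_true_eq] at hzI
              have h6 := hI.mem_of_p (e ▸ hτ) hp hzI
              exact (List.nodup_append.1 (e ▸ hτ.nodup)).2.2 z h6 z hz rfl
            rw [hl', e, List.filter_append, this, List.append_nil]
          rw [hall, hl.length, h1, ← hσ.length, List.take_length, hσ.mem_iff]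
          exact hx
      · have hp' : p ∉ (pre.flatMap B).toFinset := by
          rw [List.mem_toFinset, hmem e]
          rintro (h | h)
          exacts [hI.p_notMem h.1, hp h.2]
        have hv' : v ∈ (pre.flatMap B).toFinset := by
          rw [List.mem_toFinset, hmem e]; exact Or.inr ⟨hI.v_notMem, hv⟩
        rw [hm, mem_eq_restMem_add hI hK hv' hp' (l := σ) (j := g (pre.filter (· ∈ I)).length),
          mem_eq_restMem_add hI hK (by simpa using hv) (by simpa using hp) (l := l)
          (j := (pre.filter (· ∈ I)).length), hr]
        · have := hA _ (hcnt e)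
          linarith
        · intro x; rw [hlt e, List.mem_toFinset]
        · intro x
          rw [List.mem_toFinset, hmem e]
          have : x ∈ σ.take (g (pre.filter (· ∈ I)).length) → x ∈ I := fun h =>
            (hσ.mem_iff x).1 (List.mem_of_mem_take h)
          tauto
    · have hn : ∀ x ∈ I, x ∉ pre := fun x hx h => hv (hI.v_mem (e ▸ hτ) h hx)
      rw [hm, mem_eq_restMem hI hK (Or.inl ⟨?_, ?_⟩), mem_eq_restMem hI hK (Or.inl ⟨?_, ?_⟩), hr]
      · rw [List.mem_toFinset]; exact hv
      · intro x hx
        rw [List.mem_toFinset]; exact hn x hx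
      · rw [List.mem_toFinset, hmem e]
        rintro (h | h)
        exacts [hI.v_notMem h.1, hv h.2]
      · intro x hx
        rw [List.mem_toFinset, hmem e]
        have : pre.filter (· ∈ I) = [] := by
          rw [List.filter_eq_nil_iff]
          intro z hz hzI
          exact hn z (by simpa using hzI) hz
        rw [this, List.length_nil, h0]
        simp [hx]
  intro post
  induction post with
  | nil =>
    intro pre e
    exact .single (hmle e)
  | cons x post ih =>
    intro pre e
    have e' : τ = (pre ++ [x]) ++ post := by rw [e]; simp
    have ih := ih (pre ++ [x]) e'
    rw [List.flatMap_append, List.flatMap_singleton, List.toFinset_append, List.toFinset_append,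
      List.toFinset_cons, List.toFinset_nil, insert_empty_eq, Finset.union_comm pre.toFinset,
      ← Finset.insert_eq] at ih
    rw [prof, List.flatMap_cons]
    have hx : x ∉ pre.toFinset := by
      rw [List.mem_toFinset]
      intro h
      exact (List.nodup_append.1 (e ▸ hτ.nodup)).2.2 x h x (by simp) rfl
    have hstep : m (insert x pre.toFinset) ≤ m pre.toFinset + w x := by
      refine mem_insert_le G.size_nonneg hK (fun u hu => ?_) hx ?_
      · rw [List.mem_toFinset]; exact (e ▸ hτ).mem_pre hu
      · convert G.neg_release_le_scratch x
    have hle := hmle e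
    have hup : m (pre.flatMap B).toFinset ≤ m pre.toFinset + w x :=
      hle.trans (by have := hw0 x; linarith)
    have hd := dom_block (rest := post.flatMap B) (B x) _ hup (fun b₁ y b₂ hb => ?_) ih
    · obtain ⟨X, hX⟩ := prof_head m w (pre.flatMap B).toFinset (B x ++ post.flatMap B)
      rw [hX] at hd ⊢
      exact .right hle hd
    · by_cases hxI : x ∈ I
      · have hv : v ∈ pre := by
          have : v ∈ pre ++ [x] := hI.v_mem (e' ▸ hτ) (by simp) hxI
          rcases List.mem_append.1 this with h | h
          · exact h
          · rw [List.mem_singleton.1 h] at hI; exact absurd hxI hI.v_notMem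
        have hp : p ∉ pre := by
          intro h
          exact hx (List.mem_toFinset.2 (hI.mem_of_p (e ▸ hτ) h hxI))
        set j := (pre.filter (· ∈ I)).length with hj
        have hle' : l = pre.filter (· ∈ I) ++ x :: post.filter (· ∈ I) := by
          rw [hl', e, List.filter_append, List.filter_cons_of_pos (by simpa using hxI)]
        have hjl : j < l.length := by
          have := congrArg List.length hle'
          simp at this; omega
        have hlj : l[j] = x := by
          simp only [hle']
          rw [List.getElem_append_right (by simp [hj])]
          simp [hj]
        have hBx : B x = (σ.take (g (j + 1))).drop (g j) := by
          have hidx : l.idxOf x = j := by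
            have := List.Nodup.idxOf_getElem hl.nodup j hjl
            rwa [hlj] at this
          rw [hB, subst, if_pos hxI, hidx]
        set i := g j + b₁.length with hi
        have hlen := congrArg List.length (hBx.symm.trans hb)
        simp only [List.length_drop, List.length_take, List.length_append, List.length_cons] at hlen
        have hiσ : i < σ.length := by omega
        have hig : i < g (j + 1) := by omega
        have hy : σ[i] = y := by
          have h3 : (B x)[b₁.length]? = some y := by rw [hb]; simp
          rw [hBx, List.getElem?_drop, List.getElem?_take_of_lt hig,
            List.getElem?_eq_getElem hiσ] at h3
          exact Option.some.inj h3
        have hb1 : b₁ = (σ.take i).drop (g j) := by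
          have h3 : (B x).take b₁.length = b₁ := by rw [hb]; simp
          rw [← h3, hBx, List.take_drop, List.take_take, ← hi, min_eq_left hig.le]
        have hP : ∀ u, u ∈ (pre.flatMap B).toFinset ∪ b₁.toFinset ↔
            (u ∈ I ∧ u ∈ σ.take i) ∨ (u ∉ I ∧ u ∈ pre) := by
          intro u
          have h4 : σ.take i = σ.take (g j) ++ b₁ := by
            rw [hb1]
            conv_lhs => rw [← List.take_append_drop (g j) (σ.take i)]
            rw [List.take_take, min_eq_left (by omega)]
          have h5 : u ∈ b₁ → u ∈ I := fun h => by
            rw [hb1] at h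
            exact (hσ.mem_iff u).1 (List.mem_of_mem_take (List.mem_of_mem_drop h))
          rw [Finset.mem_union, List.mem_toFinset, List.mem_toFinset, hmem e, h4, List.mem_append]
          tauto
        have hσt : ∀ {u i}, u ∈ σ.take i → u ∈ I := fun h =>
            (hσ.mem_iff _).1 (List.mem_of_mem_take h)
        have hyI : y ∈ I := by rw [← hy]; exact (hσ.mem_iff _).1 (List.getElem_mem _)
        have hm1 : m ((pre.flatMap B).toFinset ∪ b₁.toFinset) =
            restMem G.graph.Adj K G.size v I pre.toFinset + blockMem G.graph.Adj G.size v σ i := by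
          rw [hm, mem_eq_restMem_add hI hK (l := σ) (j := i), hrest e]
          · intro u hu; rw [hP]; tauto
          · rw [hP]; exact Or.inr ⟨hI.v_notMem, hv⟩
          · rw [hP]
            rintro (h | h)
            exacts [hI.p_notMem h.1, hp h.2]
          · intro u; rw [hP]
            have := @hσt u i
            tauto
        have htake : ∀ u, u ∈ σ.take (i + 1) ↔ u = y ∨ u ∈ σ.take i := by
          intro u
          rw [List.take_succ_eq_append_getElem hiσ, hy]
          simp [or_comm]
        have hm2 : m (insert y ((pre.flatMap B).toFinset ∪ b₁.toFinset)) =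
            restMem G.graph.Adj K G.size v I pre.toFinset +
              blockMem G.graph.Adj G.size v σ (i + 1) := by
          have hyv : v ≠ y := by rintro rfl; exact hI.v_notMem hyI
          have hyp : p ≠ y := by rintro rfl; exact hI.p_notMem hyI
          rw [hm, mem_eq_restMem_add hI hK (l := σ) (j := i + 1), hrest e]
          · intro u hu
            rw [Finset.mem_insert, hP]
            have : u ≠ y := by rintro rfl; exact hu hyI
            tauto
          · rw [Finset.mem_insert, hP]; exact Or.inr (Or.inr ⟨hI.v_notMem, hv⟩)
          · rw [Finset.mem_insert, hP]
            rintro (h | h | h)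
            exacts [hyp h, hI.p_notMem h.1, hp h.2]
          · intro u; rw [Finset.mem_insert, hP, htake]
            have := @hσt u i
            constructor
            · rintro (rfl | h)
              · exact ⟨Or.inl rfl, hyI⟩
              · exact ⟨Or.inr (Or.inl ⟨this h, h⟩), this h⟩
            · tauto
        have hm3 : m pre.toFinset =
            restMem G.graph.Adj K G.size v I pre.toFinset + blockMem G.graph.Adj G.size v l j := by
          rw [hm, mem_eq_restMem_add hI hK (l := l) (j := j)]
          · simpa using hv
          · simpa using hp
          · intro u; rw [hlt e, List.mem_toFinset]
        -- `hD` bounds the entry during `y`, and the entry after `y` is at most that one by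
        -- `blockMem_succ_le`.
        have h8 := hD j hjl i hiσ (by omega) hig
        rw [hy] at h8
        simp only [hlj] at h8
        have h9 := blockMem_succ_le G hI hσ hiσ
        rw [hy] at h9
        rw [hm1, hm2, hm3]
        simp only [hw]
        constructor <;> linarith
      · have hBx : B x = [x] := by rw [hB, subst, if_neg hxI]
        rw [hBx] at hb
        obtain ⟨rfl, rfl⟩ : b₁ = [] ∧ y = x := by
          rcases b₁ with _ | ⟨z, c⟩
          · simp at hb; exact ⟨rfl, hb.1.symm⟩
          · simp at hb
        rw [List.toFinset_nil, Finset.union_empty]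
        refine ⟨by linarith, ?_⟩
        have h7 := hmle e'
        rw [List.flatMap_append, List.flatMap_singleton, hBx, List.toFinset_append,
          List.toFinset_append, List.toFinset_cons, List.toFinset_nil, insert_empty_eq,
          Finset.union_comm pre.toFinset, ← Finset.insert_eq, Finset.union_comm,
          ← Finset.insert_eq] at h7
        exact h7.trans hstep

end Exchange
end PeakMem

/-! ### Topological orderings and the relinked graph -/

namespace PeakMem

section Relink

variable {V : Type*}

theorem Topo.mem_pre_of_transGen {Adj : V → V → Prop} {pre post : List V} {x u : V}
    (h : Topo Adj (pre ++ x :: post)) (hu : Relation.TransGen Adj u x) : u ∈ pre := by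
  obtain ⟨z, h1, hz⟩ := Relation.TransGen.tail'_iff.1 hu
  have hz := h.mem_pre hz
  rcases Relation.reflTransGen_iff_eq_or_transGen.1 h1 with h2 | h2
  · rwa [h2] at hz
  · exact h.mem_of_transGen hz h2

theorem Topo.acyclic {Adj : V → V → Prop} {σ : List V} (h : Topo Adj σ) (v : V) :
    ¬ Relation.TransGen Adj v v := by
  intro hv
  obtain ⟨a, b, rfl⟩ := List.append_of_mem (h.complete v)
  have h1 := h.mem_pre_of_transGen hv
  exact (List.nodup_append.1 h.nodup).2.2 v h1 v (by simp) rfl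

theorem Topo.not_adj_last {Adj : V → V → Prop} {σ : List V} {t : V} (h : Topo Adj (σ ++ [t]))
    (w : V) : ¬ Adj t w := by
  intro ht
  rcases List.mem_append.1 (h.complete w) with hw | hw
  · have h1 := h.mem_of_transGen hw (.single ht)
    exact (List.nodup_append.1 h.nodup).2.2 t h1 t (by simp) rfl
  · rw [List.mem_singleton.1 hw] at ht
    exact h.irrefl _ ht

theorem exists_topo [Fintype V] {Adj : V → V → Prop} (h : ∀ v, ¬ Relation.TransGen Adj v v) :
    ∃ σ, Topo Adj σ := by
  classical
  have key : ∀ k, ∀ S : Finset V, S.card = k →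
      ∃ l : List V, l.Nodup ∧ (∀ x, x ∈ l ↔ x ∈ S) ∧ l.Pairwise fun u v => ¬ Adj v u := by
    intro k
    induction k with
    | zero => intro S hS; exact ⟨[], by simp [Finset.card_eq_zero.1 hS]⟩
    | succ k ih =>
      intro S hS
      have : Std.Irrefl (Relation.TransGen Adj) := ⟨h⟩
      have hwf : WellFounded (Relation.TransGen Adj) := Finite.wellFounded_of_trans_of_irrefl _
      obtain ⟨x, hx, hmin⟩ := hwf.has_min (S : Set V) (by
        rw [Finset.coe_nonempty, ← Finset.card_pos]; omega)
      obtain ⟨l, h1, h2, h3⟩ := ih (S.erase x) (by rw [Finset.card_erase_of_mem hx]; omega)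
      refine ⟨x :: l, ?_, ?_, ?_⟩
      · rw [List.nodup_cons, h2]; exact ⟨by simp, h1⟩
      · intro y
        rw [List.mem_cons, h2, Finset.mem_erase]
        constructor
        · rintro (rfl | h); exacts [hx, h.2]
        · intro hy; by_cases e : y = x
          exacts [Or.inl e, Or.inr ⟨e, hy⟩]
      · rw [List.pairwise_cons]
        refine ⟨fun y hy hA => hmin y (Finset.mem_of_mem_erase ((h2 y).1 hy)) (.single hA), h3⟩
  obtain ⟨l, h1, h2, h3⟩ := key _ Finset.univ rfl
  exact ⟨l, fun v hv => h v (.single hv), h1, by simpa using h2, h3⟩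

theorem Consec.of_cons {a x y : V} {L : List V} (h : Consec L x y) : Consec (a :: L) x y := by
  obtain ⟨i, h1, h2⟩ := h
  exact ⟨i + 1, by simpa using h1, by simpa using h2⟩

/-- A list that respects all consecutive pairs of `L` is equal to `L`. -/
theorem eq_of_consec {R : V → V → Prop} : ∀ {L τ : List V}, L.Nodup → τ.Nodup →
    (∀ x, x ∈ τ ↔ x ∈ L) → (∀ a b, Consec L a b → R a b) →
    (τ.Pairwise fun u v => ¬ R v u) → τ = L := by
  intro L
  induction L with
  | nil =>
    intro τ _ _ h _ _
    exact List.eq_nil_iff_forall_not_mem.2 fun x hx => by simpa using (h x).1 hx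
  | cons a L ih =>
    intro τ hL hτ hm hR hp
    obtain ⟨pre, post, rfl⟩ := List.append_of_mem ((hm a).2 (by simp))
    have hsub : (pre ++ post).Sublist (pre ++ a :: post) := by simp
    have haL := (List.nodup_cons.1 hL).1
    have hno : a ∉ pre ++ post := (List.nodup_middle.1 hτ).notMem
    have e : pre ++ post = L := by
      refine ih (List.nodup_cons.1 hL).2 (hτ.sublist hsub) (fun x => ?_)
        (fun x y h => hR x y h.of_cons) (hp.sublist hsub)
      have := hm x
      simp only [List.mem_append, List.mem_cons] at this hno ⊢
      by_cases hx : x = a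
      · subst hx; tauto
      · tauto
    rcases pre with _ | ⟨b, pre⟩
    · simpa using e
    · exfalso
      have hR' := hR a b ⟨0, by simp, by simp [← e]⟩
      rw [List.cons_append, List.pairwise_cons] at hp
      exact hp.1 a (by simp) hR'

theorem transGen_consec {L : List V} {a b : V} : ∀ {i j : ℕ}, i < j → L[i]? = some a →
    L[j]? = some b → Relation.TransGen (Consec L) a b := by
  intro i j hij ha
  induction j, hij using Nat.le_induction generalizing b with
  | base => intro hb; exact .single ⟨i, ha, hb⟩
  | succ j hij ih =>
    intro hb
    have hj : j < L.length := by
      have := (List.getElem?_eq_some_iff.1 hb).1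
      omega
    exact .tail (ih (List.getElem?_eq_getElem hj)) ⟨j, List.getElem?_eq_getElem hj, hb⟩

theorem Consec.right_unique {L : List V} (hn : L.Nodup) {a b c : V} (hb : Consec L a b)
    (hc : Consec L a c) : b = c := by
  obtain ⟨i, h1, h2⟩ := hb
  obtain ⟨j, h3, h4⟩ := hc
  obtain ⟨h5, h6⟩ := List.getElem?_eq_some_iff.1 h1
  obtain ⟨h7, h8⟩ := List.getElem?_eq_some_iff.1 h3
  obtain rfl := (List.Nodup.getElem_inj_iff hn).1 (h6.trans h8.symm)
  exact Option.some.inj (h2.symm.trans h4)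

section

variable {Adj : V → V → Prop} {v p : V} {I : Finset V} {σ : List V}

theorem relink_of_notMem (hI : IsBlock Adj v p I) (hσ : IsOrder Adj I σ) {a b : V} (ha : a ∉ I)
    (hav : a ≠ v) : relink Adj v p I σ a b ↔ Adj a b := by
  constructor
  · rintro (h | h)
    · exact h.2.2
    · obtain ⟨⟨h1 | h1, -⟩, -⟩ := consec_path (hI.nodup_path hσ) h
      exacts [absurd h1 hav, absurd ((hσ.mem_iff a).1 h1) ha]
  · exact fun h => Or.inl ⟨ha, hav, h⟩

theorem relink_of_mem {a b : V} (ha : a ∈ I ∨ a = v) :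
    relink Adj v p I σ a b ↔ Consec (v :: (σ ++ [p])) a b := by
  unfold relink
  tauto

theorem transGen_relink {a b : V} {i j : ℕ} (hij : i < j) (ha : (v :: (σ ++ [p]))[i]? = some a)
    (hb : (v :: (σ ++ [p]))[j]? = some b) : Relation.TransGen (relink Adj v p I σ) a b :=
  Relation.TransGen.mono (show Consec (v :: (σ ++ [p])) ≤ relink Adj v p I σ from
    fun _ _ h => Or.inr h) _ _ (transGen_consec hij ha hb)

theorem getElem?_path_p : (v :: (σ ++ [p]))[σ.length + 1]? = some p := by
  rw [getElem?_path]; simp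

theorem getElem?_path_getElem {i : ℕ} (hi : i < σ.length) :
    (v :: (σ ++ [p]))[i + 1]? = some σ[i] := by
  rw [getElem?_path]; simp [hi]

theorem IsBlock.relink (hI : IsBlock Adj v p I) (hσ : IsOrder Adj I σ) :
    IsBlock (relink Adj v p I σ) v p I where
  v_notMem := hI.v_notMem
  p_notMem := hI.p_notMem
  ne := hI.ne
  out_v w hw := by
    rw [relink_of_mem (Or.inr rfl)] at hw
    have := (consec_path (hI.nodup_path hσ) hw).1.2
    rw [hσ.mem_iff] at this; tauto
  out_mem x hx w hw := by
    rw [relink_of_mem (Or.inl hx)] at hw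
    have := (consec_path (hI.nodup_path hσ) hw).1.2
    rw [hσ.mem_iff] at this; tauto
  in_mem x hx u hu := by
    rcases hu with hu | hu
    · exact hI.in_mem x hx u hu.2.2
    · have := (consec_path (hI.nodup_path hσ) hu).1.1
      rw [hσ.mem_iff] at this; tauto
  reach_v x hx := by
    obtain ⟨i, hi, rfl⟩ := List.mem_iff_getElem.1 ((hσ.mem_iff x).2 hx)
    exact transGen_relink (Nat.succ_pos i) (by simp) (getElem?_path_getElem hi)
  reach_p x hx := by
    obtain ⟨i, hi, rfl⟩ := List.mem_iff_getElem.1 ((hσ.mem_iff x).2 hx)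
    exact transGen_relink (i := i + 1) (by omega) (getElem?_path_getElem hi) getElem?_path_p
  reach := transGen_relink (Nat.succ_pos _) (by simp) getElem?_path_p

/-- Relinking only adds precedence constraints: since `σ` is topological, an old edge between
members of the block is a stretch of the path `v, σ, p`. Consequently every schedule of the new
graph is one of the old graph. -/
theorem transGen_relink_of_adj (hI : IsBlock Adj v p I) (hσ : IsOrder Adj I σ)
    (hirr : ∀ v, ¬ Adj v v) {a b : V} (h : Adj a b) :
    Relation.TransGen (PeakMem.relink Adj v p I σ) a b := by
  have hI' := hI.relink hσ
  by_cases hav : a = v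
  · subst hav
    rcases hI.out_v b h with hb | rfl
    exacts [hI'.reach_v b hb, hI'.reach]
  by_cases ha : a ∈ I
  · rcases hI.out_mem a ha b h with hb | rfl
    · obtain ⟨i, hi, rfl⟩ := List.mem_iff_getElem.1 ((hσ.mem_iff a).2 ha)
      obtain ⟨j, hj, rfl⟩ := List.mem_iff_getElem.1 ((hσ.mem_iff b).2 hb)
      refine transGen_relink (i := i + 1) (j := j + 1) ?_ (getElem?_path_getElem hi)
        (getElem?_path_getElem hj)
      rcases lt_trichotomy i j with hij | rfl | hij
      · omega
      · exact absurd h (hirr _)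
      · exact absurd h (List.pairwise_iff_getElem.1 hσ.topological j i hj hi hij)
    · exact hI'.reach_p a ha
  · exact .single ((relink_of_notMem hI hσ ha hav).2 h)

theorem Topo.of_relink (hI : IsBlock Adj v p I) (hσ : IsOrder Adj I σ) (hirr : ∀ v, ¬ Adj v v)
    {τ : List V} (h : Topo (PeakMem.relink Adj v p I σ) τ) : Topo Adj τ :=
  .of_mem_pre h.nodup h.complete fun _ _ _ e _ hu =>
    (e ▸ h).mem_pre_of_transGen (transGen_relink_of_adj hI hσ hirr hu)

end

end Relink

end PeakMem

/-! ### Replacing a block by a path refines the computation graph -/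

namespace PeakMem

theorem blockMem_nonneg {V : Type*} [DecidableEq V] {Adj : V → V → Prop} {size : V → ℝ}
    (h : ∀ v, 0 ≤ size v) (v : V) (σ : List V) (i : ℕ) : 0 ≤ blockMem Adj size v σ i := by
  unfold blockMem mem
  exact Finset.sum_nonneg fun u _ => h u

theorem exists_cons_append_singleton {V : Type*} {l : List V} {a b : V} (hab : a ≠ b) (ha : a ∈ l)
    (hb : b ∈ l) : ∃ s m t, l = s :: (m ++ [t]) := by
  rcases l with _ | ⟨s, l⟩
  · simp at ha
  · rcases l.eq_nil_or_concat with rfl | ⟨m, t, rfl⟩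
    · simp at ha hb; exact absurd (ha.trans hb.symm) hab
    · exact ⟨s, m, t, by simp⟩

namespace CompGraph

variable {V : Type*} [Fintype V]

/-- Every schedule of `G'` is a schedule of `G` with the same memory profiles, and every schedule
of `G` is dominated by a schedule of `G'`. -/
structure Refines (G G' : CompGraph V) : Prop where
  topo : ∀ τ, Topo G'.graph.Adj τ → Topo G.graph.Adj τ ∧ G'.profile τ = G.profile τ ∧
    G'.internalProfile τ = G.internalProfile τ
  dom : ∀ τ, Topo G.graph.Adj τ → ∃ τ', Topo G'.graph.Adj τ' ∧
    Dom (G.profile τ') (G.profile τ) ∧ Dom (G.internalProfile τ') (G.internalProfile τ)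

theorem Refines.trans {G G' G'' : CompGraph V} (h : Refines G G') (h' : Refines G' G'') :
    Refines G G'' where
  topo τ hτ := by
    obtain ⟨h1, h2, h3⟩ := h'.topo τ hτ
    obtain ⟨h4, h5, h6⟩ := h.topo τ h1
    exact ⟨h4, h2.trans h5, h3.trans h6⟩
  dom τ hτ := by
    obtain ⟨τ', h1, h2, h3⟩ := h.dom τ hτ
    obtain ⟨τ'', h4, h5, h6⟩ := h'.dom τ' h1
    obtain ⟨-, e1, e2⟩ := h.topo _ h1
    obtain ⟨h8, -, -⟩ := h'.topo _ h4
    obtain ⟨-, e3, e4⟩ := h.topo _ h8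
    rw [e1, e3] at h5
    rw [e2, e4] at h6
    exact ⟨τ'', h4, h5.trans h2, h6.trans h3⟩

variable [DecidableEq V] (G : CompGraph V) {v p : V} {I : Finset V} {σ : List V}

/-- The sizes of the outputs after the block has been replaced by a path. -/
noncomputable def relinkSize (v : V) (I : Finset V) (σ : List V) (x : V) : ℝ :=
  if x ∈ I then blockMem G.graph.Adj G.size v σ (σ.idxOf x + 1) else G.size x

theorem relinkSize_getElem (hσ : IsOrder G.graph.Adj I σ) {i : ℕ} (hi : i < σ.length) :
    G.relinkSize v I σ σ[i] = blockMem G.graph.Adj G.size v σ (i + 1) := by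
  rw [relinkSize, if_pos ((hσ.mem_iff _).1 (List.getElem_mem _)), hσ.nodup.idxOf_getElem]

theorem relinkSize_nonneg (x : V) : 0 ≤ G.relinkSize v I σ x := by
  unfold relinkSize
  split_ifs
  exacts [blockMem_nonneg G.size_nonneg _ _ _, G.size_nonneg x]

theorem blockMem_zero (hI : IsBlock G.graph.Adj v p I) :
    blockMem G.graph.Adj G.size v σ 0 = G.size v := by
  obtain ⟨w, hw, -⟩ := Relation.TransGen.head'_iff.1 hI.reach
  rw [blockMem, List.take_zero, List.toFinset_nil, Finset.union_empty, mem,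
    ← Finset.sum_singleton G.size v]
  refine Finset.sum_congr ?_ fun _ _ => rfl
  ext u
  simp only [Finset.mem_filter, Finset.mem_singleton, false_or, and_iff_left_iff_imp]
  rintro rfl
  exact ⟨w, fun h => G.acyclic u (.single (by rwa [h] at hw)), hw⟩

/-- The size of the predecessor of a vertex on the path. -/
theorem exists_consec (hI : IsBlock G.graph.Adj v p I) (hσ : IsOrder G.graph.Adj I σ) {i : ℕ}
    (hi : i ≤ σ.length) : ∃ a, (a = v ∨ a ∈ I) ∧ (v :: (σ ++ [p]))[i]? = some a ∧
      G.relinkSize v I σ a = blockMem G.graph.Adj G.size v σ i := by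
  rcases i with _ | i
  · refine ⟨v, Or.inl rfl, by simp, ?_⟩
    rw [G.blockMem_zero hI, relinkSize, if_neg hI.v_notMem]
  · have hi' : i < σ.length := hi
    exact ⟨σ[i], Or.inr ((hσ.mem_iff _).1 (List.getElem_mem _)), getElem?_path_getElem hi',
      G.relinkSize_getElem hσ hi'⟩

/-- On a path only the output of the last executed vertex is needed, and `relinkSize` gives it
exactly the amount that the block held at that moment. -/
theorem blockMem_relink (hI : IsBlock G.graph.Adj v p I) (hσ : IsOrder G.graph.Adj I σ) {i : ℕ}
    (hi : i ≤ σ.length) :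
    blockMem (relink G.graph.Adj v p I σ) (G.relinkSize v I σ) v σ i =
      blockMem G.graph.Adj G.size v σ i := by
  obtain ⟨a, ha, hai, hs⟩ := G.exists_consec hI hσ hi
  rw [← hs, blockMem, mem, ← Finset.sum_singleton (G.relinkSize v I σ) a]
  refine Finset.sum_congr ?_ fun _ _ => rfl
  have hn := hI.nodup_path hσ
  have hmem : ∀ u, (u = v ∨ u ∈ σ.take i) ↔ ∃ j ≤ i, (v :: (σ ++ [p]))[j]? = some u := by
    intro u
    constructor
    · rintro (rfl | h)
      · exact ⟨0, Nat.zero_le _, by simp⟩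
      · obtain ⟨j, hj, rfl⟩ := List.mem_take_iff_getElem.1 h
        exact ⟨j + 1, by omega, getElem?_path_getElem (by omega)⟩
    · rintro ⟨j, hj, h⟩
      rcases j with _ | j
      · left; simpa using h.symm
      · right
        rw [getElem?_path_getElem (by omega)] at h
        exact List.mem_take_iff_getElem.2 ⟨j, by omega, Option.some.inj h⟩
  have hinj : ∀ {j k : ℕ} {u : V}, (v :: (σ ++ [p]))[j]? = some u →
      (v :: (σ ++ [p]))[k]? = some u → j = k := by
    intro j k u h1 h2
    obtain ⟨h5, h6⟩ := List.getElem?_eq_some_iff.1 h1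
    obtain ⟨h7, h8⟩ := List.getElem?_eq_some_iff.1 h2
    exact (List.Nodup.getElem_inj_iff hn).1 (h6.trans h8.symm)
  have hnext : ∀ j ≤ σ.length, ∃ b, (v :: (σ ++ [p]))[j + 1]? = some b := fun j hj =>
    ⟨_, List.getElem?_eq_getElem (by simp; omega)⟩
  ext u
  simp only [Finset.mem_filter, Finset.mem_union, Finset.mem_singleton, List.mem_toFinset, hmem,
    false_or]
  constructor
  · rintro ⟨⟨j, hj, hu⟩, w, hw, hadj⟩
    have huI : u ∈ I ∨ u = v := by
      have := (hmem u).2 ⟨j, hj, hu⟩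
      rcases this with h | h
      · exact Or.inr h
      · exact Or.inl ((hσ.mem_iff u).1 (List.mem_of_mem_take h))
    rw [relink_of_mem huI] at hadj
    obtain ⟨k, h1, h2⟩ := hadj
    obtain rfl := hinj hu h1
    have : j = i := by
      by_contra hne
      exact hw ⟨j + 1, by omega, h2⟩
    subst this
    exact Option.some.inj (hu.symm.trans hai)
  · rintro rfl
    obtain ⟨b, hb⟩ := hnext i hi
    refine ⟨⟨i, le_rfl, hai⟩, b, ?_, Or.inr ⟨i, hai, hb⟩⟩
    rintro ⟨j, hj, h⟩
    have := hinj h hb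
    omega

/-- A schedule of the relinked graph is forced by the path to run `I` in the order `σ`
(`eq_of_consec`), so `blockMem_relink` applies while the block is running. The rest is untouched,
since edges and sizes outside the block are the same. -/
theorem mem_relink (hI : IsBlock G.graph.Adj v p I) (hσ : IsOrder G.graph.Adj I σ) {τ : List V}
    (hτ : Topo (relink G.graph.Adj v p I σ) τ) (K : V → Prop)
    (hK : ∀ u, K u → ∀ w, ¬ G.graph.Adj u w) {pre post : List V} (e : τ = pre ++ post) :
    mem (relink G.graph.Adj v p I σ) K (G.relinkSize v I σ) pre.toFinset =
      mem G.graph.Adj K G.size pre.toFinset := by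
  have hI' := hI.relink hσ
  have hKI : ∀ u, K u → u ∉ I ∧ u ≠ v := by
    intro u hu
    constructor
    · intro h
      obtain ⟨w, hw, -⟩ := Relation.TransGen.head'_iff.1 (hI.reach_p u h)
      exact hK u hu w hw
    · rintro rfl
      obtain ⟨w, hw, -⟩ := Relation.TransGen.head'_iff.1 hI.reach
      exact hK u hu w hw
  have hK' : ∀ u, K u → ∀ w, ¬ relink G.graph.Adj v p I σ u w := by
    intro u hu w hw
    rw [relink_of_notMem hI hσ (hKI u hu).1 (hKI u hu).2] at hw
    exact hK u hu w hw
  have hrest : restMem (relink G.graph.Adj v p I σ) K (G.relinkSize v I σ) v I pre.toFinset =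
      restMem G.graph.Adj K G.size v I pre.toFinset := by
    refine mem_congr_of_ne ?_ ?_ fun u hu => ?_
    · intro u _ hu
      have hu : ¬ (u ∈ I ∨ u = v) := fun h => hu (if_pos h)
      rw [if_neg hu, if_neg hu, relinkSize, if_neg (fun h => hu (Or.inl h))]
    · intro u _ hu
      have hu : ¬ (u ∈ I ∨ u = v) := fun h => hu (if_pos h)
      rw [if_neg hu, if_neg hu, relinkSize, if_neg (fun h => hu (Or.inl h))]
    · have hu : ¬ (u ∈ I ∨ u = v) := fun h => hu (if_pos h)
      simp only [relink_of_notMem hI hσ (fun h => hu (Or.inl h)) (fun h => hu (Or.inr h))]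
  by_cases hv : v ∈ pre
  · by_cases hp : p ∈ pre
    · have hall : ∀ x ∈ I, x ∈ pre.toFinset := fun x hx => by
        rw [List.mem_toFinset]; exact hI'.mem_of_p (e ▸ hτ) hp hx
      rw [mem_eq_restMem hI' hK' (Or.inr ⟨by simpa using hp, hall⟩),
        mem_eq_restMem hI hK (Or.inr ⟨by simpa using hp, hall⟩), hrest]
    · have hord : τ.filter (· ∈ I) = σ := by
        have h1 : IsOrder (relink G.graph.Adj v p I σ) I (τ.filter (· ∈ I)) := .of_topo hτ
        refine eq_of_consec hσ.nodup h1.nodup (fun x => by rw [h1.mem_iff, hσ.mem_iff])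
          (fun a b h => Or.inr ?_) h1.topological
        obtain ⟨i, h2, h3⟩ := h
        refine ⟨i + 1, ?_, ?_⟩
        · rw [List.getElem?_cons_succ, List.getElem?_append_left (List.getElem?_eq_some_iff.1 h2).1]
          exact h2
        · rw [List.getElem?_cons_succ, List.getElem?_append_left (List.getElem?_eq_some_iff.1 h3).1]
          exact h3
      have hl : ∀ x, x ∈ σ.take (pre.filter (· ∈ I)).length ↔ x ∈ pre.toFinset ∧ x ∈ I := by
        intro u
        rw [← hord, e, List.filter_append, List.take_left' rfl]
        simp
      have hlen : (pre.filter (· ∈ I)).length ≤ σ.length := by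
        rw [← hord, e, List.filter_append, List.length_append]; omega
      rw [mem_eq_restMem_add hI' hK' (by simpa using hv) (by simpa using hp) hl,
        mem_eq_restMem_add hI hK (by simpa using hv) (by simpa using hp) hl, hrest,
        G.blockMem_relink hI hσ hlen]
  · have hn : ∀ x ∈ I, x ∉ pre.toFinset := fun x hx h =>
      hv (hI'.v_mem (e ▸ hτ) (List.mem_toFinset.1 h) hx)
    rw [mem_eq_restMem hI' hK' (Or.inl ⟨by simpa using hv, hn⟩),
      mem_eq_restMem hI hK (Or.inl ⟨by simpa using hv, hn⟩), hrest]

/-- The second condition on `scratch` for the new graph. A vertex of `I` releases its predecessor on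
the path, and the condition becomes `blockMem_succ_le`. The vertex `p` releases the last vertex of
the path, whose size includes every output of the block that `p` released before. Any other vertex
releases nothing from the block and the same outputs as before from the rest. -/
theorem relink_release (hI : IsBlock G.graph.Adj v p I) (hσ : IsOrder G.graph.Adj I σ) (x : V) :
    open Classical in
    -(∑ u with {w | relink G.graph.Adj v p I σ u w} = {x}, G.relinkSize v I σ u) ≤
      G.size x + G.scratch x - G.relinkSize v I σ x := by
  classical
  have hn := hI.nodup_path hσ
  have hnn : ∀ u, 0 ≤ G.relinkSize v I σ u := fun u => G.relinkSize_nonneg u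
  have hpath : ∀ {i a b}, (a = v ∨ a ∈ I) → (v :: (σ ++ [p]))[i]? = some a →
      (v :: (σ ++ [p]))[i + 1]? = some b → {w | relink G.graph.Adj v p I σ a w} = {b} := by
    intro i a b ha h1 h2
    ext w
    simp only [Set.mem_ofPred_eq, Set.mem_singleton_iff]
    rw [relink_of_mem ha.symm]
    constructor
    · exact fun h => h.right_unique hn ⟨i, h1, h2⟩
    · rintro rfl; exact ⟨i, h1, h2⟩
  by_cases hx : x ∈ I
  · obtain ⟨i, hi, rfl⟩ := List.mem_iff_getElem.1 ((hσ.mem_iff x).2 hx)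
    obtain ⟨a, ha, hai, hs⟩ := G.exists_consec hI hσ hi.le
    have h1 := blockMem_succ_le G hI hσ hi
    rw [G.relinkSize_getElem hσ hi]
    have h2 : G.relinkSize v I σ a ≤ ∑ u with {w | relink G.graph.Adj v p I σ u w} = {σ[i]},
        G.relinkSize v I σ u := by
      refine Finset.single_le_sum (fun u _ => hnn u) ?_
      simp only [Finset.mem_filter, Finset.mem_univ, true_and]
      exact hpath ha hai (getElem?_path_getElem hi)
    have h3 := hs.symm.trans_le h2
    linarith
  · have h0 := G.neg_release_le_scratch x
    have hsx : G.relinkSize v I σ x = G.size x := if_neg hx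
    have key : ∑ u with {w | G.graph.Adj u w} = {x}, G.size u ≤
        ∑ u with {w | relink G.graph.Adj v p I σ u w} = {x}, G.relinkSize v I σ u := by
      rw [← Finset.sum_filter_add_sum_filter_not (Finset.univ.filter _) (fun u => u ∈ I ∨ u = v),
        ← Finset.sum_filter_add_sum_filter_not
          (Finset.univ.filter fun u => {w | relink G.graph.Adj v p I σ u w} = {x})
          (fun u => u ∈ I ∨ u = v)]
      refine add_le_add ?_ ?_
      · by_cases hxp : x = p
        · subst hxp
          obtain ⟨a, ha, hai, hs⟩ := G.exists_consec hI hσ le_rfl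
          have h2 : G.relinkSize v I σ a ≤ ∑ u ∈ (Finset.univ.filter fun u =>
              {w | relink G.graph.Adj v x I σ u w} = {x}).filter (fun u => u ∈ I ∨ u = v),
              G.relinkSize v I σ u := by
            refine Finset.single_le_sum (fun u _ => hnn u) ?_
            simp only [Finset.mem_filter, Finset.mem_univ, true_and]
            exact ⟨hpath ha hai getElem?_path_p, ha.symm⟩
          refine le_trans ?_ h2
          rw [hs, blockMem, List.take_length, mem]
          refine Finset.sum_le_sum_of_subset_of_nonneg ?_ fun u _ _ => G.size_nonneg u
          intro u hu
          simp only [Finset.mem_filter, Finset.mem_univ, true_and, Finset.mem_union,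
            Finset.mem_singleton, List.mem_toFinset, hσ.mem_iff, false_or] at hu ⊢
          have hux : G.graph.Adj u x := by
            have := Set.ext_iff.1 hu.1 x; simpa using this
          refine ⟨hu.2.symm, x, ?_, hux⟩
          rintro (h | h)
          exacts [hI.ne h.symm, hx h]
        · refine le_trans (le_of_eq ?_) (Finset.sum_nonneg fun u _ => hnn u)
          refine Finset.sum_eq_zero fun u hu => ?_
          exfalso
          simp only [Finset.mem_filter, Finset.mem_univ, true_and] at hu
          have hux : G.graph.Adj u x := by
            have := Set.ext_iff.1 hu.1 x; simpa using this
          have : x ∈ I ∨ x = p := by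
            rcases hu.2 with h | rfl
            exacts [hI.out_mem u h x hux, hI.out_v x hux]
          tauto
      · refine le_of_eq (Finset.sum_congr ?_ ?_)
        · ext u
          simp only [Finset.mem_filter, Finset.mem_univ, true_and]
          refine and_congr_left fun hu => ?_
          simp only [relink_of_notMem hI hσ (fun h => hu (Or.inl h)) (fun h => hu (Or.inr h))]
        · intro u hu
          simp only [Finset.mem_filter] at hu
          rw [relinkSize, if_neg (fun h => hu.2 (Or.inl h))]
    rw [hsx]
    have h0' : -(∑ u with {w | G.graph.Adj u w} = {x}, G.size u) ≤ G.scratch x := by convert h0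
    linarith

/-- Replacing a block by a path along a best order loses nothing. -/
theorem exists_relink (hI : IsBlock G.graph.Adj v p I) (hσ : IsOrder G.graph.Adj I σ)
    (hb : IsBest G.graph.Adj G.size (fun x => G.size x + G.scratch x) v I σ) :
    ∃ G' : CompGraph V, G'.graph.Adj = relink G.graph.Adj v p I σ ∧
      G'.size = G.relinkSize v I σ ∧
      (G'.scratch = fun x => G.size x + G.scratch x - G.relinkSize v I σ x) ∧ Refines G G' := by
  have hsim : ∀ τ, Topo G.graph.Adj τ → ∃ τ', Topo (relink G.graph.Adj v p I σ) τ' ∧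
      Dom (G.profile τ') (G.profile τ) ∧ Dom (G.internalProfile τ') (G.internalProfile τ) := by
    intro τ hτ
    obtain ⟨g, hg, h0, h1, hA, hD⟩ := hb _ (.of_topo hτ)
    have ht := subst_topo hI hg h0 h1 hσ hτ
    have ht' := ht.of_relink hI hσ hτ.irrefl
    refine ⟨_, ht, ?_, ?_⟩
    · rw [profile_eq G hτ, profile_eq G ht']
      have := subst_dom G hI hg h0 h1 hσ hτ hA hD (fun _ => False) (by simp) τ [] rfl
      simpa using this
    -- The first and the last vertex of a schedule lie outside `I`, because members of `I` have `v`
    -- before and `p` behind them. The substitution therefore fixes both ends, and `t` has no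
    -- out-neighbour, so `K` may be chosen as `(· = t)`.
    · obtain ⟨s, l, t, e⟩ := exists_cons_append_singleton hI.ne (hτ.complete v) (hτ.complete p)
      have hlast : ∀ w, ¬ G.graph.Adj t w := by
        have h2 := hτ
        rw [e, ← List.cons_append] at h2
        exact h2.not_adj_last
      have htI : t ∉ I := by
        intro h
        obtain ⟨w, hw, -⟩ := Relation.TransGen.head'_iff.1 (hI.reach_p t h)
        exact hlast w hw
      have hsI : s ∉ I := by
        intro h
        have h2 := hτ
        rw [e, ← List.nil_append (s :: _)] at h2
        exact absurd (h2.mem_pre_of_transGen (hI.reach_v s h)) (by simp)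
      have hd := subst_dom G hI hg h0 h1 hσ hτ hA hD (· = t) (by rintro _ rfl; exact hlast)
        (l ++ [t]) [s] e
      set B := subst I (τ.filter (· ∈ I)) σ g with hB
      have hs : B s = [s] := by rw [hB, subst, if_neg hsI]
      have ht2 : B t = [t] := by rw [hB, subst, if_neg htI]
      have e2 : τ.flatMap B = s :: (l.flatMap B ++ [t]) := by
        conv_lhs => rw [e]
        rw [List.flatMap_cons, hs, List.flatMap_append, List.flatMap_singleton, ht2]
        rfl
      rw [e2] at ht' ⊢
      have hτ' := hτ
      rw [e] at hτ' ⊢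
      rw [internalProfile_eq G hτ', internalProfile_eq G ht']
      rw [List.flatMap_append, List.flatMap_singleton, List.flatMap_singleton, hs, ht2] at hd
      simpa using hd
  -- Acyclicity of the relinked graph comes from a topological ordering of it, obtained by
  -- simulating one of the old graph.
  obtain ⟨τ₀, hτ₀⟩ := exists_topo G.acyclic
  obtain ⟨τ₁, hτ₁, -⟩ := hsim τ₀ hτ₀
  let G' : CompGraph V :=
    { graph := ⟨relink G.graph.Adj v p I σ⟩
      acyclic := hτ₁.acyclic
      size := G.relinkSize v I σ
      -- This keeps size plus scratch, hence the increment from the memory before an operation to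
      -- the memory during it.
      scratch := fun x => G.size x + G.scratch x - G.relinkSize v I σ x
      size_nonneg := fun x => G.relinkSize_nonneg x
      neg_size_le_scratch := fun x => by
        have := G.neg_size_le_scratch x
        linarith
      neg_release_le_scratch := fun x => by
        convert G.relink_release hI hσ x }
  refine ⟨G', rfl, rfl, rfl, ⟨fun τ hτ => ?_, hsim⟩⟩
  have hτ' : Topo G.graph.Adj τ := Topo.of_relink hI hσ (fun v hv => G.acyclic v (.single hv)) hτ
  have hw : ∀ x, G'.size x + G'.scratch x = G.size x + G.scratch x := fun x => by simp [G']
  refine ⟨hτ', ?_, ?_⟩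
  · rw [profile_eq G hτ', profile_eq G' hτ]
    refine prof_congr hw _ _ fun pre post e => ?_
    rw [Finset.empty_union]
    exact G.mem_relink hI hσ hτ _ (by simp) e
  · obtain ⟨s, l, t, e⟩ := exists_cons_append_singleton hI.ne (hτ.complete v) (hτ.complete p)
    have hlast : ∀ w, ¬ G.graph.Adj t w := by
      have h2 := hτ'
      rw [e, ← List.cons_append] at h2
      exact h2.not_adj_last
    have hτ2 := hτ
    rw [e] at hτ' hτ2 ⊢
    rw [internalProfile_eq G hτ', internalProfile_eq G' hτ2]
    refine prof_congr hw _ _ fun pre post e' => ?_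
    have h3 := G.mem_relink hI hσ hτ (· = t) (by rintro _ rfl; exact hlast) (pre := s :: pre)
      (post := post) (by rw [e, e', List.cons_append])
    rw [List.toFinset_cons, Finset.insert_eq] at h3
    exact h3

end CompGraph

end PeakMem

/-! ### From a dominant schedule of the block graph to a best order of the block -/

namespace PeakMem

/-- Read off from a pair of pointers, after how many operations they stand. -/
theorem exists_index {k : ℕ} {X Y : ℕ → ℝ} {c : ℕ → ℕ} (hX : ∀ i < k, X (2 * i) ≤ X (2 * i + 1))
    (hX1 : X (2 * k + 1) = X (2 * k)) (hX2 : X (2 * k + 2) = X (2 * k))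
    (hY : ∀ j < k, Y (2 * j) ≤ Y (2 * j + 1)) (hY' : ∀ j < k, Y (2 * j + 2) ≤ Y (2 * j + 1))
    (hY1 : Y (2 * k + 1) = Y (2 * k)) (hY2 : Y (2 * k + 2) = Y (2 * k))
    (hXY : X (2 * k) ≤ Y (2 * k)) (c0 : c 0 = 0) (hc : Monotone c)
    (hcl : c (2 * k + 3) = 2 * k + 2)
    (h : ∀ j < 2 * k + 3, ∀ i, c j ≤ i → i ≤ c (j + 1) → X i ≤ Y j) :
    ∃ g : ℕ → ℕ, Monotone g ∧ g 0 = 0 ∧ g k = k ∧ (∀ j ≤ k, g j ≤ k) ∧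
      (∀ j ≤ k, X (2 * g j) ≤ Y (2 * j)) ∧
      ∀ j < k, ∀ i < k, g j ≤ i → i < g (j + 1) → X (2 * i + 1) ≤ Y (2 * j + 1) := by
  -- The two entries of `X` behind position `2 * k`, which belong to the sink, repeat entry `2 * k`;
  -- so the first pointer may be stopped there.
  set c' : ℕ → ℕ := fun j => min (c j) (2 * k) with hc'
  have hcm : Monotone c' := fun i j hij => min_le_min_right _ (hc hij)
  have hc2 : ∀ j, c' j ≤ 2 * k := fun j => min_le_right _ _
  have key : ∀ j < 2 * k + 3, ∀ i, c' j ≤ i → i ≤ c' (j + 1) → X i ≤ Y j := by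
    intro j hj i h1 h2
    have h3 := hc (show j + 1 ≤ 2 * k + 3 by omega)
    have h4 := hc (show j ≤ j + 1 by omega)
    simp only [hc'] at h1 h2
    by_cases h5 : c j ≤ i
    · exact h j hj i h5 (by omega)
    · have h6 := h j hj (c j) le_rfl h4
      have : i = 2 * k := by omega
      subst this
      have : c j = 2 * k + 1 ∨ c j = 2 * k + 2 := by omega
      rcases this with e | e
      · rwa [e, hX1] at h6
      · rwa [e, hX2] at h6
  -- Even positions are states between operations, odd ones are operations. A pointer at an odd
  -- position is rounded down, which does not increase the entry by `hX`. The value `k` at `j = k`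
  -- is forced by hand and justified by `hXY`.
  refine ⟨fun j => if k ≤ j then k else c' (2 * j) / 2, ?_, ?_, by simp, ?_, ?_, ?_⟩
  · intro i j hij
    have h1 := hcm (show 2 * i ≤ 2 * j by omega)
    have h2 := hc2 (2 * i)
    simp only
    split_ifs <;> omega
  · simp only [hc', c0]; split_ifs <;> omega
  · intro j hj
    have h2 := hc2 (2 * j)
    simp only
    split_ifs <;> omega
  · intro j hj
    simp only
    split_ifs with h1
    · rw [show j = k by omega]; exact hXY
    · have h2 := key (2 * j) (by omega) (c' (2 * j)) le_rfl (hcm (by omega))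
      have h3 := hc2 (2 * j)
      rcases Nat.even_or_odd' (c' (2 * j)) with ⟨q, e | e⟩
      · rw [e] at h2 ⊢
        rwa [show 2 * (2 * q / 2) = 2 * q by omega]
      · rw [e] at h2 ⊢
        rw [show 2 * ((2 * q + 1) / 2) = 2 * q by omega]
        exact (hX q (by omega)).trans h2
  · intro j hj i hi h1 h2
    have h3 : c' (2 * j) ≤ 2 * i + 1 := by
      simp only [if_neg (show ¬ k ≤ j by omega)] at h1; omega
    have hA := key (2 * j) (by omega) (2 * i + 1)
    have hB := key (2 * j + 1) (by omega) (2 * i + 1)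
    have hjY := hY j hj
    by_cases h4 : 2 * i + 1 ≤ c' (2 * j + 1)
    · exact (hA h3 h4).trans hjY
    by_cases h5 : 2 * i + 1 ≤ c' (2 * j + 2)
    · exact hB (by omega) h5
    -- An operation of the bunch that the pointer has not passed at `2 * j + 2` exists only if `g (j
    -- + 1)` is the forced value. The leftover operations are then compared with `Y` at `2 * k` or
    -- behind it, where all entries equal `Y (2 * k)`, and this is at most `Y (2 * j + 1)`.
    have hjk : j + 1 = k := by
      by_contra hne
      simp only [show 2 * (j + 1) = 2 * j + 2 by ring] at h2
      rw [if_neg (by omega)] at h2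
      omega
    have e1 : 2 * j + 2 = 2 * k := by omega
    have hYk : Y (2 * k) ≤ Y (2 * j + 1) := by rw [← e1]; exact hY' j hj
    rw [e1] at h5
    by_cases h6 : 2 * i + 1 ≤ c' (2 * k + 1)
    · exact (key (2 * k) (by omega) _ (by omega) h6).trans hYk
    by_cases h7 : 2 * i + 1 ≤ c' (2 * k + 2)
    · have := key (2 * k + 1) (by omega) _ (by omega) h7
      rw [hY1] at this
      exact this.trans hYk
    have h8 : c' (2 * k + 3) = 2 * k := by simp only [hc', hcl]; omega
    have := key (2 * k + 2) (by omega) (2 * i + 1) (by omega)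
      (by rw [show 2 * k + 2 + 1 = 2 * k + 3 by ring, h8]; omega)
    rw [hY2] at this
    exact this.trans hYk

section Embedding

variable {V W : Type*} [Fintype V] [Fintype W]

/-- `H` is the block of `G` between `v` and `p`, with weights at its ends that make the memory at
the end equal to the memory before the last operation. -/
structure IsBlockGraph (G : CompGraph V) (v p : V) (I : Finset V) (H : CompGraph W)
    (e : W → V) (a b : W) : Prop where
  inj : Function.Injective e
  map_a : e a = v
  map_b : e b = p
  range : ∀ x ∈ I, ∃ c, e c = x
  mem : ∀ c, c ≠ a → c ≠ b → e c ∈ I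
  adj : ∀ c d, H.graph.Adj c d ↔ G.graph.Adj (e c) (e d)
  size : ∀ c, e c ∈ I → H.size c = G.size (e c)
  scratch : ∀ c, e c ∈ I → H.scratch c = G.scratch (e c)
  size_a : open Classical in H.size a = if G.graph.Adj v p then 0 else G.size v
  size_b : open Classical in H.size b = ∑ y ∈ I with G.graph.Adj y p, G.size y
  scratch_b : H.scratch b = -H.size b

variable {G : CompGraph V} {v p : V} {I : Finset V} {H : CompGraph W} {e : W → V} {a b : W}

theorem IsBlockGraph.ne (hH : IsBlockGraph G v p I H e a b) (hI : IsBlock G.graph.Adj v p I) :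
    a ≠ b := by
  rintro rfl
  exact hI.ne (hH.map_a.symm.trans hH.map_b)

/-- The memory of the source that is in use throughout. -/
noncomputable def IsBlockGraph.offset (G : CompGraph V) (v p : V) : ℝ :=
  open Classical in if G.graph.Adj v p then G.size v else 0

variable [DecidableEq V] [DecidableEq W]

/-- If there is an edge from `v` to `p`, the output of `v` stays in memory as long as the block
runs. The block graph leaves out this constant by giving the source size `0`; it cancels in every
comparison of two orders. -/
theorem IsBlockGraph.blockMem_eq (hH : IsBlockGraph G v p I H e a b)
    (hI : IsBlock G.graph.Adj v p I) {m : List W} (hm : ∀ c ∈ m, e c ∈ I) (i : ℕ) :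
    blockMem G.graph.Adj G.size v (m.map e) i =
      PeakMem.mem H.graph.Adj (· = b) H.size ({a} ∪ (m.take i).toFinset) +
        IsBlockGraph.offset G v p := by
  classical
  have hmi : ∀ c ∈ m.take i, e c ∈ I := fun c hc => hm c (List.mem_of_mem_take hc)
  have hvI := hI.v_notMem
  have hpI := hI.p_notMem
  set P := ({v} ∪ ((m.map e).take i).toFinset : Finset V) with hP
  have hmemP : ∀ u, u ∈ P ↔ u = v ∨ ∃ c ∈ m.take i, e c = u := by
    intro u
    rw [hP, ← List.map_take, Finset.mem_union, Finset.mem_singleton, List.mem_toFinset,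
      List.mem_map]
  have hpP : p ∉ P := by
    rw [hmemP]
    rintro (h | ⟨c, hc, h⟩)
    exacts [hI.ne h.symm, hpI (h ▸ hmi c hc)]
  have hsum : PeakMem.mem H.graph.Adj (· = b) H.size ({a} ∪ (m.take i).toFinset) =
      PeakMem.mem G.graph.Adj (fun _ => False) (fun u => if u = v then H.size a else G.size u) P := by
    unfold PeakMem.mem
    refine Finset.sum_nbij e ?_ hH.inj.injOn ?_ ?_
    · intro c hc
      simp only [Finset.mem_filter, Finset.mem_union, Finset.mem_singleton, List.mem_toFinset,
        hmemP, false_or] at hc ⊢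
      obtain ⟨hc, hc'⟩ := hc
      have hcb : c ≠ b := by
        rintro rfl
        rcases hc with h | h
        · exact hH.ne hI h.symm
        · exact hpI (hH.map_b ▸ hmi _ h)
      refine ⟨?_, ?_⟩
      · rcases hc with rfl | h
        exacts [Or.inl hH.map_a, Or.inr ⟨c, h, rfl⟩]
      · obtain ⟨d, hd, hcd⟩ := hc'.resolve_left hcb
        refine ⟨e d, ?_, (hH.adj _ _).1 hcd⟩
        rintro (h | ⟨c', h, h'⟩)
        · exact hd (Or.inl (hH.inj (h.trans hH.map_a.symm)))
        · have := hH.inj h'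
          exact hd (Or.inr (this ▸ h))
    · intro u hu
      simp only [Finset.coe_filter, hmemP, false_or, Set.mem_ofPred_eq] at hu
      obtain ⟨hu, w, hw, huw⟩ := hu
      have : ∃ c, (c = a ∨ c ∈ m.take i) ∧ e c = u := by
        rcases hu with rfl | ⟨c, hc, h⟩
        exacts [⟨a, Or.inl rfl, hH.map_a⟩, ⟨c, Or.inr hc, h⟩]
      obtain ⟨c, hc, rfl⟩ := this
      refine ⟨c, ?_, rfl⟩
      simp only [Finset.coe_filter, Finset.mem_union, Finset.mem_singleton, List.mem_toFinset,
        Set.mem_ofPred_eq]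
      refine ⟨hc, Or.inr ?_⟩
      have hw' : w ∈ I ∨ w = p := by
        rcases hc with rfl | hc
        · rw [hH.map_a] at huw; exact hI.out_v w huw
        · exact hI.out_mem _ (hmi c hc) w huw
      have : ∃ d, e d = w := by
        rcases hw' with h | rfl
        exacts [hH.range w h, ⟨b, hH.map_b⟩]
      obtain ⟨d, rfl⟩ := this
      refine ⟨d, ?_, (hH.adj _ _).2 huw⟩
      rintro (rfl | h)
      exacts [hw (Or.inl hH.map_a), hw (Or.inr ⟨d, h, rfl⟩)]
    · intro c hc
      simp only [Finset.mem_filter, Finset.mem_union, Finset.mem_singleton, List.mem_toFinset] at hc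
      rcases hc.1 with rfl | h
      · rw [if_pos hH.map_a]
      · have hne : e c ≠ v := fun h' => hvI (h' ▸ hmi c h)
        rw [if_neg hne, hH.size c (hmi c h)]
  have hoff : PeakMem.mem G.graph.Adj (fun _ => False)
      (fun u => if u = v then IsBlockGraph.offset G v p else 0) P = IsBlockGraph.offset G v p := by
    by_cases hvp : G.graph.Adj v p
    · unfold PeakMem.mem
      rw [Finset.sum_eq_single_of_mem v]
      · rw [if_pos rfl]
      · simp only [Finset.mem_filter, hmemP, false_or]
        exact ⟨(hmemP v).1 (by simp [hP]) |>.imp_left fun _ => trivial, p, fun h => hpP ((hmemP p).2 h), hvp⟩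
      · intro u _ hu; rw [if_neg hu]
    · have h0 : IsBlockGraph.offset G v p = 0 := by unfold IsBlockGraph.offset; rw [if_neg hvp]
      rw [h0]
      unfold PeakMem.mem
      exact Finset.sum_eq_zero fun u _ => by split_ifs <;> rfl
  rw [hsum]
  conv_rhs => rw [← hoff]
  rw [← mem_add, blockMem]
  congr 1
  ext u
  by_cases hu : u = v
  · rw [if_pos hu, if_pos hu, hH.size_a, IsBlockGraph.offset, hu]
    split_ifs <;> simp
  · rw [if_neg hu, if_neg hu, add_zero]

/-- When all of `I` has been executed, only outputs needed by `p` remain. Those from `I` sum to the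
size of `b` by definition, and that of `v`, if needed, is the offset. -/
theorem IsBlockGraph.blockMem_end (hH : IsBlockGraph G v p I H e a b)
    (hI : IsBlock G.graph.Adj v p I) {m : List W} (hm : ∀ x, x ∈ m.map e ↔ x ∈ I) :
    PeakMem.mem H.graph.Adj (· = b) H.size ({a} ∪ m.toFinset) = H.size b := by
  classical
  have hmI : ∀ c ∈ m, e c ∈ I := fun c hc => (hm _).1 (List.mem_map_of_mem hc)
  have h1 := hH.blockMem_eq hI hmI m.length
  rw [List.take_length] at h1
  have h2 : blockMem G.graph.Adj G.size v (m.map e) m.length =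
      H.size b + IsBlockGraph.offset G v p := by
    rw [blockMem, List.take_of_length_le (by simp), hH.size_b, IsBlockGraph.offset]
    have hset : ∀ u, (u ∈ ({v} ∪ (m.map e).toFinset : Finset V) ∧ (False ∨ ∃ w,
        w ∉ ({v} ∪ (m.map e).toFinset : Finset V) ∧ G.graph.Adj u w)) ↔
        (u = v ∧ G.graph.Adj v p) ∨ (u ∈ I ∧ G.graph.Adj u p) := by
      intro u
      simp only [Finset.mem_union, Finset.mem_singleton, List.mem_toFinset, hm, false_or]
      constructor
      · rintro ⟨rfl | hu, w, hw, huw⟩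
        · rcases hI.out_v w huw with h | rfl
          exacts [absurd (Or.inr h) hw, Or.inl ⟨rfl, huw⟩]
        · rcases hI.out_mem u hu w huw with h | rfl
          exacts [absurd (Or.inr h) hw, Or.inr ⟨hu, huw⟩]
      · have hpn : ¬ (p = v ∨ p ∈ I) := by
          rintro (h | h)
          exacts [hI.ne h.symm, hI.p_notMem h]
        rintro (⟨rfl, h⟩ | ⟨hu, h⟩)
        exacts [⟨Or.inl rfl, p, hpn, h⟩, ⟨Or.inr hu, p, hpn, h⟩]
    have hvI : v ∉ I.filter fun y => G.graph.Adj y p := fun h =>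
      hI.v_notMem (Finset.mem_filter.1 h).1
    by_cases hvp : G.graph.Adj v p
    · rw [if_pos hvp, add_comm, ← Finset.sum_insert hvI, PeakMem.mem]
      refine Finset.sum_congr ?_ fun _ _ => rfl
      ext u
      rw [Finset.mem_insert, Finset.mem_filter (p := fun y => G.graph.Adj y p)]
      simp only [Finset.mem_filter]
      rw [hset]; tauto
    · rw [if_neg hvp, add_zero, PeakMem.mem]
      refine Finset.sum_congr ?_ fun _ _ => rfl
      ext u
      simp only [Finset.mem_filter]
      rw [hset]; tauto
  linarith

/-- The sink of the block graph has size plus scratch zero and its size is the memory in use before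
it, so executing it leaves the profile constant. These are the constant tails required by
`exists_index`. -/
theorem IsBlockGraph.profile_values (hH : IsBlockGraph G v p I H e a b)
    (hI : IsBlock G.graph.Adj v p I) {m : List W} (hm : ∀ x, x ∈ m.map e ↔ x ∈ I)
    (ht : Topo H.graph.Adj (a :: (m ++ [b]))) :
    let X : ℕ → ℝ := fun i => (H.internalProfile (a :: (m ++ [b]))).getD i 0
    (∀ i ≤ m.length, blockMem G.graph.Adj G.size v (m.map e) i =
      X (2 * i) + IsBlockGraph.offset G v p) ∧
    (∀ i (hi : i < m.length), X (2 * i + 1) = X (2 * i) + (G.size (e m[i]) + G.scratch (e m[i]))) ∧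
    X (2 * m.length) = H.size b ∧ X (2 * m.length + 1) = H.size b ∧
    X (2 * m.length + 2) = H.size b := by
  intro X
  have hmI : ∀ c ∈ m, e c ∈ I := fun c hc => (hm _).1 (List.mem_map_of_mem hc)
  have hX : ∀ i, X i = (prof (PeakMem.mem H.graph.Adj (· = b) H.size)
      (fun x => H.size x + H.scratch x) {a} (m ++ [b])).getD i 0 := fun i => by
    simp only [X]; rw [CompGraph.internalProfile_eq H ht]
  have heven : ∀ i ≤ m.length + 1, X (2 * i) =
      PeakMem.mem H.graph.Adj (· = b) H.size ({a} ∪ ((m ++ [b]).take i).toFinset) := fun i hi => by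
    rw [hX, prof_getD _ _ _ _ _ (by simpa using hi)]
  have hodd : ∀ i (hi : i < (m ++ [b]).length), X (2 * i + 1) =
      PeakMem.mem H.graph.Adj (· = b) H.size ({a} ∪ ((m ++ [b]).take i).toFinset) +
        (H.size (m ++ [b])[i] + H.scratch (m ++ [b])[i]) := fun i hi => by
    rw [hX, prof_getD_odd _ _ _ _ _ hi]
  have htake : ∀ i ≤ m.length, (m ++ [b]).take i = m.take i := fun i hi =>
    List.take_append_of_le_length hi
  have hend := hH.blockMem_end hI hm
  have h2 : X (2 * m.length) = H.size b := by
    rw [heven _ (by omega), htake _ le_rfl, List.take_length, hend]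
  refine ⟨fun i hi => ?_, fun i hi => ?_, h2, ?_, ?_⟩
  · rw [heven i (by omega), htake i hi, hH.blockMem_eq hI hmI]
  · rw [hodd i (by simp; omega), heven i (by omega)]
    have : (m ++ [b])[i]'(by simp; omega) = m[i] := List.getElem_append_left hi
    rw [this, hH.size _ (hmI _ (List.getElem_mem _)), hH.scratch _ (hmI _ (List.getElem_mem _))]
  · rw [hodd m.length (by simp), htake _ le_rfl, List.take_length, hend]
    have : (m ++ [b])[m.length]'(by simp) = b := by simp
    rw [this, hH.scratch_b]; ring
  · rw [show 2 * m.length + 2 = 2 * (m.length + 1) by ring, heven _ le_rfl,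
      List.take_of_length_le (by simp)]
    have : ({a} ∪ (m ++ [b]).toFinset : Finset W) = Finset.univ := by
      ext c
      have := ht.complete c
      simp only [List.mem_cons, List.mem_append] at this
      simp only [Finset.mem_union, Finset.mem_singleton, List.toFinset_append, List.mem_toFinset,
        Finset.mem_univ, iff_true, List.mem_singleton]
      tauto
    rw [this, mem_univ_of_forall_not]

theorem IsBlockGraph.topo_of_order (hH : IsBlockGraph G v p I H e a b)
    (hI : IsBlock G.graph.Adj v p I) {m : List W} (hl : IsOrder G.graph.Adj I (m.map e)) :
    Topo H.graph.Adj (a :: (m ++ [b])) := by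
  have hac := G.acyclic
  have hmI : ∀ c ∈ m, e c ∈ I := fun c hc => (hl.mem_iff _).1 (List.mem_map_of_mem hc)
  have hmem : ∀ c, e c ∈ I → c ∈ m := fun c hc => by
    obtain ⟨d, hd, hde⟩ := List.mem_map.1 ((hl.mem_iff _).2 hc)
    exact hH.inj hde ▸ hd
  have ham : a ∉ m := fun h => hI.v_notMem (hH.map_a ▸ hmI a h)
  have hbm : b ∉ m := fun h => hI.p_notMem (hH.map_b ▸ hmI b h)
  have hto_a : ∀ c, c ∈ m ∨ c = b → ¬ H.graph.Adj c a := by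
    intro c hc h
    rw [hH.adj, hH.map_a] at h
    rcases hc with hc | rfl
    · exact hac v (.tail (hI.reach_v _ (hmI c hc)) h)
    · rw [hH.map_b] at h; exact hac v (.tail hI.reach h)
  refine ⟨fun c hc => H.acyclic c (.single hc), ?_, ?_, ?_⟩
  · rw [List.nodup_cons, List.nodup_append]
    refine ⟨?_, (List.Nodup.of_map _ hl.nodup), by simp, ?_⟩
    · simp only [List.mem_append, List.mem_singleton, not_or]; exact ⟨ham, hH.ne hI⟩
    · rintro c hc d hd rfl
      rw [List.mem_singleton] at hd
      exact hbm (hd ▸ hc)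
  · intro c
    simp only [List.mem_cons, List.mem_append, List.not_mem_nil, or_false]
    by_cases h1 : c = a
    · exact Or.inl h1
    by_cases h2 : c = b
    · exact Or.inr (Or.inr h2)
    · exact Or.inr (Or.inl (hmem c (hH.mem c h1 h2)))
  · rw [List.pairwise_cons, List.pairwise_append]
    refine ⟨fun c hc => hto_a c (by simpa using hc), ?_, by simp, ?_⟩
    · have := hl.topological
      rw [List.pairwise_map] at this
      exact this.imp fun {c d} h h' => h ((hH.adj _ _).1 h')
    · intro c hc d hd h
      rw [List.mem_singleton.1 hd, hH.adj, hH.map_b] at h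
      exact hac p (.head h (hI.reach_p _ (hmI c hc)))

/-- A dominant schedule of the block yields a best order. -/
theorem IsBlockGraph.isBest (hH : IsBlockGraph G v p I H e a b) (hI : IsBlock G.graph.Adj v p I) {σ : List W}
    (hσ : H.IsDominant σ) : ∃ m, σ = a :: (m ++ [b]) ∧ IsOrder G.graph.Adj I (m.map e) ∧
      IsBest G.graph.Adj G.size (fun x => G.size x + G.scratch x) v I (m.map e) := by
  have ht := H.isSchedule_iff.1 hσ.isSchedule
  obtain ⟨s, m, t, rfl⟩ := exists_cons_append_singleton (hH.ne hI) (ht.complete a) (ht.complete b)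
  -- Paths of `G` starting in the block and ending at a vertex of the block never leave it, so they
  -- are paths of `H`. This forces every schedule of `H` to begin with `a` and to end with `b`.
  have hpath : ∀ x y, Relation.TransGen G.graph.Adj x y → (x = v ∨ x ∈ I) →
      ∀ d, e d = y → ∀ c, e c = x → Relation.TransGen H.graph.Adj c d := by
    intro x y hxy
    induction hxy using Relation.TransGen.head_induction_on with
    | @single x h =>
      rintro hx d rfl c rfl
      exact .single ((hH.adj _ _).2 h)
    | @head x z h _ ih =>
      rintro hx d rfl c rfl
      have hz : z ∈ I ∨ z = p := by
        rcases hx with hx | hx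
        · exact hI.out_v z (hx ▸ h)
        · exact hI.out_mem _ hx z h
      rcases hz with hz | hz
      · obtain ⟨c', rfl⟩ := hH.range z hz
        exact .head ((hH.adj _ _).2 h) (ih (Or.inr hz) d rfl c' rfl)
      · exfalso
        rename_i hpd
        rw [hz] at hpd
        -- nothing in the block lies behind its end
        have hd : e d = v ∨ e d ∈ I ∨ e d = p := by
          by_cases h1 : d = a
          · exact Or.inl (h1 ▸ hH.map_a)
          by_cases h2 : d = b
          · exact Or.inr (Or.inr (h2 ▸ hH.map_b))
          · exact Or.inr (Or.inl (hH.mem d h1 h2))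
        rcases hd with hd | hd | hd
        · rw [hd] at hpd; exact G.acyclic v (hI.reach.trans hpd)
        · exact G.acyclic _ (hpd.trans (hI.reach_p _ hd))
        · rw [hd] at hpd; exact G.acyclic _ hpd
  have hs : s = a := by
    by_contra hne
    have : s ≠ b := by
      rintro rfl
      have := hpath v _ hI.reach (Or.inl rfl) s hH.map_b a hH.map_a
      rw [← List.nil_append (s :: _)] at ht
      exact absurd (ht.mem_pre_of_transGen this) (by simp)
    have h1 := hpath v _ (hI.reach_v _ (hH.mem s hne this)) (Or.inl rfl) s rfl a hH.map_a
    rw [← List.nil_append (s :: _)] at ht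
    exact absurd (ht.mem_pre_of_transGen h1) (by simp)
  have htb : t = b := by
    by_contra hne
    have hta : t ≠ a := by
      rintro rfl
      subst hs
      have := ht.nodup
      simp at this
    have h1 := hpath _ _ (hI.reach_p _ (hH.mem t hta hne)) (Or.inr (hH.mem t hta hne)) b hH.map_b t rfl
    obtain ⟨w, hw, -⟩ := Relation.TransGen.head'_iff.1 h1
    rw [← List.cons_append] at ht
    exact ht.not_adj_last w hw
  subst hs htb
  have hnd := ht.nodup
  rw [List.nodup_cons, List.nodup_append] at hnd
  have hmI : ∀ c ∈ m, e c ∈ I := by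
    intro c hc
    refine hH.mem c ?_ ?_
    · rintro rfl; exact hnd.1 (List.mem_append_left _ hc)
    · rintro rfl; exact hnd.2.2.2 c hc c (by simp) rfl
  have hord : IsOrder G.graph.Adj I (m.map e) := by
    refine ⟨hnd.2.1.map hH.inj, fun x => ⟨?_, fun hx => ?_⟩, ?_⟩
    · intro h
      obtain ⟨c, hc, rfl⟩ := List.mem_map.1 h
      exact hmI c hc
    · obtain ⟨c, rfl⟩ := hH.range x hx
      refine List.mem_map_of_mem ?_
      have := ht.complete c
      simp only [List.mem_cons, List.mem_append, List.not_mem_nil, or_false] at this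
      rcases this with rfl | h | rfl
      · rw [hH.map_a] at hx; exact absurd hx hI.v_notMem
      · exact h
      · rw [hH.map_b] at hx; exact absurd hx hI.p_notMem
    · rw [List.pairwise_map]
      have := ht.topological
      rw [List.pairwise_cons, List.pairwise_append] at this
      exact this.2.1.imp fun {c d} h h' => h ((hH.adj _ _).2 h')
  refine ⟨m, rfl, hord, ?_⟩
  intro l hl
  obtain ⟨l', rfl⟩ : ∃ l' : List W, l'.map e = l := by
    have : Nonempty W := ⟨s⟩
    refine ⟨l.map (Function.invFun e), ?_⟩
    rw [List.map_map]
    refine (List.map_congr_left fun x hx => ?_).trans (List.map_id l)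
    obtain ⟨c, hc⟩ := hH.range x ((hl.mem_iff x).1 hx)
    exact Function.invFun_eq ⟨c, hc⟩
  have ht' := hH.topo_of_order hI hl
  obtain ⟨c, c0, hcm, hcl, hc⟩ := (hσ.internal _ (H.isSchedule_iff.2 ht')).dom.exists_breaks
  obtain ⟨hX1, hX2, hX3, hX4, hX5⟩ :=
    hH.profile_values hI hord.mem_iff ht
  obtain ⟨hY1, hY2, hY3, hY4, hY5⟩ :=
    hH.profile_values hI hl.mem_iff ht'
  have hlm : m.length = I.card := by rw [← hord.length, List.length_map]
  have hll : l'.length = I.card := by rw [← hl.length, List.length_map]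
  rw [CompGraph.internalProfile_eq H ht, CompGraph.internalProfile_eq H ht', prof_length,
    prof_length, List.length_append, List.length_append, hlm, hll] at hcl
  rw [CompGraph.internalProfile_eq H ht', prof_length, List.length_append, hll,
    ← CompGraph.internalProfile_eq H ht'] at hc
  simp only [List.length_singleton] at hcl hc
  rw [show 2 * (I.card + 1) + 1 = 2 * I.card + 3 by ring] at hcl hc
  rw [hlm] at hX1 hX3 hX4 hX5
  rw [hll] at hY1 hY3 hY4 hY5
  replace hX2 := fun i (hi : i < I.card) => hX2 i (hlm ▸ hi)
  replace hY2 := fun i (hi : i < I.card) => hY2 i (hll ▸ hi)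
  have hw0 : ∀ x, 0 ≤ G.size x + G.scratch x := fun x => by
    have := G.neg_size_le_scratch x
    linarith
  set X : ℕ → ℝ := fun i => (H.internalProfile (s :: (m ++ [t]))).getD i 0 with hX
  set Y : ℕ → ℝ := fun i => (H.internalProfile (s :: (l' ++ [t]))).getD i 0 with hY
  obtain ⟨g, g1, g2, g3, g4, g5, g6⟩ := exists_index (k := I.card) (X := X) (Y := Y) (c := c)
    (fun i hi => by rw [hX2 i hi]; have := hw0 (e m[i]); linarith)
    (by rw [hX3, hX4]) (by rw [hX3, hX5])
    (fun i hi => by rw [hY2 i hi]; have := hw0 (e l'[i]); linarith)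
    (fun i hi => by
      have h1 := blockMem_succ_le G hI hl (i := i) (by simpa [hll] using hi)
      rw [hY1 (i + 1) (by omega), hY1 i (by omega), List.getElem_map] at h1
      rw [hY2 i hi, show 2 * i + 2 = 2 * (i + 1) by ring]
      linarith)
    (by rw [hY3, hY4]) (by rw [hY3, hY5]) (by rw [hX3, hY3]) c0 hcm (by omega) hc
  refine ⟨g, g1, g2, g3, fun j hj => ?_, fun j hj i hi h1 h2 => ?_⟩
  · rw [hX1 _ (g4 j hj), hY1 j hj]
    have := g5 j hj
    linarith
  · have hj' : j < I.card := by rwa [hl.length] at hj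
    have hi' : i < I.card := by rwa [hord.length] at hi
    have := g6 j hj' i hi' h1 h2
    rw [hX2 i hi', hY2 j hj'] at this
    rw [hX1 i hi'.le, hY1 j hj'.le]
    simp only [List.getElem_map]
    linarith

end Embedding

end PeakMem

/-! ### Reachability and the number of edges in series-parallel graphs -/

namespace PeakMem

open Relation

section SeriesParallel

variable {V : Type*}

/-- If an edge into a vertex behind `v` starts at a vertex that is not behind `v`, then every path
from `v` leads to this vertex. -/
def SPAt (Adj : V → V → Prop) (v : V) : Prop :=
  ∀ x u, x ≠ v → ReflTransGen Adj v x → Adj u x → ¬ ReflTransGen Adj v u →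
    ∀ w, Adj v w → ReflTransGen Adj w x

/-- The basic properties of series-parallel graphs. -/
structure IsSPOn.Facts (U : Set V) (D : Digraph V) (s t : V) : Prop where
  ne : s ≠ t
  source_mem : s ∈ U
  sink_mem : t ∈ U
  mem : ∀ a b, D.Adj a b → a ∈ U ∧ b ∈ U
  not_adj_source : ∀ a, ¬ D.Adj a s
  not_adj_sink : ∀ a, ¬ D.Adj t a
  source : ∀ x ∈ U, ReflTransGen D.Adj s x
  sink : ∀ x ∈ U, ReflTransGen D.Adj x t
  sp : ∀ v ∈ U, SPAt D.Adj v

theorem ReflTransGen.of_forall_left {r r' : V → V → Prop} {S : V → Prop}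
    (h : ∀ a b, S a → r a b → r' a b ∧ S b) {a b : V} (ha : S a) (hab : ReflTransGen r a b) :
    ReflTransGen r' a b ∧ S b := by
  induction hab with
  | refl => exact ⟨.refl, ha⟩
  | tail _ h2 ih => exact ⟨ih.1.tail (h _ _ ih.2 h2).1, (h _ _ ih.2 h2).2⟩

theorem ReflTransGen.of_forall_right {r r' : V → V → Prop} {S : V → Prop}
    (h : ∀ a b, S b → r a b → r' a b ∧ S a) {a b : V} (hb : S b) (hab : ReflTransGen r a b) :
    ReflTransGen r' a b ∧ S a := by
  induction hab using ReflTransGen.head_induction_on with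
  | refl => exact ⟨.refl, hb⟩
  | head h1 _ ih => exact ⟨.head (h _ _ ih.2 h1).1 ih.1, (h _ _ ih.2 h1).2⟩

theorem ReflTransGen.eq_of_forall_not_right {r : V → V → Prop} {a b : V}
    (h : ReflTransGen r a b) (hb : ∀ c, ¬ r c b) : a = b := by
  rcases h.cases_tail with h | ⟨c, -, hc⟩
  exacts [h.symm, absurd hc (hb c)]

theorem ReflTransGen.eq_of_forall_not_left {r : V → V → Prop} {a b : V}
    (h : ReflTransGen r a b) (ha : ∀ c, ¬ r a c) : a = b := by
  rcases h.cases_head with h | ⟨c, hc, -⟩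
  exacts [h, absurd hc (ha c)]

theorem ReflTransGen.left_of_le {r r' : V → V → Prop} (h : ∀ a b, r a b → r' a b) {a b : V}
    (hab : ReflTransGen r a b) : ReflTransGen r' a b := ReflTransGen.mono h _ _ hab

/-- The two parts meet only in `m`, a sink of the first and a source of the second: nothing returns
from `U₂`, and nothing enters `U₁` from outside. For `SPAt`, either `v` and `x` can be treated
inside one part, or `v` lies in the first and `x` in the second, and then every path reaches `x`
through `m`. -/
theorem IsSPOn.Facts.series {U₁ U₂ : Set V} {D₁ D₂ : Digraph V} {s m t : V}
    (f₁ : IsSPOn.Facts U₁ D₁ s m) (f₂ : IsSPOn.Facts U₂ D₂ m t) (h : U₁ ∩ U₂ = {m}) :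
    IsSPOn.Facts (U₁ ∪ U₂) (D₁ ⊔ D₂) s t := by
  have hm : ∀ x, x ∈ U₁ → x ∈ U₂ → x = m := fun x h1 h2 => by
    have : x ∈ U₁ ∩ U₂ := ⟨h1, h2⟩
    rwa [h] at this
  have l₁ : ∀ {a b}, ReflTransGen D₁.Adj a b → ReflTransGen (D₁ ⊔ D₂).Adj a b :=
    ReflTransGen.left_of_le fun _ _ h => Or.inl h
  have l₂ : ∀ {a b}, ReflTransGen D₂.Adj a b → ReflTransGen (D₁ ⊔ D₂).Adj a b :=
    ReflTransGen.left_of_le fun _ _ h => Or.inr h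
  have e₂ : ∀ a b, a ∈ U₂ → (D₁ ⊔ D₂).Adj a b → D₂.Adj a b ∧ b ∈ U₂ := by
    rintro a b ha (hab | hab)
    · rw [hm a (f₁.mem a b hab).1 ha] at hab
      exact absurd hab (f₁.not_adj_sink b)
    · exact ⟨hab, (f₂.mem a b hab).2⟩
  have e₁ : ∀ a b, b ∈ U₁ → (D₁ ⊔ D₂).Adj a b → D₁.Adj a b ∧ a ∈ U₁ := by
    rintro a b hb (hab | hab)
    · exact ⟨hab, (f₁.mem a b hab).1⟩
    · rw [hm b hb (f₂.mem a b hab).2] at hab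
      exact absurd hab (f₂.not_adj_source a)
  refine ⟨?_, Or.inl f₁.source_mem, Or.inr f₂.sink_mem, ?_, ?_, ?_, ?_, ?_, ?_⟩
  · rintro rfl
    exact f₁.ne (hm _ f₁.source_mem f₂.sink_mem)
  · rintro a b (hab | hab)
    exacts [⟨Or.inl (f₁.mem a b hab).1, Or.inl (f₁.mem a b hab).2⟩,
      ⟨Or.inr (f₂.mem a b hab).1, Or.inr (f₂.mem a b hab).2⟩]
  · intro a ha
    exact f₁.not_adj_source a (e₁ a s f₁.source_mem ha).1
  · intro a ha
    exact f₂.not_adj_sink a (e₂ t a f₂.sink_mem ha).1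
  · rintro x (hx | hx)
    exacts [l₁ (f₁.source x hx), (l₁ (f₁.source m f₁.sink_mem)).trans (l₂ (f₂.source x hx))]
  · rintro x (hx | hx)
    exacts [(l₁ (f₁.sink x hx)).trans (l₂ (f₂.sink m f₂.source_mem)), l₂ (f₂.sink x hx)]
  · intro v hv x u hxv hvx hux hvu w hvw
    by_cases hv2 : v ∈ U₂
    · obtain ⟨h1, hx⟩ := ReflTransGen.of_forall_left e₂ hv2 hvx
      have hux' : D₂.Adj u x := by
        rcases hux with hux | hux
        · have := hm x (f₁.mem u x hux).2 hx
          rw [this] at h1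
          have := ReflTransGen.eq_of_forall_not_right h1 f₂.not_adj_source
          exact absurd (‹x = m›.trans this.symm) hxv
        · exact hux
      exact l₂ (f₂.sp v hv2 x u hxv h1 hux' (fun h => hvu (l₂ h)) w (e₂ v w hv2 hvw).1)
    · have hv1 : v ∈ U₁ := hv.resolve_right hv2
      have hvw1 : D₁.Adj v w := by
        rcases hvw with h | h
        exacts [h, absurd (f₂.mem v w h).1 hv2]
      by_cases hx : x ∈ U₁
      · obtain ⟨h1, -⟩ := ReflTransGen.of_forall_right e₁ hx hvx
        exact l₁ (f₁.sp v hv1 x u hxv h1 (e₁ u x hx hux).1 (fun h => hvu (l₁ h)) w hvw1)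
      · have hx2 : x ∈ U₂ := by
          rcases hux with h | h
          exacts [absurd (f₁.mem u x h).2 hx, (f₂.mem u x h).2]
        exact (l₁ (f₁.sink w (f₁.mem v w hvw1).2)).trans (l₂ (f₂.source x hx2))

/-- The source `s` is excluded as `v`, since every vertex lies behind it. From any other `v` of the
first part one stays in that part, and the other part contributes an edge into `x` only if `x = t`,
a vertex that everything reaches. -/
theorem IsSPOn.Facts.sp_parallel {U₁ U₂ : Set V} {D₁ D₂ : Digraph V} {s t : V}
    (f₁ : IsSPOn.Facts U₁ D₁ s t) (f₂ : IsSPOn.Facts U₂ D₂ s t) (h : U₁ ∩ U₂ = {s, t})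
    {v : V} (hv : v ∈ U₁) : SPAt (D₁ ⊔ D₂).Adj v := by
  have hm : ∀ x, x ∈ U₁ → x ∈ U₂ → x = s ∨ x = t := fun x h1 h2 => by
    have : x ∈ U₁ ∩ U₂ := ⟨h1, h2⟩
    rwa [h] at this
  have l₁ : ∀ {a b}, ReflTransGen D₁.Adj a b → ReflTransGen (D₁ ⊔ D₂).Adj a b :=
    ReflTransGen.left_of_le fun _ _ h => Or.inl h
  have l₂ : ∀ {a b}, ReflTransGen D₂.Adj a b → ReflTransGen (D₁ ⊔ D₂).Adj a b :=
    ReflTransGen.left_of_le fun _ _ h => Or.inr h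
  have e₁ : ∀ a b, (a ∈ U₁ ∧ a ≠ s) → (D₁ ⊔ D₂).Adj a b → D₁.Adj a b ∧ b ∈ U₁ ∧ b ≠ s := by
    rintro a b ⟨ha, has⟩ (hab | hab)
    · exact ⟨hab, (f₁.mem a b hab).2, fun hb => f₁.not_adj_source a (hb ▸ hab)⟩
    · rcases hm a ha (f₂.mem a b hab).1 with rfl | rfl
      · exact absurd rfl has
      · exact absurd hab (f₂.not_adj_sink b)
  intro x u hxv hvx hux hvu w hvw
  have hvs : v ≠ s := by
    rintro rfl
    rcases hux with h | h
    exacts [hvu (l₁ (f₁.source u (f₁.mem u x h).1)), hvu (l₂ (f₂.source u (f₂.mem u x h).1))]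
  obtain ⟨h1, hx, hxs⟩ := ReflTransGen.of_forall_left e₁ ⟨hv, hvs⟩ hvx
  obtain ⟨hvw', hw, -⟩ := e₁ v w ⟨hv, hvs⟩ hvw
  by_cases hxt : x = t
  · rw [hxt]; exact l₁ (f₁.sink w hw)
  · have hux' : D₁.Adj u x := by
      rcases hux with h | h
      · exact h
      · rcases hm x hx (f₂.mem u x h).2 with h | h
        exacts [absurd h hxs, absurd h hxt]
    exact l₁ (f₁.sp v hv x u hxv h1 hux' (fun h => hvu (l₁ h)) w hvw')

theorem IsSPOn.Facts.parallel {U₁ U₂ : Set V} {D₁ D₂ : Digraph V} {s t : V}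
    (f₁ : IsSPOn.Facts U₁ D₁ s t) (f₂ : IsSPOn.Facts U₂ D₂ s t) (h : U₁ ∩ U₂ = {s, t}) :
    IsSPOn.Facts (U₁ ∪ U₂) (D₁ ⊔ D₂) s t := by
  have l₁ : ∀ {a b}, ReflTransGen D₁.Adj a b → ReflTransGen (D₁ ⊔ D₂).Adj a b :=
    ReflTransGen.left_of_le fun _ _ h => Or.inl h
  have l₂ : ∀ {a b}, ReflTransGen D₂.Adj a b → ReflTransGen (D₁ ⊔ D₂).Adj a b :=
    ReflTransGen.left_of_le fun _ _ h => Or.inr h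
  refine ⟨f₁.ne, Or.inl f₁.source_mem, Or.inr f₂.sink_mem, ?_, ?_, ?_, ?_, ?_, ?_⟩
  · rintro a b (hab | hab)
    exacts [⟨Or.inl (f₁.mem a b hab).1, Or.inl (f₁.mem a b hab).2⟩,
      ⟨Or.inr (f₂.mem a b hab).1, Or.inr (f₂.mem a b hab).2⟩]
  · rintro a (ha | ha)
    exacts [f₁.not_adj_source a ha, f₂.not_adj_source a ha]
  · rintro a (ha | ha)
    exacts [f₁.not_adj_sink a ha, f₂.not_adj_sink a ha]
  · rintro x (hx | hx)
    exacts [l₁ (f₁.source x hx), l₂ (f₂.source x hx)]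
  · rintro x (hx | hx)
    exacts [l₁ (f₁.sink x hx), l₂ (f₂.sink x hx)]
  · rintro v (hv | hv)
    · exact f₁.sp_parallel f₂ h hv
    · rw [sup_comm]
      exact f₂.sp_parallel f₁ (by rw [Set.inter_comm]; exact h) hv

theorem IsSPOn.facts {U : Set V} {D : Digraph V} {s t : V} (h : IsSPOn U D s t) :
    IsSPOn.Facts U D s t := by
  induction h with
  | edge s t hst =>
    refine ⟨hst, by simp, by simp, ?_, ?_, ?_, ?_, ?_, ?_⟩
    · rintro a b ⟨rfl, rfl⟩; simp
    · rintro a ⟨rfl, h⟩; exact hst h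
    · rintro a ⟨h, rfl⟩; exact hst h.symm
    · rintro x (rfl | rfl)
      exacts [.refl, .single ⟨rfl, rfl⟩]
    · rintro x (rfl | rfl)
      exacts [.single ⟨rfl, rfl⟩, .refl]
    · rintro v (rfl | rfl) x u hx hvx ⟨rfl, rfl⟩ hvu
      · exact absurd .refl hvu
      · exact absurd rfl hx
  | series U₁ U₂ D₁ D₂ s m t _ _ h f₁ f₂ => exact f₁.series f₂ h
  | parallel U₁ U₂ D₁ D₂ s t _ _ h f₁ f₂ => exact f₁.parallel f₂ h

/-- Leaving out the edge from source to sink makes the bound additive under parallel composition,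
where the vertex sets share two elements. In a series composition the two omitted edges of the parts
have to be counted, which is paid for by the vertex sets sharing only one element. -/
theorem IsSPOn.ncard_edges [Finite V] {U : Set V} {D : Digraph V} {s t : V} (h : IsSPOn U D s t) :
    {e : V × V | D.Adj e.1 e.2 ∧ e ≠ (s, t)}.ncard + 4 ≤ 2 * U.ncard := by
  induction h with
  | edge s t hst =>
    rw [Set.ncard_pair hst]
    have : {e : V × V | (⟨fun a b => a = s ∧ b = t⟩ : Digraph V).Adj e.1 e.2 ∧ e ≠ (s, t)} = ∅ := by
      ext ⟨a, b⟩
      simp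
    rw [this]; simp
  | series U₁ U₂ D₁ D₂ s m t h₁ h₂ h ih₁ ih₂ =>
    have hU := Set.ncard_union_add_ncard_inter U₁ U₂
    rw [h, Set.ncard_singleton] at hU
    have hsub : {e : V × V | (D₁ ⊔ D₂).Adj e.1 e.2 ∧ e ≠ (s, t)} ⊆
        ({e : V × V | D₁.Adj e.1 e.2 ∧ e ≠ (s, m)} ∪ {e : V × V | D₂.Adj e.1 e.2 ∧ e ≠ (m, t)}) ∪
          {(s, m), (m, t)} := by
      rintro e ⟨h | h, -⟩
      · by_cases he : e = (s, m)
        · right; left; exact he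
        · left; left; exact ⟨h, he⟩
      · by_cases he : e = (m, t)
        · right; right; exact he
        · left; right; exact ⟨h, he⟩
    have h2 : ({(s, m), (m, t)} : Set (V × V)).ncard ≤ 2 := by
      have := Set.ncard_insert_le (s, m) {(m, t)}
      rwa [Set.ncard_singleton] at this
    have h3 := (Set.ncard_le_ncard hsub).trans ((Set.ncard_union_le _ _).trans
      (Nat.add_le_add (Set.ncard_union_le _ _) h2))
    omega
  | parallel U₁ U₂ D₁ D₂ s t h₁ h₂ h ih₁ ih₂ =>
    have hU := Set.ncard_union_add_ncard_inter U₁ U₂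
    rw [h, Set.ncard_pair h₁.facts.ne] at hU
    have hsub : {e : V × V | (D₁ ⊔ D₂).Adj e.1 e.2 ∧ e ≠ (s, t)} ⊆
        ({e : V × V | D₁.Adj e.1 e.2 ∧ e ≠ (s, t)} ∪ {e : V × V | D₂.Adj e.1 e.2 ∧ e ≠ (s, t)}) := by
      rintro e ⟨h | h, he⟩
      exacts [Or.inl ⟨h, he⟩, Or.inr ⟨h, he⟩]
    have h3 := (Set.ncard_le_ncard hsub).trans (Set.ncard_union_le _ _)
    omega

end SeriesParallel

end PeakMem

/-! ### The reduction: processed vertices, merge vertices and blocks -/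

namespace PeakMem

open Relation

section Reduction

variable {V : Type*}

theorem ReflTransGen.comparable {r : V → V → Prop} {S : V → Prop}
    (hS : ∀ a b, S a → r a b → S b) (hf : ∀ a b c, S a → r a b → r a c → b = c) {a b c : V}
    (ha : S a) (hb : ReflTransGen r a b) (hc : ReflTransGen r a c) :
    ReflTransGen r b c ∨ ReflTransGen r c b := by
  induction hb using ReflTransGen.head_induction_on with
  | refl => exact Or.inl hc
  | @head a a' h1 h2 ih =>
    rcases hc.cases_head with rfl | ⟨a'', h3, h4⟩
    · exact Or.inr (.head h1 h2)
    · obtain rfl := hf _ _ _ ha h1 h3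
      exact ih (hS _ _ ha h1) h4

theorem ReflTransGen.antisymm {r : V → V → Prop} (h : ∀ v, ¬ TransGen r v v) {a b : V}
    (hab : ReflTransGen r a b) (hba : ReflTransGen r b a) : a = b := by
  rcases reflTransGen_iff_eq_or_transGen.1 hab with e | hab
  · exact e.symm
  · exact absurd (hab.trans_left hba) (h a)

/-- In the graph with edge relation `Adj` the vertices in `P` have been processed: they have at
most one out-neighbour. -/
structure Reduced (Adj₀ Adj : V → V → Prop) (s t : V) (P : V → Prop) : Prop where
  adj_iff : ∀ v, ¬ P v → ∀ w, Adj v w ↔ Adj₀ v w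
  closed : ∀ v w, P v → Adj v w → P w
  unique : ∀ v w w', P v → Adj v w → Adj v w' → w = w'
  not_adj_sink : ∀ w, ¬ Adj t w
  exists_adj : ∀ v, v ≠ t → ∃ w, Adj v w
  source : ∀ x, ReflTransGen Adj s x
  sp : ∀ v, ¬ P v → SPAt Adj v

theorem exists_reach_sink [Finite V] {Adj : V → V → Prop} {t : V} (hac : ∀ v, ¬ TransGen Adj v v)
    (h : ∀ v, v ≠ t → ∃ w, Adj v w) (x : V) : ReflTransGen Adj x t := by
  have : Std.Irrefl (Function.swap (TransGen Adj)) := ⟨hac⟩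
  have : IsTrans V (Function.swap (TransGen Adj)) := ⟨fun a b c h1 h2 => TransGen.trans h2 h1⟩
  have hwf : WellFounded (Function.swap (TransGen Adj)) :=
    Finite.wellFounded_of_trans_of_irrefl _
  induction x using hwf.induction with
  | _ x ih =>
    by_cases hx : x = t
    · rw [hx]
    · obtain ⟨w, hw⟩ := h x hx
      exact .head hw (ih w (.single hw))

open Classical in
/-- The vertices behind `v` that are not behind all out-neighbours of `v`. -/
noncomputable def inner [Fintype V] (Adj : V → V → Prop) (v : V) : Finset V :=
  Finset.univ.filter fun x => (∃ w, Adj v w ∧ ReflTransGen Adj w x) ∧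
    ∃ w, Adj v w ∧ ¬ ReflTransGen Adj w x

/-- The first vertex that lies behind all out-neighbours of `v`. -/
structure IsMerge (Adj : V → V → Prop) (v p : V) : Prop where
  reach : ∀ w, Adj v w → ReflTransGen Adj w p
  first : ∀ x, (∀ w, Adj v w → ReflTransGen Adj w x) → ReflTransGen Adj p x

theorem mem_inner [Fintype V] {Adj : V → V → Prop} {v x : V} :
    x ∈ inner Adj v ↔ (∃ w, Adj v w ∧ ReflTransGen Adj w x) ∧
      ∃ w, Adj v w ∧ ¬ ReflTransGen Adj w x := by
  simp [inner]

variable {Adj₀ Adj : V → V → Prop} {s t v p : V} {P : V → Prop}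

theorem Reduced.closed_reach (hR : Reduced Adj₀ Adj s t P) {a b : V} (ha : P a)
    (h : ReflTransGen Adj a b) : P b :=
  (ReflTransGen.of_forall_left (r' := Adj) (fun a b ha hab => ⟨hab, hR.closed a b ha hab⟩) ha h).2

theorem Reduced.comparable (hR : Reduced Adj₀ Adj s t P) {a b c : V} (ha : P a)
    (hb : ReflTransGen Adj a b) (hc : ReflTransGen Adj a c) :
    ReflTransGen Adj b c ∨ ReflTransGen Adj c b :=
  ReflTransGen.comparable (S := P) hR.closed (fun a b c ha => hR.unique a b c ha) ha hb hc

/-- Paths from outside into the block pass through its first vertex. -/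
theorem IsBlock.reach_of_mem {I : Finset V} (hI : IsBlock Adj v p I) {a u : V} (ha : a ∉ I)
    (h : ReflTransGen Adj a u) (hu : u ∈ I) : ReflTransGen Adj a v := by
  induction h with
  | refl => exact absurd hu ha
  | @tail b c hab hbc ih =>
    rcases hI.in_mem _ hu _ hbc with h | rfl
    exacts [ih h, hab]

theorem IsBlock.of_reach {I : Finset V} (hI : IsBlock Adj v p I) {z : V}
    (h : ReflTransGen Adj v z) : z = v ∨ z ∈ I ∨ ReflTransGen Adj p z := by
  induction h with
  | refl => exact Or.inl rfl
  | @tail b c _ hbc ih =>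
    rcases ih with rfl | hb | hb
    · rcases hI.out_v c hbc with h | rfl
      exacts [Or.inr (Or.inl h), Or.inr (Or.inr .refl)]
    · rcases hI.out_mem b hb c hbc with h | rfl
      exacts [Or.inr (Or.inl h), Or.inr (Or.inr .refl)]
    · exact Or.inr (Or.inr (hb.tail hbc))

/-- A path from outside enters the block through `v`, and `v` reaches every vertex of the block and
`p` in both graphs. Reachability from outside is thus independent of how the inside is wired; the
lemma is used in both directions. -/
theorem IsBlock.reach_mono {Adj' : V → V → Prop} {I : Finset V} (hI : IsBlock Adj v p I)
    (hI' : IsBlock Adj' v p I) (h : ∀ a b, a ∉ I → a ≠ v → Adj a b → Adj' a b) {a x : V}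
    (ha : a ∉ I) (hax : ReflTransGen Adj a x) : ReflTransGen Adj' a x := by
  have key : ∀ z, z ∈ I ∨ z = p → TransGen Adj' v z := by
    rintro z (hz | rfl)
    exacts [hI'.reach_v z hz, hI'.reach]
  induction hax with
  | refl => exact .refl
  | @tail b c hab hbc ih =>
    by_cases hbv : b = v
    · rw [hbv] at ih hbc
      exact ih.trans (key c (hI.out_v c hbc)).to_reflTransGen
    by_cases hbI : b ∈ I
    · exact (hI'.reach_of_mem ha ih hbI).trans (key c (hI.out_mem b hbI c hbc)).to_reflTransGen
    · exact ih.tail (h b c hbI hbv hbc)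

/-- The block and `p` consist of processed vertices, so edges leaving unprocessed vertices other
than `v` are untouched, and `v` and `I` get the unique out-neighbours given by the path. The clause
that needs an argument is `sp`. -/
theorem Reduced.relink (hR : Reduced Adj₀ Adj s t P) (hac : ∀ v, ¬ TransGen Adj v v)
    (hvt : v ≠ t) (hv : ¬ P v) (hvP : ∀ w, Adj v w → P w) {I : Finset V} (hI : IsBlock Adj v p I)
    {σ : List V} (hσ : IsOrder Adj I σ) :
    Reduced Adj₀ (relink Adj v p I σ) s t (fun x => P x ∨ x = v) := by
  have hI' := hI.relink hσ
  have hIP : ∀ x ∈ I, P x := by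
    intro x hx
    obtain ⟨w, hw, hwx⟩ := TransGen.head'_iff.1 (hI.reach_v x hx)
    exact hR.closed_reach (hvP w hw) hwx
  have hpP : P p := by
    obtain ⟨w, hw, hwx⟩ := TransGen.head'_iff.1 hI.reach
    exact hR.closed_reach (hvP w hw) hwx
  have hreach : ∀ {a x}, a ∉ I → (ReflTransGen (PeakMem.relink Adj v p I σ) a x ↔
      ReflTransGen Adj a x) := by
    intro a x ha
    exact ⟨hI'.reach_mono hI (fun a b h1 h2 => (relink_of_notMem hI hσ h1 h2).1) ha,
      hI.reach_mono hI' (fun a b h1 h2 => (relink_of_notMem hI hσ h1 h2).2) ha⟩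
  have hn := hI.nodup_path hσ
  refine ⟨?_, ?_, ?_, ?_, ?_, ?_, ?_⟩
  · intro u hu w
    push Not at hu
    rw [relink_of_notMem hI hσ (fun h => hu.1 (hIP u h)) hu.2]
    exact hR.adj_iff u hu.1 w
  · rintro u w hu (⟨h1, h2, h3⟩ | h)
    · exact Or.inl (hR.closed u w (hu.resolve_right h2) h3)
    · have := (consec_path hn h).1.2
      rw [hσ.mem_iff] at this
      rcases this with rfl | h
      exacts [Or.inl hpP, Or.inl (hIP w h)]
  · intro u w w' hu h1 h2
    by_cases huI : u ∈ I ∨ u = v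
    · rw [relink_of_mem huI] at h1 h2
      exact h1.right_unique hn h2
    · push Not at huI
      rw [relink_of_notMem hI hσ huI.1 huI.2] at h1 h2
      exact hR.unique u w w' (hu.resolve_right huI.2) h1 h2
  · have htI : t ∉ I := by
      intro h
      obtain ⟨w, hw, -⟩ := TransGen.head'_iff.1 (hI.reach_p t h)
      exact hR.not_adj_sink w hw
    intro w hw
    rw [relink_of_notMem hI hσ htI hvt.symm] at hw
    exact hR.not_adj_sink w hw
  · intro u hu
    by_cases huI : u ∈ I ∨ u = v
    · have : TransGen (PeakMem.relink Adj v p I σ) u p := by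
        rcases huI with h | rfl
        exacts [hI'.reach_p u h, hI'.reach]
      obtain ⟨w, hw, -⟩ := TransGen.head'_iff.1 this
      exact ⟨w, hw⟩
    · push Not at huI
      obtain ⟨w, hw⟩ := hR.exists_adj u hu
      exact ⟨w, (relink_of_notMem hI hσ huI.1 huI.2).2 hw⟩
  · intro x
    refine (hreach ?_).2 (hR.source x)
    intro hs
    exact hac s (TransGen.trans_right (hR.source v) (hI.reach_v s hs))
  -- Only a new edge from `y` to `x` of the path is critical. As `u` does not reach `y`, it does not
  -- reach `v` either; since paths into `I` pass through `v`, this leaves `x = p`. Some old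
  -- in-neighbour of `p` behind `v` is also out of reach of `u` and takes the role of `y` in the old
  -- graph.
  · intro u hu x y hxu hux hyx huy w huw
    push Not at hu
    have huI : u ∉ I := fun h => hu.1 (hIP u h)
    rw [hreach huI] at hux huy
    rw [relink_of_notMem hI hσ huI hu.2] at huw
    have hwI : w ∉ I := by
      intro h
      rcases hI.in_mem w h u huw with h | h
      exacts [huI h, hu.2 h]
    rw [hreach hwI]
    rcases hyx with ⟨-, -, hyx⟩ | hyx
    · exact hR.sp u hu.1 x y hxu hux hyx huy w huw
    obtain ⟨⟨hy, hx⟩, -⟩ := consec_path hn hyx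
    rw [hσ.mem_iff] at hy hx
    have huv : ¬ ReflTransGen Adj u v := by
      intro h
      rcases hy with rfl | hy
      exacts [huy h, huy (h.trans (hI.reach_v y hy).to_reflTransGen)]
    rcases hx with rfl | hx
    · obtain ⟨z, hvz, hz⟩ := TransGen.tail'_iff.1 hI.reach
      refine hR.sp u hu.1 x z hxu hux hz (fun huz => ?_) w huw
      rcases hI.of_reach hvz with rfl | h | h
      · exact huv huz
      · exact huv (hI.reach_of_mem huI huz h)
      · exact hac x (TransGen.tail' h hz)
    · exact absurd (hI.reach_of_mem huI hux hx) huv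

/-- If every vertex has been processed, the graph is a path. -/
theorem Reduced.exists_path (hR : Reduced Adj₀ Adj s t P) (hac : ∀ v, ¬ TransGen Adj v v)
    (hP : ∀ v, P v) [Finite V] : ∃ L : List V, L.Nodup ∧ (∀ x, x ∈ L) ∧ L.head? = some s ∧
      (∀ a b, Consec L a b → Adj a b) ∧ Topo Adj L := by
  have : Std.Irrefl (Function.swap (TransGen Adj)) := ⟨hac⟩
  have : IsTrans V (Function.swap (TransGen Adj)) := ⟨fun a b c h1 h2 => TransGen.trans h2 h1⟩
  have hwf : WellFounded (Function.swap (TransGen Adj)) :=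
    Finite.wellFounded_of_trans_of_irrefl _
  have key : ∀ x, ∃ L : List V, L.head? = some x ∧ (∀ y, y ∈ L ↔ ReflTransGen Adj x y) ∧
      (L.Pairwise (TransGen Adj)) ∧ (∀ a b, Consec L a b → Adj a b) := by
    intro x
    induction x using hwf.induction with
    | _ x ih =>
      by_cases hx : ∃ w, Adj x w
      · obtain ⟨w, hw⟩ := hx
        obtain ⟨L, h1, h2, h3, h4⟩ := ih w (.single hw)
        refine ⟨x :: L, rfl, fun y => ?_, ?_, ?_⟩
        · rw [List.mem_cons, h2]
          constructor
          · rintro (rfl | h)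
            exacts [.refl, .head hw h]
          · intro h
            rcases h.cases_head with rfl | ⟨z, hz, hzy⟩
            · exact Or.inl rfl
            · rw [hR.unique x w z (hP x) hw hz]; exact Or.inr hzy
        · rw [List.pairwise_cons]
          exact ⟨fun y hy => TransGen.head' hw ((h2 y).1 hy), h3⟩
        · rintro a b ⟨i, ha, hb⟩
          rcases i with _ | i
          · simp only [List.getElem?_cons_zero, Option.some.injEq] at ha
            rw [List.getElem?_cons_succ, ← List.head?_eq_getElem?, h1] at hb
            rw [← ha, ← Option.some.inj hb]; exact hw
          · exact h4 a b ⟨i, by simpa using ha, by simpa using hb⟩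
      · push Not at hx
        refine ⟨[x], rfl, fun y => ?_, by simp, ?_⟩
        · rw [List.mem_singleton]
          constructor
          · rintro rfl; exact .refl
          · intro h; exact (ReflTransGen.eq_of_forall_not_left h hx).symm
        · rintro a b ⟨i, -, hb⟩
          simp at hb
  obtain ⟨L, h1, h2, h3, h4⟩ := key s
  have hn : L.Nodup := h3.imp fun {a b} (h : TransGen Adj a b) => by rintro rfl; exact hac _ h
  have hc : ∀ x, x ∈ L := fun x => (h2 x).2 (hR.source x)
  exact ⟨L, hn, hc, h1, h4, fun v hv => hac v (.single hv), hn, hc,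
    h3.imp fun {a b} (h : TransGen Adj a b) (h' : Adj b a) => hac a (h.tail h')⟩

variable [Fintype V]

/-- The vertices behind all out-neighbours of `v` include `t`, and they lie on the unique path from
any one out-neighbour. So they are linearly ordered by reachability, and a minimal one comes before
all others. -/
theorem Reduced.exists_merge (hR : Reduced Adj₀ Adj s t P) (hac : ∀ v, ¬ TransGen Adj v v)
    (hvt : v ≠ t) (hvP : ∀ w, Adj v w → P w) : ∃ p, IsMerge Adj v p := by
  have : Std.Irrefl (TransGen Adj) := ⟨hac⟩
  have hwf : WellFounded (TransGen Adj) := Finite.wellFounded_of_trans_of_irrefl _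
  obtain ⟨p, hp, hmin⟩ := hwf.has_min {x | ∀ w, Adj v w → ReflTransGen Adj w x}
    ⟨t, fun w _ => exists_reach_sink hac hR.exists_adj w⟩
  obtain ⟨w, hw⟩ := hR.exists_adj v hvt
  refine ⟨p, hp, fun x hx => ?_⟩
  rcases hR.comparable (hvP w hw) (hp w hw) (hx w hw) with h | h
  · exact h
  · rcases reflTransGen_iff_eq_or_transGen.1 h with rfl | h
    · exact .refl
    · exact absurd h (hmin x hx)

/-- A vertex behind `v` that is not an inner vertex lies behind `p`. An inner vertex has a unique
out-neighbour, through which its path to `p` must go; hence an edge leaving the inner part can only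
end at `p`. -/
theorem Reduced.isBlock (hR : Reduced Adj₀ Adj s t P) (hac : ∀ v, ¬ TransGen Adj v v)
    (hvt : v ≠ t) (hv : ¬ P v) (hvP : ∀ w, Adj v w → P w) (hp : IsMerge Adj v p) :
    IsBlock Adj v p (inner Adj v) := by
  have hvx : ∀ x ∈ inner Adj v, TransGen Adj v x := by
    intro x hx
    obtain ⟨⟨w, hw, hwx⟩, -⟩ := mem_inner.1 hx
    exact TransGen.head' hw hwx
  have hpx : ∀ x ∈ inner Adj v, ¬ ReflTransGen Adj p x := by
    intro x hx h
    obtain ⟨-, w, hw, hwx⟩ := mem_inner.1 hx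
    exact hwx ((hp.reach w hw).trans h)
  have hcase : ∀ x, (∃ w, Adj v w ∧ ReflTransGen Adj w x) → ¬ (x ∈ inner Adj v) →
      ReflTransGen Adj p x := by
    intro x hx hxI
    refine hp.first x fun w hw => ?_
    by_contra h
    exact hxI (mem_inner.2 ⟨hx, w, hw, h⟩)
  have hvp : TransGen Adj v p := by
    obtain ⟨w, hw⟩ := hR.exists_adj v hvt
    exact TransGen.head' hw (hp.reach w hw)
  have hxp : ∀ x ∈ inner Adj v, ReflTransGen Adj x p := by
    intro x hx
    obtain ⟨⟨w, hw, hwx⟩, -⟩ := mem_inner.1 hx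
    rcases hR.comparable (hvP w hw) hwx (hp.reach w hw) with h | h
    exacts [h, absurd h (hpx x hx)]
  refine ⟨fun h => hac v (hvx v h), fun h => hpx p h .refl, ?_, ?_, ?_, ?_, hvx, ?_, hvp⟩
  · rintro rfl; exact hac _ hvp
  · intro w hw
    by_cases hwI : w ∈ inner Adj v
    · exact Or.inl hwI
    · exact Or.inr (ReflTransGen.antisymm hac (hp.reach w hw) (hcase w ⟨w, hw, .refl⟩ hwI))
  · intro x hx w hxw
    by_cases hwI : w ∈ inner Adj v
    · exact Or.inl hwI
    · right
      obtain ⟨⟨w', hw', hwx'⟩, -⟩ := mem_inner.1 hx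
      have hpw := hcase w ⟨w', hw', hwx'.tail hxw⟩ hwI
      refine ReflTransGen.antisymm hac ?_ hpw
      have hxP : P x := hR.closed_reach (hvP w' hw') hwx'
      rcases (hxp x hx).cases_head with rfl | ⟨z, hz, hzp⟩
      · exact absurd .refl (hpx x hx)
      · rwa [hR.unique x w z hxP hxw hz]
  -- An edge into `x` from a vertex not behind `v` would, by `SPAt`, put `x` behind all
  -- out-neighbours of `v`, contrary to `x` being inner.
  · intro x hx u hux
    obtain ⟨⟨w₁, hw₁, hwx₁⟩, w₂, hw₂, hwx₂⟩ := mem_inner.1 hx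
    have hne : x ≠ v := by rintro rfl; exact hac _ (hvx _ hx)
    have hvu : ReflTransGen Adj v u := by
      by_contra h
      exact hwx₂ (hR.sp v hv x u hne (hvx x hx).to_reflTransGen hux h w₂ hw₂)
    rcases hvu.cases_head with rfl | ⟨w, hw, hwu⟩
    · exact Or.inr rfl
    · left
      refine mem_inner.2 ⟨⟨w, hw, hwu⟩, w₂, hw₂, fun h => hwx₂ (h.tail hux)⟩
  · intro x hx
    rcases reflTransGen_iff_eq_or_transGen.1 (hxp x hx) with rfl | h
    · exact absurd .refl (hpx _ hx)
    · exact h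

end Reduction

end PeakMem

/-! ### Blocks are starborescences -/

namespace PeakMem

open Relation

section Star

variable {W : Type*} {Adj : W → W → Prop} {a b : W}

/-- Every vertex except the source `a` and the sink `b` has exactly one out-neighbour, and every
vertex except the source has an in-neighbour. -/
structure IsStar (Adj : W → W → Prop) (a b : W) : Prop where
  acyclic : ∀ x, ¬ TransGen Adj x x
  not_adj_source : ∀ x, ¬ Adj x a
  not_adj_sink : ∀ x, ¬ Adj b x
  unique : ∀ x y z, x ≠ a → Adj x y → Adj x z → y = z
  exists_out : ∀ x, x ≠ b → ∃ y, Adj x y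
  exists_in : ∀ x, x ≠ a → ∃ y, Adj y x

theorem IsSPOn.congr {U U' : Set W} {D D' : Digraph W} {s t : W} (h : IsSPOn U D s t)
    (hU : ∀ x, x ∈ U ↔ x ∈ U') (hD : ∀ x y, D.Adj x y ↔ D'.Adj x y) : IsSPOn U' D' s t := by
  obtain rfl : U = U' := Set.ext hU
  obtain rfl : D = D' := by ext x y; exact hD x y
  exact h

/-- The vertices other than `a` from which `y` can be reached. -/
def above (Adj : W → W → Prop) (a y : W) : Set W := {x | x ≠ a ∧ ReflTransGen Adj x y}

theorem IsStar.above_source (h : IsStar Adj a b) (x : W) : x ∉ above Adj a a :=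
  fun hx => hx.1 (ReflTransGen.eq_of_forall_not_right hx.2 h.not_adj_source)

/-- The vertices reached from `x` form a chain, so one of `c`, `c'` would reach the other. This path
would start with the unique edge into `y`, and the edge from the other vertex to `y` would close a
cycle. -/
theorem IsStar.above_disjoint (h : IsStar Adj a b) {c c' y : W} (hc : Adj c y) (hc' : Adj c' y)
    (hne : c ≠ c') {x : W} (hx : x ∈ above Adj a c) (hx' : x ∈ above Adj a c') : False := by
  have key : ∀ c c', Adj c y → Adj c' y → c ≠ c' → c ≠ a → ReflTransGen Adj c c' → False := by
    intro c c' hc hc' hne hca hcc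
    rcases hcc.cases_head with e | ⟨z, hz, hzc⟩
    · exact hne e
    · rw [h.unique c z y hca hz hc] at hzc
      exact h.acyclic y (TransGen.tail' hzc hc')
  have hS : ∀ x y, x ≠ a → Adj x y → y ≠ a := by
    rintro x y - hxy rfl; exact h.not_adj_source _ hxy
  rcases ReflTransGen.comparable (S := fun x => x ≠ a) hS
    (fun x y z hx => h.unique x y z hx) hx.1 hx.2 hx'.2 with h1 | h1
  · exact key c c' hc hc' hne (fun e => h.above_source x (e ▸ hx)) h1
  · exact key c' c hc' hc hne.symm (fun e => h.above_source x (e ▸ hx')) h1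

/-- Well-founded induction along the edges. Each in-neighbour `c` of `y` contributes the graph above
`c` in series with the edge from `c` to `y`, or just this edge if `c = a`. These pieces meet only in
`a` and `y` by `above_disjoint`, so they can be composed in parallel. -/
theorem IsStar.isSPOn_above [Finite W] (h : IsStar Adj a b) (y : W) (hy : y ≠ a) :
    IsSPOn (above Adj a y ∪ {a}) ⟨fun u w => Adj u w ∧ w ∈ above Adj a y⟩ a y := by
  classical
  have := Fintype.ofFinite W
  have : Std.Irrefl (TransGen Adj) := ⟨h.acyclic⟩
  have hwf : WellFounded (TransGen Adj) := Finite.wellFounded_of_trans_of_irrefl _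
  induction y using hwf.induction with
  | _ y ih =>
  have hya : ∀ c, Adj c y → y ∉ above Adj a c := fun c hc hyc =>
    h.acyclic y (TransGen.tail' hyc.2 hc)
  have haa : ∀ c, a ∉ above Adj a c := fun c hc => hc.1 rfl
  have piece : ∀ c, Adj c y → IsSPOn (above Adj a c ∪ {a, y})
      ⟨fun u w => (u = c ∧ w = y) ∨ Adj u w ∧ w ∈ above Adj a c⟩ a y := by
    intro c hc
    by_cases hca : c = a
    · subst hca
      refine (IsSPOn.edge c y hy.symm).congr (fun x => ?_) (fun u w => ?_)
      · simp [h.above_source x]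
      · simp [h.above_source]
    · refine (IsSPOn.series _ _ _ _ a c y (ih c (.single hc) hca) (IsSPOn.edge c y ?_) ?_).congr
        (fun x => ?_) (fun u w => ?_)
      · rintro rfl; exact h.acyclic c (.single hc)
      · ext x
        simp only [Set.mem_inter_iff, Set.mem_union, Set.mem_singleton_iff, Set.mem_insert_iff]
        constructor
        · rintro ⟨hx | rfl, rfl | rfl⟩
          · rfl
          · exact absurd hx (hya c hc)
          · rfl
          · exact absurd rfl hy
        · rintro rfl
          exact ⟨Or.inl ⟨hca, .refl⟩, Or.inl rfl⟩
      · have : c ∈ above Adj a c := ⟨hca, .refl⟩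
        simp only [Set.mem_union, Set.mem_singleton_iff, Set.mem_insert_iff]
        constructor
        · rintro ((h | h) | rfl | h) <;> simp [*]
        · rintro (h | h | h) <;> simp [h]
      · simp only [Digraph.sup_adj]
        exact or_comm
  have all : ∀ C : Finset W, C.Nonempty → (∀ c ∈ C, Adj c y) →
      IsSPOn ({x | ∃ c ∈ C, x ∈ above Adj a c} ∪ {a, y})
        ⟨fun u w => (u ∈ C ∧ w = y) ∨ Adj u w ∧ ∃ c ∈ C, w ∈ above Adj a c⟩ a y := by
    intro C hC
    induction hC using Finset.Nonempty.cons_induction with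
    | singleton c =>
      intro hc
      refine (piece c (hc c (by simp))).congr (fun x => ?_) (fun u w => ?_) <;> simp
    | cons c C hcC hC ihC =>
      intro hc
      have hc' : ∀ d ∈ C, Adj d y := fun d hd => hc d (by simp [hd])
      refine (IsSPOn.parallel _ _ _ _ a y (piece c (hc c (by simp)))
        (ihC hc') ?_).congr (fun x => ?_) (fun u w => ?_)
      · ext x
        simp only [Set.mem_inter_iff, Set.mem_union, Set.mem_singleton_iff, Set.mem_insert_iff,
          Set.mem_ofPred_eq]
        constructor
        · rintro ⟨hx | hx, ⟨d, hd, hxd⟩ | hx'⟩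
          · exact (h.above_disjoint (hc c (by simp)) (hc' d hd)
              (fun e => hcC (e ▸ hd)) hx hxd).elim
          all_goals assumption
        · intro hx; exact ⟨Or.inr hx, Or.inr hx⟩
      · simp only [Set.mem_union, Set.mem_singleton_iff, Set.mem_insert_iff, Set.mem_ofPred_eq,
          Finset.mem_cons, exists_eq_or_imp]
        have : ∀ A B C D : Prop, (A ∨ C ∨ D) ∨ (B ∨ C ∨ D) ↔ (A ∨ B) ∨ C ∨ D := by tauto
        exact this _ _ _ _
      · simp only [Digraph.sup_adj, Finset.mem_cons, exists_eq_or_imp]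
        tauto
  obtain ⟨c₀, hc₀⟩ := h.exists_in y hy
  refine (all (Finset.univ.filter fun c => Adj c y) ⟨c₀, by simpa using hc₀⟩ (by simp)).congr
    (fun x => ?_) (fun u w => ?_)
  · simp only [Set.mem_union, Set.mem_singleton_iff, Set.mem_insert_iff, Set.mem_ofPred_eq,
      Finset.mem_filter, Finset.mem_univ, true_and]
    constructor
    · rintro (⟨c, hc, hx⟩ | rfl | rfl)
      · exact Or.inl ⟨hx.1, hx.2.tail hc⟩
      · exact Or.inr rfl
      · exact Or.inl ⟨hy, .refl⟩
    · rintro (⟨hxa, hx⟩ | rfl)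
      · rcases hx.cases_tail with rfl | ⟨c, hxc, hc⟩
        · simp
        · exact Or.inl ⟨c, hc, hxa, hxc⟩
      · simp
  · simp only [Finset.mem_filter, Finset.mem_univ, true_and]
    constructor
    · rintro (⟨huy, rfl⟩ | ⟨huw, c, hc, hw⟩)
      · exact ⟨huy, hy, .refl⟩
      · exact ⟨huw, hw.1, hw.2.tail hc⟩
    · rintro ⟨huw, hwa, hw⟩
      rcases hw.cases_tail with rfl | ⟨c, hwc, hc⟩
      · exact Or.inl ⟨huw, rfl⟩
      · exact Or.inr ⟨huw, c, hc, hwa, hwc⟩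

/-- Every vertex reaches `b`, so the graph above `b` is everything. Without `a` the underlying graph
is connected, and it is a tree because it has too few edges for a cycle. -/
theorem IsStar.isStarborescence [Finite W] {D : Digraph W} (h : IsStar D.Adj a b) (hab : a ≠ b) :
    IsStarborescence D := by
  classical
  have := Fintype.ofFinite W
  have hreach : ∀ x, ReflTransGen D.Adj x b :=
    exists_reach_sink h.acyclic h.exists_out
  refine ⟨a, b, (h.isSPOn_above b hab.symm).congr (fun x => ?_) (fun u w => ?_), hab.symm, ?_⟩
  · by_cases hx : x = a
    · simp [hx]
    · simp [hx, above, hreach]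
  · simp only [above, Set.mem_ofPred_eq, hreach, and_true, and_iff_left_iff_imp]
    rintro h1 rfl
    exact h.not_adj_source _ h1
  · refine ⟨?_, fun u v w hu hw => Subtype.ext (h.unique _ _ _ u.2 hu hw),
      fun w hw => h.not_adj_sink _ hw⟩
    choose! nx hnx using h.exists_out
    have hnxa : ∀ x, x ≠ b → nx x ≠ a := fun x hx e => h.not_adj_source x (e ▸ hnx x hx)
    let T := SimpleGraph.fromRel (inducedDigraph D {a}ᶜ).Adj
    have hconn : T.Connected := by
      have : Nonempty ({a}ᶜ : Set W) := ⟨⟨b, hab.symm⟩⟩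
      have hb : ∀ x : ({a}ᶜ : Set W), T.Reachable x ⟨b, hab.symm⟩ := by
        rintro ⟨x, hx⟩
        have := hreach x
        induction this using ReflTransGen.head_induction_on with
        | refl => exact .refl _
        | @head x y hxy _ ih =>
          have hya : y ∈ ({a}ᶜ : Set W) := fun e => h.not_adj_source x (by
            rw [Set.mem_singleton_iff] at e; rwa [e] at hxy)
          refine SimpleGraph.Reachable.trans (SimpleGraph.Adj.reachable ?_) (ih hya)
          rw [SimpleGraph.fromRel_adj]
          refine ⟨fun e => ?_, Or.inl hxy⟩
          have := congrArg Subtype.val e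
          simp only at this
          exact h.acyclic x (.single (by rwa [← this] at hxy))
      exact ⟨fun x y => (hb x).trans (hb y).symm⟩
    rw [SimpleGraph.isTree_iff_connected_and_card]
    refine ⟨hconn, le_antisymm ?_ hconn.card_vert_le_card_edgeSet_add_one⟩
    -- Every edge joins some vertex other than `b` to its unique out-neighbour `nx x`, so there are
    -- fewer edges than vertices. The value at `b` is never used.
    have hsub : T.edgeSet ⊆ (fun x : ({a}ᶜ : Set W) =>
        if hx : x.1 = b then s(x, x) else s(x, ⟨nx x, hnxa x hx⟩)) '' {⟨b, hab.symm⟩}ᶜ := by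
      intro e he
      induction e using Sym2.ind with
      | _ x y =>
      rw [SimpleGraph.mem_edgeSet, SimpleGraph.fromRel_adj] at he
      have key : ∀ x y : ({a}ᶜ : Set W), D.Adj x y → s(x, y) ∈ (fun x : ({a}ᶜ : Set W) =>
          if hx : x.1 = b then s(x, x) else s(x, ⟨nx x, hnxa x hx⟩)) '' {⟨b, hab.symm⟩}ᶜ := by
        intro x y hxy
        have hxb : x.1 ≠ b := fun e => h.not_adj_sink y (e ▸ hxy)
        refine ⟨x, fun e => hxb (congrArg Subtype.val e), ?_⟩
        have hy : (⟨nx x.1, hnxa x.1 hxb⟩ : ({a}ᶜ : Set W)) = y := Subtype.ext (h.unique x.1 (nx x.1) y.1 x.2 (hnx _ hxb) hxy)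
        simp only [dif_neg hxb, hy]
      rcases he.2 with h1 | h1
      · exact key x y h1
      · rw [Sym2.eq_swap]; exact key y x h1
    have h1 := Set.ncard_le_ncard hsub (Set.toFinite _)
    have h2 := h1.trans (Set.ncard_image_le (Set.toFinite _))
    have h3 := Set.ncard_add_ncard_compl ({⟨b, hab.symm⟩} : Set ({a}ᶜ : Set W))
    rw [Set.ncard_singleton] at h3
    change T.edgeSet.ncard + 1 ≤ _
    omega

end Star

variable {V W : Type*} [Fintype V]

/-- The block of a vertex whose descendants have been processed is a starborescence. -/
theorem Reduced.isStar {Adj₀ Adj : V → V → Prop} {s t v p : V} {P : V → Prop}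
    (hR : Reduced Adj₀ Adj s t P) (hac : ∀ v, ¬ TransGen Adj v v) (hvt : v ≠ t) (hv : ¬ P v)
    (hvP : ∀ w, Adj v w → P w) (hp : IsMerge Adj v p) {D : Digraph W} {e : W → V} {a b : W}
    (inj : Function.Injective e) (hea : e a = v) (heb : e b = p)
    (range : ∀ x, (∃ c, e c = x) ↔ x = v ∨ x = p ∨ x ∈ inner Adj v)
    (adj : ∀ c d, D.Adj c d ↔ Adj (e c) (e d)) : IsStar D.Adj a b ∧ a ≠ b := by
  have hI := hR.isBlock hac hvt hv hvP hp
  have hlift : ∀ c d, TransGen D.Adj c d → TransGen Adj (e c) (e d) := fun c d h =>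
    h.lift e fun c d => (adj c d).1
  have hmem : ∀ c, e c = v ∨ e c = p ∨ e c ∈ inner Adj v := fun c => (range _).1 ⟨c, rfl⟩
  have hpv : ∀ z, ReflTransGen Adj p z → z ≠ v := by
    rintro z hz rfl; exact hac _ (hI.reach.trans_left hz)
  have hpI : ∀ z, ReflTransGen Adj p z → z ∉ inner Adj v := fun z hz h =>
    hac z ((hI.reach_p z h).trans_left hz)
  refine ⟨⟨fun x hx => hac _ (hlift x x hx), ?_, ?_, ?_, ?_, ?_⟩, ?_⟩
  · intro x hx
    rw [adj, hea] at hx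
    rcases hmem x with h | h | h
    · exact hac v (.single (h ▸ hx))
    · exact hpv v (.single (h ▸ hx)) rfl
    · exact hac v ((hI.reach_v _ h).tail hx)
  · intro x hx
    rw [adj, heb] at hx
    rcases hmem x with h | h | h
    · exact hpv _ (.single hx) h
    · exact hac _ (.single (h ▸ hx))
    · exact hpI _ (.single hx) h
  · intro x y z hx hy hz
    rw [adj] at hy hz
    refine inj (hR.unique (e x) _ _ ?_ hy hz)
    rcases hmem x with h | h | h
    · exact absurd (inj (h.trans hea.symm)) hx
    · obtain ⟨w, hw⟩ := hR.exists_adj v hvt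
      exact h ▸ hR.closed_reach (hvP w hw) (hp.reach w hw)
    · obtain ⟨⟨w, hw, hwx⟩, -⟩ := mem_inner.1 h
      exact hR.closed_reach (hvP w hw) hwx
  · intro x hx
    have hxp : e x ≠ p := fun h => hx (inj (h.trans heb.symm))
    obtain ⟨y, hy⟩ : ∃ y, Adj (e x) y := by
      rcases hmem x with h | h | h
      · rw [h]; exact hR.exists_adj v hvt
      · exact absurd h hxp
      · obtain ⟨y, hy, -⟩ := TransGen.head'_iff.1 (hI.reach_p _ h)
        exact ⟨y, hy⟩
    have : y ∈ inner Adj v ∨ y = p := by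
      rcases hmem x with h | h | h
      · exact hI.out_v y (h ▸ hy)
      · exact absurd h hxp
      · exact hI.out_mem _ h y hy
    obtain ⟨c, rfl⟩ := (range y).2 (by tauto)
    exact ⟨c, (adj _ _).2 hy⟩
  · intro x hx
    have hxv : e x ≠ v := fun h => hx (inj (h.trans hea.symm))
    have : TransGen Adj v (e x) := by
      rcases hmem x with h | h | h
      · exact absurd h hxv
      · exact h ▸ hI.reach
      · exact hI.reach_v _ h
    obtain ⟨y, hvy, hy⟩ := TransGen.tail'_iff.1 this
    have hyp : y ∈ inner Adj v ∨ y = v := by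
      rcases hI.of_reach hvy with h | h | h
      · exact Or.inr h
      · exact Or.inl h
      · exfalso
        rcases hmem x with h1 | h1 | h1
        · exact hxv h1
        · rw [h1] at hy; exact hac p (TransGen.tail' h hy)
        · exact hpI _ (h.tail hy) h1
    obtain ⟨c, rfl⟩ := (range y).2 (by tauto)
    exact ⟨c, (adj _ _).2 hy⟩
  · rintro rfl
    exact hI.ne (hea.symm.trans heb)

end PeakMem

namespace PeakMem

/-! ### Reasoning about programs -/

/-- The arrays of natural numbers to which a program writes. -/
def Cmd.natWrites : Cmd → List ℕ
  | .skip => []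
  | .setNat a _ _ => [a]
  | .setReal _ _ _ => []
  | .seq c d => c.natWrites ++ d.natWrites
  | .ite _ c d => c.natWrites ++ d.natWrites
  | .while _ c => c.natWrites
  | .call _ _ _ natOut _ => natOut.map Transfer.dst

/-- The arrays of real numbers to which a program writes. -/
def Cmd.realWrites : Cmd → List ℕ
  | .skip => []
  | .setNat _ _ _ => []
  | .setReal a _ _ => [a]
  | .seq c d => c.realWrites ++ d.realWrites
  | .ite _ c d => c.realWrites ++ d.realWrites
  | .while _ c => c.realWrites
  | .call _ _ _ _ realOut => realOut.map Transfer.dst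

/-- Outside the listed arrays the memories agree. -/
structure Frame (N R : List ℕ) (M M' : Mem) : Prop where
  nat : ∀ a, a ∉ N → M'.nat a = M.nat a
  real : ∀ a, a ∉ R → M'.real a = M.real a

theorem Frame.refl (N R : List ℕ) (M : Mem) : Frame N R M M := ⟨fun _ _ => rfl, fun _ _ => rfl⟩

theorem Frame.trans {N R : List ℕ} {M M' M'' : Mem} (h : Frame N R M M') (h' : Frame N R M' M'') :
    Frame N R M M'' :=
  ⟨fun a ha => (h'.nat a ha).trans (h.nat a ha), fun a ha => (h'.real a ha).trans (h.real a ha)⟩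

theorem Frame.mono {N R N' R' : List ℕ} {M M' : Mem} (h : Frame N R M M') (hN : N ⊆ N')
    (hR : R ⊆ R') : Frame N' R' M M' :=
  ⟨fun a ha => h.nat a fun h => ha (hN h), fun a ha => h.real a fun h => ha (hR h)⟩

@[simp] theorem Mem.storeNat_nat (M : Mem) (a i x a' i' : ℕ) :
    (M.storeNat a i x).nat a' i' = if a' = a ∧ i' = i then x else M.nat a' i' := rfl

@[simp] theorem Mem.storeNat_real (M : Mem) (a i x : ℕ) : (M.storeNat a i x).real = M.real := rfl

@[simp] theorem Mem.storeReal_nat (M : Mem) (a i : ℕ) (x : ℝ) :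
    (M.storeReal a i x).nat = M.nat := rfl

@[simp] theorem Mem.storeReal_real (M : Mem) (a i : ℕ) (x : ℝ) (a' i' : ℕ) :
    (M.storeReal a i x).real a' i' = if a' = a ∧ i' = i then x else M.real a' i' := rfl

theorem frame_storeNat (M : Mem) (a i x : ℕ) : Frame [a] [] M (M.storeNat a i x) := by
  refine ⟨fun b hb => funext fun j => ?_, fun _ _ => rfl⟩
  rw [Mem.storeNat_nat, if_neg]
  rintro ⟨rfl, -⟩; simp at hb

theorem frame_storeReal (M : Mem) (a i : ℕ) (x : ℝ) : Frame [] [a] M (M.storeReal a i x) := by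
  refine ⟨fun _ _ => rfl, fun b hb => funext fun j => ?_⟩
  rw [Mem.storeReal_real, if_neg]
  rintro ⟨rfl, -⟩; simp at hb

theorem copyNat_real (env src : Mem) (l : List Transfer) (M : Mem) :
    (copyNat env src l M).real = M.real := by
  induction l generalizing M with
  | nil => rfl
  | cons x l ih => exact ih _

theorem copyReal_nat (env src : Mem) (l : List Transfer) (M : Mem) :
    (copyReal env src l M).nat = M.nat := by
  induction l generalizing M with
  | nil => rfl
  | cons x l ih => exact ih _

theorem copyNat_of_notMem (env src : Mem) (l : List Transfer) (M : Mem) {a : ℕ}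
    (ha : a ∉ l.map Transfer.dst) : (copyNat env src l M).nat a = M.nat a := by
  induction l generalizing M with
  | nil => rfl
  | cons x l ih =>
    rw [List.map_cons, List.mem_cons, not_or] at ha
    refine (ih _ ha.2).trans (funext fun i => ?_)
    simp [ha.1]

theorem copyReal_of_notMem (env src : Mem) (l : List Transfer) (M : Mem) {a : ℕ}
    (ha : a ∉ l.map Transfer.dst) : (copyReal env src l M).real a = M.real a := by
  induction l generalizing M with
  | nil => rfl
  | cons x l ih =>
    rw [List.map_cons, List.mem_cons, not_or] at ha
    refine (ih _ ha.2).trans (funext fun i => ?_)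
    simp [ha.1]

/-- Programs change only the arrays to which they write. -/
theorem Exec.frame {c : Cmd} {M M' : Mem} {k : ℕ} (h : Exec c M k M') :
    Frame c.natWrites c.realWrites M M' := by
  induction h with
  | skip M => exact .refl _ _ _
  | setNat a i e M => exact frame_storeNat _ _ _ _
  | setReal a i e M => exact frame_storeReal _ _ _ _
  | seq c d M₁ M₂ M₃ k l _ _ ihc ihd =>
    exact (ihc.mono (List.subset_append_left _ _) (List.subset_append_left _ _)).trans
      (ihd.mono (List.subset_append_right _ _) (List.subset_append_right _ _))
  | ite_true b c d M M' k _ _ ih =>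
    exact ih.mono (List.subset_append_left _ _) (List.subset_append_left _ _)
  | ite_false b c d M M' k _ _ ih =>
    exact ih.mono (List.subset_append_right _ _) (List.subset_append_right _ _)
  | while_true b c M₁ M₂ M₃ k l _ _ _ ihc ihw => exact ihc.trans ihw
  | while_false b c M _ => exact .refl _ _ _
  | call body natIn realIn natOut realOut M M' k _ _ =>
    refine ⟨fun a ha => ?_, fun a ha => ?_⟩
    · rw [copyReal_nat]; exact copyNat_of_notMem _ _ _ _ ha
    · rw [copyReal_of_notMem _ _ _ _ ha, copyNat_real]

/-- Started in the memory `M`, the program halts within `K` steps in a memory with property `Q`. -/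
def Run (c : Cmd) (M : Mem) (K : ℕ) (Q : Mem → Prop) : Prop :=
  ∃ k M', Exec c M k M' ∧ k ≤ K ∧ Q M'

variable {c d : Cmd} {M : Mem} {K K₁ K₂ : ℕ} {Q Q' : Mem → Prop}

/-- The frame is supplied together with the postcondition, here and in `Run.seq`. Specifications
therefore need to mention only what a program writes; everything else is recovered from its list of
written arrays. -/
theorem Run.mono (h : Run c M K₁ Q) (hK : K₁ ≤ K)
    (hQ : ∀ M', Frame c.natWrites c.realWrites M M' → Q M' → Q' M') : Run c M K Q' := by
  obtain ⟨k, M', h1, h2, h3⟩ := h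
  exact ⟨k, M', h1, h2.trans hK, hQ _ h1.frame h3⟩

theorem Run.seq (hc : Run c M K₁ Q)
    (hd : ∀ M', Frame c.natWrites c.realWrites M M' → Q M' → Run d M' K₂ Q') :
    Run (.seq c d) M (K₁ + K₂) Q' := by
  obtain ⟨k, M', h1, h2, h3⟩ := hc
  obtain ⟨l, M'', h4, h5, h6⟩ := hd M' h1.frame h3
  exact ⟨_, _, .seq _ _ _ _ _ _ _ h1 h4, add_le_add h2 h5, h6⟩

theorem Run.ite {b : BExp} (hc : b.eval M → Run c M K Q) (hd : ¬ b.eval M → Run d M K Q) :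
    Run (.ite b c d) M (1 + b.cost + K) Q := by
  by_cases hb : b.eval M
  · obtain ⟨k, M', h1, h2, h3⟩ := hc hb
    exact ⟨_, _, .ite_true _ _ _ _ _ _ hb h1, by omega, h3⟩
  · obtain ⟨k, M', h1, h2, h3⟩ := hd hb
    exact ⟨_, _, .ite_false _ _ _ _ _ _ hb h1, by omega, h3⟩

/-- Loops with an invariant that is indexed by a bound on the number of remaining iterations. -/
theorem Run.while {b : BExp} (Inv : ℕ → Mem → Prop) (r : ℕ) (h0 : Inv r M)
    (step : ∀ r M', Frame c.natWrites c.realWrites M M' → Inv r M' → b.eval M' →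
      ∃ r' < r, Run c M' K (Inv r')) :
    Run (.while b c) M ((r + 1) * (1 + b.cost + K)) fun M' => ∃ r, Inv r M' ∧ ¬ b.eval M' := by
  have key : ∀ r M', Frame c.natWrites c.realWrites M M' → Inv r M' →
      Run (.while b c) M' ((r + 1) * (1 + b.cost + K)) fun M' => ∃ r, Inv r M' ∧ ¬ b.eval M' := by
    intro r
    induction r using Nat.strong_induction_on with
    | _ r ih =>
      intro M' hF hI
      by_cases hb : b.eval M'
      · obtain ⟨r', hr, k, M'', h1, h2, h3⟩ := step r M' hF hI hb
        obtain ⟨l, M₃, h4, h5, h6⟩ := ih r' hr M'' (hF.trans h1.frame) h3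
        refine ⟨_, _, .while_true _ _ _ _ _ _ _ hb h1 h4, ?_, h6⟩
        have : (r' + 1 + 1) * (1 + b.cost + K) ≤ (r + 1) * (1 + b.cost + K) :=
          Nat.mul_le_mul_right _ (by omega)
        rw [add_mul (r' + 1)] at this
        omega
      · refine ⟨_, _, .while_false _ _ _ hb, ?_, r, hI, hb⟩
        rw [add_mul]; omega
  exact key r M (.refl _ _ _) h0

/-- For `x = 0, …, N - 1`, where `N` is the initial value of cell `j` of the array `a`. -/
def Cmd.for (x a j : ℕ) (c : Cmd) : Cmd :=
  .seq (.setNat x (.const 0) (.const 0))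
    (.while (.natLt (.get x (.const 0)) (.get a (.const j)))
      (.seq c (.setNat x (.const 0) (.add (.get x (.const 0)) (.const 1)))))

/-- The cost may vary with the iteration, as required by loops over edges or vertices in which only
some iterations are expensive. Test and increment cost `12` per round; initialisation and the final
failing test cost `9`. -/
theorem Run.for {x a j : ℕ} (hx : x ∉ c.natWrites) (ha : a ∉ x :: c.natWrites)
    (Inv : ℕ → Mem → Prop) (K : ℕ → ℕ) (h0 : Inv 0 (M.storeNat x 0 0))
    (step : ∀ i < M.nat a j, ∀ M', Frame (x :: c.natWrites) c.realWrites M M' →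
      M'.nat x 0 = i → Inv i M' → Run c M' (K i) fun M'' => Inv (i + 1) (M''.storeNat x 0 (i + 1))) :
    Run (.for x a j c) M ((∑ i ∈ Finset.range (M.nat a j), (K i + 12)) + 9)
      (Inv (M.nat a j)) := by
  have hax : a ≠ x := fun h => ha (by simp [h])
  set N := M.nat a j with hN
  have key : ∀ r i M', i + r = N → Frame (x :: c.natWrites) c.realWrites M M' → M'.nat x 0 = i →
      Inv i M' → Run (.while (.natLt (.get x (.const 0)) (.get a (.const j)))
        (.seq c (.setNat x (.const 0) (.add (.get x (.const 0)) (.const 1))))) M'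
        ((∑ i ∈ Finset.Ico i N, (K i + 12)) + 6) (Inv N) := by
    intro r
    induction r with
    | zero =>
      intro i M' hi hF hxi hI
      have hn : M'.nat a j = N := by rw [hF.nat a ha]
      obtain rfl : i = N := by omega
      refine ⟨_, _, .while_false _ _ _ ?_, ?_, hI⟩
      · simp only [BExp.eval, NExp.eval, hxi, hn]; omega
      · simp [BExp.cost, NExp.cost]
    | succ r ih =>
      intro i M' hi hF hxi hI
      have hn : M'.nat a j = N := by rw [hF.nat a ha]
      obtain ⟨k, M'', h1, h2, h3⟩ := step i (by omega) M' hF hxi hI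
      have hxi' : M''.nat x 0 = i := by rw [h1.frame.nat x hx, hxi]
      have hF' : Frame (x :: c.natWrites) c.realWrites M (M''.storeNat x 0 (i + 1)) :=
        (hF.trans (h1.frame.mono (List.subset_cons_self _ _) fun _ h => h)).trans
          ((frame_storeNat _ _ _ _).mono (by simp) (by simp))
      obtain ⟨l, M₃, h4, h5, h6⟩ := ih (i + 1) (M''.storeNat x 0 (i + 1)) (by omega) hF'
        (by simp) h3
      have h7 := Exec.setNat x (.const 0) (.add (.get x (.const 0)) (.const 1)) M''
      simp only [NExp.eval, hxi'] at h7
      refine ⟨_, _, .while_true _ _ _ _ _ _ _ ?_ (.seq _ _ _ _ _ _ _ h1 h7) h4, ?_, h6⟩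
      · simp only [BExp.eval, NExp.eval, hxi, hn]; omega
      · rw [Finset.sum_eq_sum_Ico_succ_bot (show i < N by omega)]
        simp only [BExp.cost, NExp.cost]
        omega
  obtain ⟨k, M', h1, h2, h3⟩ := key N 0 (M.storeNat x 0 0) (by omega)
    ((frame_storeNat _ _ _ _).mono (by simp) (by simp)) (by simp) h0
  refine ⟨_, _, .seq _ _ _ _ _ _ _ (.setNat x (.const 0) (.const 0) M) h1, ?_, h3⟩
  rw [Finset.range_eq_Ico]
  simp only [NExp.cost]
  omega

/-- Programs without loops and calls. -/
def Cmd.straight : Cmd → Bool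
  | .skip => true
  | .setNat _ _ _ => true
  | .setReal _ _ _ => true
  | .seq c d => c.straight && d.straight
  | .ite _ c d => c.straight && d.straight
  | .while _ _ => false
  | .call _ _ _ _ _ => false

open Classical in
/-- The effect of a program without loops and calls. -/
noncomputable def Cmd.effect : Cmd → Mem → Mem
  | .setNat a i e, M => M.storeNat a (i.eval M) (e.eval M)
  | .setReal a i e, M => M.storeReal a (i.eval M) (e.eval M)
  | .seq c d, M => d.effect (c.effect M)
  | .ite b c d, M => if b.eval M then c.effect M else d.effect M
  | _, M => M

/-- A bound for the number of steps of a program without loops and calls. -/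
def Cmd.bound : Cmd → ℕ
  | .setNat _ i e => 1 + i.cost + e.cost
  | .setReal _ i e => 1 + i.cost + e.cost
  | .seq c d => c.bound + d.bound
  | .ite b c d => 1 + b.cost + (c.bound + d.bound)
  | _ => 1

theorem Cmd.exists_exec (hc : c.straight = true) (M : Mem) :
    ∃ k ≤ c.bound, Exec c M k (c.effect M) := by
  induction c generalizing M with
  | skip => exact ⟨1, le_rfl, .skip M⟩
  | setNat a i e => exact ⟨_, le_rfl, .setNat a i e M⟩
  | setReal a i e => exact ⟨_, le_rfl, .setReal a i e M⟩
  | seq c d ihc ihd =>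
    rw [Cmd.straight, Bool.and_eq_true] at hc
    obtain ⟨k, h1, h2⟩ := ihc hc.1 M
    obtain ⟨l, h3, h4⟩ := ihd hc.2 (c.effect M)
    exact ⟨_, add_le_add h1 h3, .seq _ _ _ _ _ _ _ h2 h4⟩
  | ite b c d ihc ihd =>
    rw [Cmd.straight, Bool.and_eq_true] at hc
    obtain ⟨k, h1, h2⟩ := ihc hc.1 M
    obtain ⟨l, h3, h4⟩ := ihd hc.2 M
    by_cases hb : b.eval M
    · refine ⟨1 + b.cost + k, by rw [Cmd.bound]; omega, ?_⟩
      rw [Cmd.effect, if_pos hb]; exact .ite_true _ _ _ _ _ _ hb h2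
    · refine ⟨1 + b.cost + l, by rw [Cmd.bound]; omega, ?_⟩
      rw [Cmd.effect, if_neg hb]; exact .ite_false _ _ _ _ _ _ hb h4
  | _ => simp [Cmd.straight] at hc

/-- For code without loops and calls, the shape and the step count are settled by computation, and
what remains is a statement about the explicit memory `c.effect M`. -/
theorem Run.straight (hc : c.straight = true) (hK : c.bound ≤ K) (hQ : Q (c.effect M)) :
    Run c M K Q := by
  obtain ⟨k, h1, h2⟩ := Cmd.exists_exec hc M
  exact ⟨k, _, h2, h1.trans hK, hQ⟩

end PeakMem

/-! ### Enumerating the vertices so that out-neighbours come first -/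

namespace PeakMem

infixr:60 " ;; " => Cmd.seq

/-- Cell `0` of an array, used as a scalar. -/
abbrev NExp.var (x : ℕ) : NExp := .get x (.const 0)

variable {n : ℕ} {es : List (Fin n × Fin n)} {M M' : Mem}

/-- The edge list `es` on `n` vertices is stored in the arrays `0`, `1` and `2`. -/
structure EdgeMem (es : List (Fin n × Fin n)) (M : Mem) : Prop where
  size : M.nat 0 0 = n
  length : M.nat 0 1 = es.length
  tail : ∀ i (h : i < es.length), M.nat 1 i = es[i].1
  head : ∀ i (h : i < es.length), M.nat 2 i = es[i].2

theorem EdgeMem.congr (h : EdgeMem es M) (h0 : M'.nat 0 = M.nat 0) (h1 : M'.nat 1 = M.nat 1)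
    (h2 : M'.nat 2 = M.nat 2) : EdgeMem es M' := by
  obtain ⟨a, b, c, d⟩ := h
  exact ⟨by rw [h0, a], by rw [h0, b], fun i hi => by rw [h1, c i hi],
    fun i hi => by rw [h2, d i hi]⟩

theorem EdgeMem.frame (h : EdgeMem es M) {N R : List ℕ} (hF : Frame N R M M') (h0 : 0 ∉ N)
    (h1 : 1 ∉ N) (h2 : 2 ∉ N) : EdgeMem es M' :=
  h.congr (hF.nat _ h0) (hF.nat _ h1) (hF.nat _ h2)

namespace TopoSort

/-- Mark the tail of the edge in `12` if its head has no position. -/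
def markBad : Cmd :=
  .ite (.natEq (.get 6 (.get 2 (.var 12))) (.const 0))
    (.setNat 7 (.get 1 (.var 12)) (.add (.var 11) (.const 1))) .skip

/-- Remember the vertex in `13` if it may be the next one. -/
def pick : Cmd :=
  .ite (.and (.natEq (.get 6 (.var 13)) (.const 0))
      (.not (.natEq (.get 7 (.var 13)) (.add (.var 11) (.const 1)))))
    (.setNat 14 (.const 0) (.var 13)) .skip

/-- Append the vertex in `14`. -/
def append : Cmd :=
  .setNat 5 (.var 11) (.var 14) ;; .setNat 6 (.var 14) (.const 1)

def body : Cmd := .for 12 0 1 markBad ;; .for 13 0 0 pick ;; append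

/-- Enumerate the vertices in the array `5` in such a way that every vertex comes after its
out-neighbours. -/
def prog : Cmd := .for 11 0 0 body

/-- In the list `L`, all vertices come after their out-neighbours. -/
structure Closed (es : List (Fin n × Fin n)) (L : List (Fin n)) : Prop where
  nodup : L.Nodup
  mem_take : ∀ i (h : i < L.length), ∀ w, (L[i], w) ∈ es → w ∈ L.take i

theorem Closed.exists_next {L : List (Fin n)}
    (hac : ∀ v, ¬ Relation.TransGen (fun a b => (a, b) ∈ es) v v) (hn : L.length < n) :
    ∃ v, v ∉ L ∧ ∀ w, (v, w) ∈ es → w ∈ L := by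
  have : Std.Irrefl (Function.swap (Relation.TransGen fun a b => (a, b) ∈ es)) := ⟨hac⟩
  have : IsTrans (Fin n) (Function.swap (Relation.TransGen fun a b => (a, b) ∈ es)) :=
    ⟨fun a b c h1 h2 => Relation.TransGen.trans h2 h1⟩
  have hwf : WellFounded (Function.swap (Relation.TransGen fun a b => (a, b) ∈ es)) :=
    Finite.wellFounded_of_trans_of_irrefl _
  have hne : ∃ v, v ∉ L := by
    by_contra! h
    have h1 : Finset.univ ⊆ L.toFinset := fun x _ => List.mem_toFinset.2 (h x)
    have h2 := (Finset.card_le_card h1).trans (List.toFinset_card_le L)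
    simp at h2; omega
  obtain ⟨v, hv, hmin⟩ := hwf.has_min {v | v ∉ L} hne
  refine ⟨v, hv, fun w hw => ?_⟩
  by_contra hwL
  exact hmin w hwL (.single hw)

theorem Closed.append {L : List (Fin n)} (h : Closed es L) {v : Fin n} (hv : v ∉ L)
    (hw : ∀ w, (v, w) ∈ es → w ∈ L) : Closed es (L ++ [v]) := by
  refine ⟨?_, fun i hi w hiw => ?_⟩
  · rw [List.nodup_append]
    exact ⟨h.nodup, List.nodup_singleton _, fun a ha b hb => by
      rintro rfl; exact hv (by simpa using List.mem_singleton.1 hb ▸ ha)⟩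
  · rw [List.length_append, List.length_singleton] at hi
    rcases Nat.lt_succ_iff_lt_or_eq.1 hi with h1 | rfl
    · rw [List.getElem_append_left h1] at hiw
      rw [List.take_append_of_le_length h1.le]
      exact h.mem_take i h1 w hiw
    · simp only [List.getElem_append_right le_rfl, Nat.sub_self, List.getElem_cons_zero] at hiw
      rw [List.take_left]
      exact hw w hiw

/-- Round `i` uses the stamp `i + 1`. Stamps of earlier rounds are at most `i`, so the array `7`
never has to be cleared. -/
theorem run_markBad {L : List (Fin n)} (hE : EdgeMem es M) (i : ℕ) (hi : M.nat 11 0 = i)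
    (hpos : ∀ u : Fin n, M.nat 6 u = if u ∈ L then 1 else 0) (hbad : ∀ u : Fin n, M.nat 7 u ≤ i) :
    Run (.for 12 0 1 markBad) M (35 * es.length + 9) fun M' =>
      ∀ u : Fin n, M'.nat 7 u ≤ i + 1 ∧ (M'.nat 7 u = i + 1 ↔ ∃ w, (u, w) ∈ es ∧ w ∉ L) := by
  refine (Run.for (by decide) (by decide) (fun e M' => ∀ u : Fin n, M'.nat 7 u ≤ i + 1 ∧
    (M'.nat 7 u = i + 1 ↔ ∃ w, (u, w) ∈ es.take e ∧ w ∉ L)) (fun _ => 23) ?_ ?_).mono ?_ ?_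
  · intro u
    have := hbad u
    simp; omega
  · intro e he M₁ hF hx hI
    rw [hE.length] at he
    have hE₁ := hE.frame hF (by decide) (by decide) (by decide)
    refine Run.straight (by decide) (by decide) ?_
    have h6 : ∀ u : Fin n, M₁.nat 6 u = if u ∈ L then 1 else 0 := fun u => by
      rw [hF.nat 6 (by decide), hpos]
    have h11 : M₁.nat 11 0 = i := by rw [hF.nat 11 (by decide), hi]
    intro u
    obtain ⟨h1, h2⟩ := hI u
    simp only [List.take_succ_eq_append_getElem he, List.mem_append, List.mem_singleton]
    simp only [markBad, Cmd.effect, BExp.eval, NExp.eval, hx, hE₁.tail e he, hE₁.head e he, h6, h11]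
    by_cases hL : es[e].2 ∈ L
    · simp only [hL, if_true, one_ne_zero, if_false, Mem.storeNat_nat]
      refine ⟨by simpa using h1, ?_⟩
      simp only [Nat.reduceEqDiff, false_and, if_false, h2]
      constructor
      · rintro ⟨w, hw, hwL⟩; exact ⟨w, Or.inl hw, hwL⟩
      · rintro ⟨w, hw | hw, hwL⟩
        · exact ⟨w, hw, hwL⟩
        · rw [← hw] at hL; exact absurd hL hwL
    · simp only [hL, if_true, if_false, Mem.storeNat_nat, Nat.reduceEqDiff, false_and, true_and]
      by_cases hu : u = es[e].1
      · simp only [hu, if_true, le_refl, true_and, true_iff]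
        exact ⟨es[e].2, Or.inr rfl, hL⟩
      · have hu' : (u : ℕ) ≠ (es[e].1 : ℕ) := fun h => hu (Fin.ext h)
        simp only [hu', if_false, h1, h2, true_and]
        constructor
        · rintro ⟨w, hw, hwL⟩; exact ⟨w, Or.inl hw, hwL⟩
        · rintro ⟨w, hw | hw, hwL⟩
          · exact ⟨w, hw, hwL⟩
          · exact absurd (congrArg Prod.fst hw) hu
  · rw [hE.length]; simp; omega
  · intro M' _ h
    rw [hE.length, List.take_length] at h
    exact h

theorem run_pick {P : Fin n → Prop} (hE : EdgeMem es M) (i : ℕ) (hi : M.nat 11 0 = i)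
    (hP : ∀ u : Fin n, P u ↔ M.nat 6 u = 0 ∧ M.nat 7 u ≠ i + 1) (hex : ∃ u, P u) :
    Run (.for 13 0 0 pick) M (40 * n + 9) fun M' => ∃ u, P u ∧ M'.nat 14 0 = u := by
  refine (Run.for (by decide) (by decide) (fun e M' => (∃ u : Fin n, u < e ∧ P u) →
    ∃ u, P u ∧ M'.nat 14 0 = u) (fun _ => 28) ?_ ?_).mono ?_ ?_
  · rintro ⟨u, hu, -⟩; exact absurd hu (Nat.not_lt_zero _)
  · intro e he M₁ hF hx hI
    rw [hE.size] at he
    refine Run.straight (by decide) (by decide) ?_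
    simp only [pick, Cmd.effect, BExp.eval, NExp.eval, hx, hF.nat 6 (by decide),
      hF.nat 7 (by decide), hF.nat 11 (by decide), hi]
    have hPe := hP ⟨e, he⟩
    simp only at hPe
    by_cases h : P ⟨e, he⟩
    · intro _
      rw [if_pos (hPe.1 h)]
      exact ⟨⟨e, he⟩, h, by simp⟩
    · rw [if_neg fun h' => h (hPe.2 h')]
      rintro ⟨u, hu, hPu⟩
      simp only [Mem.storeNat_nat, Nat.reduceEqDiff, false_and, if_false]
      refine hI ⟨u, ?_, hPu⟩
      rcases Nat.lt_succ_iff_lt_or_eq.1 hu with h1 | h1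
      · exact h1
      · exact absurd (show P ⟨e, he⟩ by convert hPu; exact h1.symm) h
  · rw [hE.size]; simp; omega
  · intro M' _ h
    obtain ⟨u, hu⟩ := hex
    exact h ⟨u, by rw [hE.size]; exact u.2, hu⟩

/-- Each of the `n` rounds scans all edges and all vertices. This is quadratic, which is affordable
because the number of edges is linear. -/
theorem run_prog (hE : EdgeMem es M) (hac : ∀ v, ¬ Relation.TransGen (fun a b => (a, b) ∈ es) v v)
    (h6 : ∀ u, M.nat 6 u = 0) (h7 : ∀ u, M.nat 7 u = 0) :
    Run prog M (35 * n * es.length + 40 * n * n + 60 * n + 9) fun M' =>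
      ∃ L : List (Fin n), L.length = n ∧ Closed es L ∧
        ∀ i (h : i < L.length), M'.nat 5 i = L[i] := by
  refine (Run.for (by decide) (by decide) (fun i M' => ∃ L : List (Fin n), L.length = i ∧
    Closed es L ∧ (∀ i (h : i < L.length), M'.nat 5 i = L[i]) ∧
    (∀ u : Fin n, M'.nat 6 u = if u ∈ L then 1 else 0) ∧ ∀ u : Fin n, M'.nat 7 u ≤ i)
    (fun _ => (35 * es.length + 9) + ((40 * n + 9) + 20)) ?_ ?_).mono ?_ ?_
  · exact ⟨[], rfl, ⟨List.nodup_nil, by simp⟩, by simp, by simp [h6], by simp [h7]⟩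
  · rintro i hi M₁ hF hx ⟨L, hLi, hL, h5, h6, h7⟩
    rw [hE.size] at hi
    have hE₁ := hE.frame hF (by decide) (by decide) (by decide)
    refine Run.seq (run_markBad hE₁ i hx h6 h7) fun M₂ hF₂ hM₂ => ?_
    have hE₂ := hE₁.frame hF₂ (by decide) (by decide) (by decide)
    refine Run.seq (run_pick (P := fun v => v ∉ L ∧ ∀ w, (v, w) ∈ es → w ∈ L) hE₂ i
      (by rw [hF₂.nat 11 (by decide), hx]) (fun u => ?_)
      (Closed.exists_next hac (by omega))) ?_
    · rw [hF₂.nat 6 (by decide), h6, ne_eq, (hM₂ u).2]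
      simp
    · rintro M₃ hF₃ ⟨v, ⟨hvL, hv⟩, hM₃⟩
      refine Run.straight (by decide) (by decide) ?_
      refine ⟨L ++ [v], by simp [hLi], hL.append hvL hv, ?_, ?_, ?_⟩
      · intro j hj
        simp only [List.length_append, List.length_singleton] at hj
        simp only [append, Cmd.effect, NExp.eval, hF₃.nat 11 (by decide), hF₂.nat 11 (by decide),
          hx, Mem.storeNat_nat, hM₃, Nat.reduceEqDiff, false_and, true_and, if_false,
          hF₃.nat 5 (by decide), hF₂.nat 5 (by decide)]
        split_ifs with h
        · subst h; subst hLi; simp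
        · rw [List.getElem_append_left (by omega), h5]
      · intro u
        simp only [append, Cmd.effect, NExp.eval, Mem.storeNat_nat, hM₃, Nat.reduceEqDiff,
          false_and, true_and, if_false, hF₃.nat 6 (by decide), hF₂.nat 6 (by decide), h6]
        by_cases hu : u = v
        · simp [hu]
        · have : (u : ℕ) ≠ v := fun h => hu (Fin.ext h)
          simp [hu, this]
      · intro u
        simpa [append, Cmd.effect, NExp.eval, hF₃.nat 7 (by decide)] using (hM₂ u).1
  · rw [hE.size]; simp; ring_nf; omega
  · rintro M' _ ⟨L, h1, h2, h3, -⟩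
    exact ⟨L, by rw [h1, hE.size], h2, h3⟩

end TopoSort

end PeakMem

/-! ### Counting paths and finding the merge vertex -/

namespace PeakMem

open Relation

section Count

variable {n : ℕ}

open Classical in
/-- The number of edges in a list that leave `v` and whose heads satisfy `q`. -/
noncomputable def countOut (es : List (Fin n × Fin n)) (v : Fin n) (q : Fin n → Prop) : ℕ :=
  es.countP fun x => decide (x.1 = v ∧ q x.2)

theorem countOut_nil (v : Fin n) (q : Fin n → Prop) : countOut [] v q = 0 := rfl

open Classical in
theorem countOut_append (es es' : List (Fin n × Fin n)) (v : Fin n) (q : Fin n → Prop) :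
    countOut (es ++ es') v q = countOut es v q + countOut es' v q := List.countP_append

open Classical in
theorem countOut_cons (x : Fin n × Fin n) (es : List (Fin n × Fin n)) (v : Fin n)
    (q : Fin n → Prop) :
    countOut (x :: es) v q = countOut es v q + if x.1 = v ∧ q x.2 then 1 else 0 := by
  simp [countOut, List.countP_cons]

theorem countOut_pos {es : List (Fin n × Fin n)} {v : Fin n} {q : Fin n → Prop} :
    0 < countOut es v q ↔ ∃ w, (v, w) ∈ es ∧ q w := by
  classical
  simp only [countOut, List.countP_pos_iff, decide_eq_true_eq]
  constructor
  · rintro ⟨⟨a, w⟩, h, rfl, hq⟩; exact ⟨w, h, hq⟩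
  · rintro ⟨w, h, hq⟩; exact ⟨(v, w), h, rfl, hq⟩

/-- Together with `countOut_pos` this turns membership in `inner` into a test on numbers: `x` is
inner iff the count of out-neighbours that reach it is positive and less than the out-degree. -/
theorem countOut_lt {es : List (Fin n × Fin n)} {v : Fin n} {q : Fin n → Prop} :
    countOut es v q < countOut es v (fun _ => True) ↔ ∃ w, (v, w) ∈ es ∧ ¬ q w := by
  classical
  have h : countOut es v (fun _ => True) = countOut es v q + countOut es v fun w => ¬ q w := by
    induction es with
    | nil => rfl
    | cons x es ih =>
      simp only [countOut_cons, ih]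
      by_cases h1 : x.1 = v <;> by_cases h2 : q x.2 <;> simp [h1, h2] <;> omega
  rw [← countOut_pos]
  omega

theorem countOut_eq_card {es : List (Fin n × Fin n)} (hes : es.Nodup) (v : Fin n)
    (q : Fin n → Prop) : countOut es v q = {w | (v, w) ∈ es ∧ q w}.ncard := by
  classical
  rw [countOut, List.countP_eq_length_filter]
  have hn : ((es.filter fun x => decide (x.1 = v ∧ q x.2)).map Prod.snd).Nodup := by
    refine (hes.filter _).map_on ?_
    rintro ⟨a, b⟩ h ⟨a', b'⟩ h' rfl
    simp only [List.mem_filter, decide_eq_true_eq] at h h'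
    rw [h.2.1, h'.2.1]
  rw [← List.length_map Prod.snd, ← List.toFinset_card_of_nodup hn, ← Set.ncard_coe_finset]
  congr 1
  ext w
  simp only [List.coe_toFinset, List.mem_map, List.mem_filter, decide_eq_true_eq, Prod.exists,
    exists_eq_right, Set.mem_ofPred_eq]
  constructor
  · rintro ⟨a, h, rfl, hq⟩; exact ⟨h, hq⟩
  · rintro ⟨h, hq⟩; exact ⟨v, h, rfl, hq⟩

theorem sum_countOut (es : List (Fin n × Fin n)) :
    ∑ v, countOut es v (fun _ => True) = es.length := by
  induction es with
  | nil => simp [countOut_nil]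
  | cons x es ih => simp [countOut_cons, Finset.sum_add_distrib, ih]

-- Cost of a scan over all edges in which only the edges leaving `v` trigger a walk. Summed over all
-- `v`, the walks are charged once per edge (`sum_countOut`).
open Classical in
theorem sum_range_countOut (es : List (Fin n × Fin n)) (v : Fin n) (c d : ℕ) :
    ∑ i ∈ Finset.range es.length, (c + if (es.map Prod.fst)[i]? = some v then d else 0) =
      c * es.length + d * countOut es v (fun _ => True) := by
  induction es with
  | nil => simp [countOut_nil]
  | cons x es ih =>
    rw [List.length_cons, Finset.sum_range_succ']
    simp only [List.map_cons, List.getElem?_cons_succ, List.getElem?_cons_zero, Option.some.injEq,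
      countOut_cons, ih]
    split_ifs <;> simp_all <;> ring

end Count

variable {n : ℕ} {es : List (Fin n × Fin n)} {M M' : Mem} {Adj₀ Adj : Fin n → Fin n → Prop}
  {s t v p : Fin n} {P : Fin n → Prop}

/-- The array `4` holds the out-neighbours of the vertices in `P`, plus one. -/
structure NextMem (Adj : Fin n → Fin n → Prop) (t : Fin n) (P : Fin n → Prop) (M : Mem) :
    Prop where
  next : ∀ u w, P u → Adj u w → M.nat 4 u = w + 1
  sink : M.nat 4 t = 0

theorem NextMem.congr (h : NextMem Adj t P M) (h4 : M'.nat 4 = M.nat 4) : NextMem Adj t P M' :=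
  ⟨fun u w hu hw => by rw [h4, h.next u w hu hw], by rw [h4, h.sink]⟩

theorem NextMem.frame (h : NextMem Adj t P M) {N R : List ℕ} (hF : Frame N R M M') (h4 : 4 ∉ N) :
    NextMem Adj t P M' := h.congr (hF.nat _ h4)

namespace Step

/-- Count the vertices on the path that starts at the vertex in `32`. -/
def walk : Cmd :=
  .while (.natLt (.const 0) (.var 32))
    (.setNat 24 (.sub (.var 32) (.const 1))
        (.add (.get 24 (.sub (.var 32) (.const 1))) (.const 1)) ;;
      .setNat 32 (.const 0) (.get 4 (.sub (.var 32) (.const 1))))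

/-- Array `25` marks the out-neighbours, cell `30` is the out-degree so far and cell `31` the last
out-neighbour seen. Cell `32` holds the current vertex of the walk plus one, so that `0` means that
the walk has left the sink. -/
def visit : Cmd :=
  .setNat 25 (.get 2 (.var 12)) (.const 1) ;;
  .setNat 30 (.const 0) (.add (.var 30) (.const 1)) ;;
  .setNat 31 (.const 0) (.get 2 (.var 12)) ;;
  .setNat 32 (.const 0) (.add (.get 2 (.var 12)) (.const 1))

/-- Treat the edge in `12`, if it leaves the vertex in `10`. -/
def scanEdge : Cmd := .ite (.natEq (.get 1 (.var 12)) (.var 10)) (visit ;; walk) .skip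

/-- Count on how many of the paths that start at the out-neighbours every vertex lies. -/
def scan : Cmd := .for 12 0 1 scanEdge

/-- Find the first vertex that lies on all the paths. -/
def findMerge : Cmd :=
  .setNat 33 (.const 0) (.var 31) ;;
  .while (.natLt (.get 24 (.var 33)) (.var 30))
    (.setNat 33 (.const 0) (.sub (.get 4 (.var 33)) (.const 1)))

-- The number of vertices still reachable is the termination measure for walks along unique
-- out-edges.
open Classical in
theorem card_reach_lt (hac : ∀ v, ¬ TransGen Adj v v) {x z : Fin n} (hxz : Adj x z) :
    (Finset.univ.filter fun u => ReflTransGen Adj z u).card <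
      (Finset.univ.filter fun u => ReflTransGen Adj x u).card := by
  refine Finset.card_lt_card (Finset.ssubset_iff_subset_ne.2 ⟨fun u hu => ?_, fun h => ?_⟩)
  · simp only [Finset.mem_filter, Finset.mem_univ, true_and] at hu ⊢
    exact .head hxz hu
  · have : x ∈ Finset.univ.filter fun u => ReflTransGen Adj z u := by rw [h]; simp [ReflTransGen.refl]
    simp only [Finset.mem_filter, Finset.mem_univ, true_and] at this
    exact hac x (TransGen.head' hxz this)

theorem reach_iff (hR : Reduced Adj₀ Adj s t P) {x z u : Fin n} (hx : P x) (hxz : Adj x z) :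
    ReflTransGen Adj x u ↔ u = x ∨ ReflTransGen Adj z u := by
  constructor
  · intro h
    rcases h.cases_head with rfl | ⟨z', hz', h⟩
    · exact Or.inl rfl
    · rw [hR.unique x z z' hx hxz hz']; exact Or.inr h
  · rintro (rfl | h)
    exacts [.refl, .head hxz h]

-- From a processed vertex the walk meets exactly the vertices reachable from `w`, each once: those
-- already counted are reachable from `w` but not from the current `x`.
open Classical in
theorem run_walk (hR : Reduced Adj₀ Adj s t P) (hac : ∀ v, ¬ TransGen Adj v v)
    (hN : NextMem Adj t P M) {w : Fin n} (hw : P w) (h32 : M.nat 32 0 = w + 1) :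
    Run walk M (24 * (n + 1)) fun M' => ∀ u : Fin n,
      M'.nat 24 u = M.nat 24 u + if ReflTransGen Adj w u then 1 else 0 := by
  refine (Run.while (K := 19) (fun r M' =>
    (∃ x : Fin n, M'.nat 32 0 = x + 1 ∧ ReflTransGen Adj w x ∧
      r = (Finset.univ.filter fun u => ReflTransGen Adj x u).card ∧ ∀ u : Fin n,
      M'.nat 24 u = M.nat 24 u + if ReflTransGen Adj w u ∧ ¬ ReflTransGen Adj x u then 1 else 0) ∨
    (M'.nat 32 0 = 0 ∧ r = 0 ∧ ∀ u : Fin n,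
      M'.nat 24 u = M.nat 24 u + if ReflTransGen Adj w u then 1 else 0))
    (Finset.univ.filter fun u => ReflTransGen Adj w u).card ?_ ?_).mono ?_ ?_
  · exact Or.inl ⟨w, h32, .refl, rfl, fun u => by simp⟩
  · rintro r M₁ hF (⟨x, hx, hwx, rfl, h24⟩ | ⟨h0, -⟩) hb
    · have hPx := hR.closed_reach hw hwx
      have hN₁ := hN.frame hF (by decide)
      have hcnt : ∀ u : Fin n, (if (u : ℕ) = x then M₁.nat 24 x + 1 else M₁.nat 24 u) =
          M.nat 24 u + if ReflTransGen Adj w u ∧ (ReflTransGen Adj x u → u = x) then 1 else 0 := by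
        intro u
        by_cases hu : u = x
        · subst hu; simp [h24, hwx, ReflTransGen.refl]
        · have : (u : ℕ) ≠ x := fun h => hu (Fin.ext h)
          simp [this, h24, hu]
      by_cases hxt : x = t
      · refine ⟨0, Finset.card_pos.2 ⟨x, by simp [ReflTransGen.refl]⟩,
          Run.straight (by decide) (by decide) (Or.inr ⟨?_, rfl, fun u => ?_⟩)⟩
        · simp [Cmd.effect, NExp.eval, hx, hxt, hN₁.sink]
        · simp only [Cmd.effect, NExp.eval, hx, Mem.storeNat_nat, Nat.reduceEqDiff, false_and,
            true_and, if_false, Nat.add_sub_cancel, hcnt u]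
          have : ReflTransGen Adj x u → u = x := fun h => by
            rw [hxt] at h ⊢; exact (ReflTransGen.eq_of_forall_not_left h hR.not_adj_sink).symm
          congr 2
          simp only [eq_iff_iff]
          tauto
      · obtain ⟨z, hxz⟩ := hR.exists_adj x hxt
        refine ⟨_, card_reach_lt hac hxz, Run.straight (by decide) (by decide)
          (Or.inl ⟨z, ?_, hwx.tail hxz, rfl, fun u => ?_⟩)⟩
        · simp [Cmd.effect, NExp.eval, hx, hN₁.next x z hPx hxz]
        · simp only [Cmd.effect, NExp.eval, hx, Mem.storeNat_nat, Nat.reduceEqDiff, false_and,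
            true_and, if_false, Nat.add_sub_cancel, hcnt u]
          rw [reach_iff hR hPx hxz (u := u)]
          have : ReflTransGen Adj z u → u ≠ x := by
            rintro h rfl; exact hac u (TransGen.head' hxz h)
          congr 2
          simp only [eq_iff_iff]
          tauto
    · simp [BExp.eval, NExp.eval, h0] at hb
  · have := Finset.card_le_univ (Finset.univ.filter fun u : Fin n => ReflTransGen Adj w u)
    rw [Fintype.card_fin] at this
    simp only [BExp.cost, NExp.cost]
    omega
  · rintro M₁ - ⟨r, ⟨x, hx, -⟩ | ⟨-, -, h⟩, hb⟩
    · simp [BExp.eval, NExp.eval, hx] at hb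
    · exact h

/-- The result of scanning the edges in `es'`. -/
structure Scanned (Adj : Fin n → Fin n → Prop) (v : Fin n) (es' : List (Fin n × Fin n))
    (M : Mem) : Prop where
  deg : M.nat 30 0 = countOut es' v (fun _ => True)
  cnt : ∀ u : Fin n, M.nat 24 u = countOut es' v (fun w => ReflTransGen Adj w u)
  out : open Classical in ∀ u : Fin n, M.nat 25 u = if (v, u) ∈ es' then 1 else 0
  last : (∃ w, (v, w) ∈ es') → ∃ w, (v, w) ∈ es' ∧ M.nat 31 0 = w

-- Each edge that leaves `v` starts one walk of cost `24 * (n + 1)`; all others cost a constant. The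
-- out-neighbours being processed is what makes the walk count reachability correctly.
open Classical in
theorem run_scan (hR : Reduced Adj₀ Adj s t P) (hac : ∀ v, ¬ TransGen Adj v v)
    (hN : NextMem Adj t P M) (hE : EdgeMem es M) (hv : M.nat 10 0 = v)
    (hvP : ∀ w, (v, w) ∈ es → P w) (h24 : M.nat 24 = fun _ => 0) (h25 : M.nat 25 = fun _ => 0)
    (h30 : M.nat 30 0 = 0) :
    Run scan M (60 * es.length + 24 * (n + 1) * countOut es v (fun _ => True) + 9)
      (Scanned Adj v es) := by
  refine (Run.for (by decide) (by decide) (fun e => Scanned Adj v (es.take e))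
    (fun e => 41 + if (es.map Prod.fst)[e]? = some v then 24 * (n + 1) else 0) ?_ ?_).mono ?_ ?_
  · exact ⟨by simp [h30, countOut_nil], by simp [h24, countOut_nil], by simp [h25], by simp⟩
  · intro e he M₁ hF hx hI
    rw [hE.length] at he
    have hE₁ := hE.frame hF (by decide) (by decide) (by decide)
    have hN₁ := hN.frame hF (by decide)
    have h10 : M₁.nat 10 0 = v := by rw [hF.nat 10 (by decide), hv]
    rw [List.take_succ_eq_append_getElem he]
    have hfst : (es.map Prod.fst)[e]? = some es[e].1 := by simp [he]
    simp only [hfst, Option.some.injEq]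
    refine (Run.ite (K := 34 + if es[e].1 = v then 24 * (n + 1) else 0) ?_ ?_).mono
      (by simp only [BExp.cost, NExp.cost]; omega) fun _ _ h => h
    · intro hb
      simp only [BExp.eval, NExp.eval, hx, hE₁.tail e he, h10] at hb
      have hb : es[e].1 = v := Fin.ext hb
      rw [if_pos hb]
      have hmem : (v, es[e].2) ∈ es := by rw [← hb]; exact List.getElem_mem he
      have hw := hvP _ hmem
      refine Run.seq (K₁ := 34) (Q := fun M₂ => M₂ = visit.effect M₁)
        (Run.straight (by decide) (by decide) rfl) fun M₂ hF₂ hM₂ => ?_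
      have h32 : M₂.nat 32 0 = es[e].2 + 1 := by
        rw [hM₂]; simp [visit, Cmd.effect, NExp.eval, hx, hE₁.head e he]
      refine (run_walk hR hac (hN₁.frame hF₂ (by decide)) hw h32).mono le_rfl ?_
      intro M₃ hF₃ h3
      have hx2 : es[e] = (v, es[e].2) := by rw [← hb]
      constructor
      · simp [hF₃.nat 30 (by decide), hM₂, visit, Cmd.effect, NExp.eval, hI.deg, countOut_append,
          countOut_cons, countOut_nil, hb, -List.take_append_getElem]
      · intro u
        simp only [Mem.storeNat_nat, Nat.reduceEqDiff, false_and, if_false, h3 u,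
          hF₂.nat 24 (by decide), hI.cnt, countOut_append, countOut_cons, countOut_nil, hb,
          true_and, zero_add]
      · intro u
        simp only [Mem.storeNat_nat, Nat.reduceEqDiff, false_and, if_false,
          hF₃.nat 25 (by decide), hM₂, visit, Cmd.effect, NExp.eval, hx, hE₁.head e he, true_and,
          hI.out, List.mem_append, List.mem_singleton]
        by_cases hu : u = es[e].2
        · subst hu; simp only [if_true]; rw [if_pos (Or.inr hx2.symm)]
        · rw [if_neg fun h => hu (Fin.ext h)]
          have : ¬ (v, u) = es[e] := fun h => hu (congrArg Prod.snd h)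
          simp only [this, or_false]
      · intro _
        refine ⟨es[e].2, List.mem_append_right _ (by rw [← hx2]; simp), ?_⟩
        simp [hF₃.nat 31 (by decide), hM₂, visit, Cmd.effect, NExp.eval, hx, hE₁.head e he]
    · intro hb
      simp only [BExp.eval, NExp.eval, hx, hE₁.tail e he, h10] at hb
      have hb : es[e].1 ≠ v := fun h => hb (congrArg Fin.val h)
      have hm : ∀ u, (v, u) ∈ es.take e ++ [es[e]] ↔ (v, u) ∈ es.take e := by
        intro u
        simp only [List.mem_append, List.mem_singleton, or_iff_left_iff_imp]
        intro h; exact absurd (congrArg Prod.fst h).symm hb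
      refine Run.straight (by decide) ((show Cmd.skip.bound ≤ 34 by decide).trans
        (Nat.le_add_right _ _)) ?_
      constructor
      · simp [Cmd.effect, hI.deg, countOut_append, countOut_cons, countOut_nil, hb,
          -List.take_append_getElem]
      · simp [Cmd.effect, hI.cnt, countOut_append, countOut_cons, countOut_nil, hb,
          -List.take_append_getElem]
      · intro u
        simp only [hm, Cmd.effect, Mem.storeNat_nat, Nat.reduceEqDiff, false_and, if_false, hI.out]
      · simp only [hm]; simpa [Cmd.effect] using hI.last
  · rw [hE.length]
    have := sum_range_countOut es v 53 (24 * (n + 1))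
    rw [Finset.sum_congr rfl fun i _ => show _ = 53 + if (es.map Prod.fst)[i]? = some v then
      24 * (n + 1) else 0 by ring, this]
    omega
  · intro M' _ h
    rwa [hE.length, List.take_length] at h

/-- A vertex whose count equals the out-degree lies behind all out-neighbours, that is, behind `p`.
On the unique path from any one out-neighbour, the first such vertex is `p` itself. -/
theorem run_findMerge (hR : Reduced Adj₀ Adj s t P) (hac : ∀ v, ¬ TransGen Adj v v)
    (hN : NextMem Adj t P M) (hadj : ∀ w, (v, w) ∈ es ↔ Adj v w)
    (hvP : ∀ w, Adj v w → P w) (hp : IsMerge Adj v p) (hS : Scanned Adj v es M)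
    (hex : ∃ w, Adj v w) :
    Run findMerge M (20 * (n + 1)) fun M' => M'.nat 33 0 = p := by
  classical
  have hcnt : ∀ x : Fin n, M.nat 24 x < M.nat 30 0 ↔ ¬ ReflTransGen Adj p x := by
    intro x
    rw [hS.cnt, hS.deg, countOut_lt]
    constructor
    · rintro ⟨w, hw, hwx⟩ h
      exact hwx ((hp.reach w ((hadj w).1 hw)).trans h)
    · intro h
      by_contra! h'
      exact h (hp.first x fun w hw => h' w ((hadj w).2 hw))
  obtain ⟨w, hw, h31⟩ := hS.last (by simpa only [hadj] using hex)
  rw [hadj] at hw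
  have hPw := hvP w hw
  refine (Run.seq (K₁ := 4) (Q := fun M' => M'.nat 33 0 = w) (Run.straight (by decide) (by decide)
    (by simp [Cmd.effect, NExp.eval, h31])) fun M₁ hF₁ h33 => ?_).mono
    (K₁ := 4 + (n + 1) * 15) (by omega) fun _ _ h => h
  refine (Run.while (K := 8) (fun r M' => ∃ x : Fin n, M'.nat 33 0 = x ∧ ReflTransGen Adj w x ∧
    ReflTransGen Adj x p ∧ r = (Finset.univ.filter fun u => ReflTransGen Adj x u).card)
    (Finset.univ.filter fun u => ReflTransGen Adj w u).card
    ⟨w, h33, .refl, hp.reach w hw, rfl⟩ ?_).mono ?_ ?_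
  · rintro r M₂ hF₂ ⟨x, hx, hwx, hxp, rfl⟩ hb
    have hb : M.nat 24 x < M.nat 30 0 := by
      simpa only [BExp.eval, NExp.eval, hx, hF₂.nat 24 (by decide), hF₂.nat 30 (by decide),
        hF₁.nat 24 (by decide), hF₁.nat 30 (by decide)] using hb
    rcases hxp.cases_head with rfl | ⟨z, hxz, hzp⟩
    · exact absurd .refl ((hcnt x).1 hb)
    · refine ⟨_, card_reach_lt hac hxz, Run.straight (by decide) (by decide)
        ⟨z, ?_, hwx.tail hxz, hzp, rfl⟩⟩
      simp [Cmd.effect, NExp.eval, hx, ((hN.frame hF₁ (by decide)).frame hF₂ (by decide)).next x z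
        (hR.closed_reach hPw hwx) hxz]
  · have := Finset.card_le_univ (Finset.univ.filter fun u : Fin n => ReflTransGen Adj w u)
    rw [Fintype.card_fin] at this
    simp only [BExp.cost, NExp.cost]
    omega
  · rintro M₂ hF₂ ⟨r, ⟨x, hx, hwx, hxp, -⟩, hb⟩
    have hb' : ¬ M.nat 24 x < M.nat 30 0 := by
      simpa only [BExp.eval, NExp.eval, hx, hF₂.nat 24 (by decide), hF₂.nat 30 (by decide),
        hF₁.nat 24 (by decide), hF₁.nat 30 (by decide)] using hb
    rw [hcnt, not_not] at hb'
    rw [hx, ReflTransGen.antisymm hac hxp hb']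

end Step

end PeakMem

/-! ### Writing down the vertices, edges and weights of the block -/

namespace PeakMem

open Relation

variable {n : ℕ} {es : List (Fin n × Fin n)} {M M' : Mem} {Adj : Fin n → Fin n → Prop}
  {v p : Fin n}

theorem nodup_append_singleton {α : Type*} {L : List α} {x : α} (h : L.Nodup) (hx : x ∉ L) :
    (L ++ [x]).Nodup := by
  rw [List.nodup_append]
  refine ⟨h, List.nodup_singleton _, fun a ha b hb => ?_⟩
  rw [List.mem_singleton.1 hb]
  rintro rfl; exact hx ha

namespace Step

/-- The list `q` is stored in the array `26`, its length in `20` and the positions of its members in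
`27`. -/
structure Enumerated (q : List (Fin n)) (M : Mem) : Prop where
  length : M.nat 20 0 = q.length
  get : ∀ i (h : i < q.length), M.nat 26 i = q[i]
  pos : ∀ i (h : i < q.length), M.nat 27 q[i] = i

theorem Enumerated.frame {q : List (Fin n)} (h : Enumerated q M) {N R : List ℕ}
    (hF : Frame N R M M') (h20 : 20 ∉ N) (h26 : 26 ∉ N) (h27 : 27 ∉ N) : Enumerated q M' :=
  ⟨by rw [hF.nat _ h20, h.length], fun i hi => by rw [hF.nat _ h26, h.get i hi],
    fun i hi => by rw [hF.nat _ h27, h.pos i hi]⟩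

def pushVertex : Cmd :=
  .setNat 27 (.var 13) (.var 20) ;; .setNat 26 (.var 20) (.var 13) ;;
  .setNat 20 (.const 0) (.add (.var 20) (.const 1))

theorem Enumerated.push {q : List (Fin n)} (h : Enumerated q M) {x : Fin n} (hx : x ∉ q)
    (h13 : M.nat 13 0 = x) : Enumerated (q ++ [x]) (pushVertex.effect M) := by
  constructor
  · simp [pushVertex, Cmd.effect, NExp.eval, h.length]
  · intro i hi
    rw [List.length_append, List.length_singleton] at hi
    simp only [pushVertex, Cmd.effect, NExp.eval, h13, h.length, Mem.storeNat_nat,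
      Nat.reduceEqDiff, false_and, true_and, if_false]
    split_ifs with h1
    · subst h1; simp
    · have h2 : i < q.length := by omega
      rw [List.getElem_append_left h2, h.get i h2]
  · intro i hi
    rw [List.length_append, List.length_singleton] at hi
    simp only [pushVertex, Cmd.effect, NExp.eval, h13, h.length, Mem.storeNat_nat,
      Nat.reduceEqDiff, false_and, true_and, if_false]
    by_cases h2 : i < q.length
    · rw [List.getElem_append_left h2, if_neg, h.pos i h2]
      intro h3
      exact hx (Fin.ext h3 ▸ List.getElem_mem h2)
    · obtain rfl : i = q.length := by omega
      simp

/-- Enumerate the vertices of the block. -/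
def enumerate : Cmd :=
  (.setNat 26 (.const 0) (.var 10) ;; .setNat 26 (.const 1) (.var 33) ;;
    .setNat 27 (.var 33) (.const 1) ;; .setNat 20 (.const 0) (.const 2)) ;;
  .for 13 0 0 (.ite (.and (.natLt (.const 0) (.get 24 (.var 13)))
      (.natLt (.get 24 (.var 13)) (.var 30))) pushVertex .skip)

theorem run_enumerate {I : Finset (Fin n)} (hE : EdgeMem es M) (hv : M.nat 10 0 = v)
    (hp : M.nat 33 0 = p) (hvp : v ≠ p) (hvI : v ∉ I) (hpI : p ∉ I)
    (hI : ∀ u, u ∈ I ↔ 0 < M.nat 24 u ∧ M.nat 24 u < M.nat 30 0) (h27 : M.nat 27 = fun _ => 0) :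
    Run enumerate M (60 * (n + 1)) fun M' => ∃ l : List (Fin n), (v :: p :: l).Nodup ∧
      (∀ x, x ∈ l ↔ x ∈ I) ∧ Enumerated (v :: p :: l) M' := by
  refine (Run.seq (K₁ := 40) (Q := fun M' => Enumerated [v, p] M')
    (Run.straight (by decide) (by decide) ?_) fun M₁ hF₁ hM₁ =>
    (Run.for (by decide) (by decide) (fun u M' => ∃ l : List (Fin n), (v :: p :: l).Nodup ∧
      (∀ x, x ∈ l ↔ x ∈ I ∧ x < u) ∧ Enumerated (v :: p :: l) M') (fun _ => 40) ?_ ?_).mono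
      (K := 52 * n + 9) ?_ ?_).mono ?_ fun _ _ h => h
  -- The position `0` of `v` is never stored; it is the initial content of array `27`.
  · have hvp' : (v : ℕ) ≠ p := fun h => hvp (Fin.ext h)
    constructor
    · simp [Cmd.effect, NExp.eval]
    · intro i hi
      simp only [List.length_cons, List.length_nil] at hi
      interval_cases i <;> simp [Cmd.effect, NExp.eval, hv, hp]
    · intro i hi
      simp only [List.length_cons, List.length_nil] at hi
      interval_cases i <;> simp [Cmd.effect, NExp.eval, hp, h27, hvp']
  · exact ⟨[], by simpa using hvp, by simp, hM₁.frame (frame_storeNat _ _ _ _) (by decide)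
      (by decide) (by decide)⟩
  · rintro u hu M₂ hF₂ hx ⟨l, hl, hm, hq⟩
    rw [hF₁.nat 0 (by decide), hE.size] at hu
    refine Run.straight (by decide) (by decide) ?_
    have hb : (⟨u, hu⟩ : Fin n) ∈ I ↔ 0 < M₂.nat 24 u ∧ M₂.nat 24 u < M₂.nat 30 0 := by
      rw [hF₂.nat 24 (by decide), hF₂.nat 30 (by decide), hF₁.nat 24 (by decide),
        hF₁.nat 30 (by decide)]
      exact hI ⟨u, hu⟩
    simp only [Cmd.effect, BExp.eval, NExp.eval, hx]
    by_cases h : (⟨u, hu⟩ : Fin n) ∈ I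
    · rw [if_pos (hb.1 h)]
      have hul : (⟨u, hu⟩ : Fin n) ∉ v :: p :: l := by
        simp only [List.mem_cons, not_or, hm]
        exact ⟨fun e => hvI (e ▸ h), fun e => hpI (e ▸ h), fun e => by simp at e⟩
      refine ⟨l ++ [⟨u, hu⟩], ?_, fun x => ?_, ?_⟩
      · exact nodup_append_singleton (L := v :: p :: l) hl hul
      · simp only [List.mem_append, List.mem_singleton, hm, Fin.ext_iff, Nat.lt_succ_iff_lt_or_eq]
        constructor
        · rintro (h1 | h1)
          · exact ⟨h1.1, Or.inl h1.2⟩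
          · exact ⟨(show x = ⟨u, hu⟩ from Fin.ext h1) ▸ h, Or.inr h1⟩
        · rintro ⟨h1, h2 | h2⟩
          exacts [Or.inl ⟨h1, h2⟩, Or.inr h2]
      · exact (hq.push hul hx).frame (frame_storeNat _ _ _ _) (by decide) (by decide) (by decide)
    · rw [if_neg fun h' => h (hb.2 h')]
      refine ⟨l, hl, fun x => ?_, hq.frame (frame_storeNat _ _ _ _) (by decide) (by decide)
        (by decide)⟩
      rw [hm, Nat.lt_succ_iff_lt_or_eq]
      constructor
      · rintro ⟨h1, h2⟩; exact ⟨h1, Or.inl h2⟩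
      · rintro ⟨h1, h2 | h2⟩
        · exact ⟨h1, h2⟩
        · exact absurd ((show x = ⟨u, hu⟩ from Fin.ext h2) ▸ h1) h
  · rw [hF₁.nat 0 (by decide), hE.size]; simp; omega
  · rintro M₂ - ⟨l, hl, hm, hq⟩
    refine ⟨l, hl, fun x => ?_, hq⟩
    rw [hm, hF₁.nat 0 (by decide), hE.size]
    simp
  · omega

/-- The list `L` of edges is stored in the arrays `21` and `22`, its length in `28`. -/
structure Listed {k : ℕ} (L : List (Fin k × Fin k)) (M : Mem) : Prop where
  length : M.nat 28 0 = L.length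
  tail : ∀ i (h : i < L.length), M.nat 21 i = L[i].1
  head : ∀ i (h : i < L.length), M.nat 22 i = L[i].2

theorem Listed.frame {k : ℕ} {L : List (Fin k × Fin k)} (h : Listed L M) {N R : List ℕ}
    (hF : Frame N R M M') (h21 : 21 ∉ N) (h22 : 22 ∉ N) (h28 : 28 ∉ N) : Listed L M' :=
  ⟨by rw [hF.nat _ h28, h.length], fun i hi => by rw [hF.nat _ h21, h.tail i hi],
    fun i hi => by rw [hF.nat _ h22, h.head i hi]⟩

/-- Append the edge with the given ends. -/
def pushEdge (x y : NExp) : Cmd :=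
  .setNat 21 (.var 28) x ;; .setNat 22 (.var 28) y ;;
  .setNat 28 (.const 0) (.add (.var 28) (.const 1))

theorem Listed.push {k : ℕ} {L : List (Fin k × Fin k)} (h : Listed L M) {c d : Fin k} {x y : NExp}
    (hx : x.eval M = c) (hy : ∀ i z, y.eval (M.storeNat 21 i z) = d) :
    Listed (L ++ [(c, d)]) ((pushEdge x y).effect M) := by
  constructor
  · simp [pushEdge, Cmd.effect, NExp.eval, h.length]
  · intro i hi
    rw [List.length_append, List.length_singleton] at hi
    simp only [pushEdge, Cmd.effect, NExp.eval, h.length, hx, Mem.storeNat_nat,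
      Nat.reduceEqDiff, false_and, true_and, if_false]
    split_ifs with h1
    · subst h1; simp
    · have h2 : i < L.length := by omega
      rw [List.getElem_append_left h2, h.tail i h2]
  · intro i hi
    rw [List.length_append, List.length_singleton] at hi
    simp only [pushEdge, Cmd.effect, NExp.eval, h.length, hx, hy, Mem.storeNat_nat,
      Nat.reduceEqDiff, false_and, true_and, if_false]
    split_ifs with h1
    · subst h1; simp
    · have h2 : i < L.length := by omega
      rw [List.getElem_append_left h2, h.head i h2]

/-- List the edges that leave the first vertex. -/
def sourceEdges : Cmd :=
  .for 12 0 1 (.ite (.natEq (.get 1 (.var 12)) (.var 10))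
    (pushEdge (.const 0) (.get 27 (.get 2 (.var 12)))) .skip)

theorem run_sourceEdges {q : List (Fin n)} (hn : q.Nodup) (hes : es.Nodup) (hE : EdgeMem es M)
    (hv : M.nat 10 0 = v) (hq : Enumerated q M) (h0 : 0 < q.length)
    (hout : ∀ w, (v, w) ∈ es → w ∈ q) (h28 : M.nat 28 0 = 0) :
    Run sourceEdges M (60 * es.length + 9) fun M' => ∃ L : List (Fin q.length × Fin q.length),
      L.Nodup ∧ Listed L M' ∧ ∀ c d, (c, d) ∈ L ↔ c = ⟨0, h0⟩ ∧ (v, q[d]) ∈ es := by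
  refine (Run.for (by decide) (by decide) (fun e M' =>
    ∃ L : List (Fin q.length × Fin q.length), L.Nodup ∧ Listed L M' ∧
      ∀ c d, (c, d) ∈ L ↔ c = ⟨0, h0⟩ ∧ (v, q[d]) ∈ es.take e) (fun _ => 40) ?_ ?_).mono ?_ ?_
  · exact ⟨[], List.nodup_nil, ⟨by simp [h28], by simp, by simp⟩, by simp⟩
  · rintro e he M₁ hF hx ⟨L, hL, hLM, hm⟩
    rw [hE.length] at he
    have hE₁ := hE.frame hF (by decide) (by decide) (by decide)
    have hq₁ := hq.frame hF (by decide) (by decide) (by decide)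
    refine Run.straight (by decide) (by decide) ?_
    simp only [List.take_succ_eq_append_getElem he, List.mem_append, List.mem_singleton]
    simp only [Cmd.effect, BExp.eval, NExp.eval, hx, hE₁.tail e he, hF.nat 10 (by decide), hv]
    by_cases hb : es[e].1 = v
    · rw [if_pos (by rw [hb])]
      have hw : es[e] = (v, es[e].2) := by rw [← hb]
      obtain ⟨d, hd, hde⟩ := List.getElem_of_mem (hout es[e].2 (by rw [← hw]; simp))
      have hnew : (v, q[d]) ∉ es.take e := by
        rw [hde, ← hw]
        intro h
        obtain ⟨j, hj, hje⟩ := List.mem_take_iff_getElem.1 h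
        have := (List.Nodup.getElem_inj_iff hes).1 hje
        omega
      refine ⟨L ++ [(⟨0, h0⟩, ⟨d, hd⟩)], nodup_append_singleton hL fun h => hnew ((hm _ _).1 h).2,
        (hLM.push (by simp [NExp.eval]) fun i z => ?_).frame (frame_storeNat _ _ _ _) (by decide)
          (by decide) (by decide), fun c d' => ?_⟩
      · simp [NExp.eval, hx, hE₁.head e he, ← hde, hq₁.pos d hd]
      · rw [List.mem_append, List.mem_singleton, hm, hw, ← hde, Prod.mk.injEq, Prod.mk.injEq]
        have : q[(d' : ℕ)] = q[d] ↔ d' = ⟨d, hd⟩ :=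
          (List.Nodup.getElem_inj_iff hn).trans (Fin.ext_iff (b := ⟨d, hd⟩)).symm
        simp only [Fin.getElem_fin]
        rw [this]
        tauto
    · rw [if_neg fun h => hb (Fin.ext h)]
      refine ⟨L, hL, hLM.frame (frame_storeNat _ _ _ _) (by decide) (by decide) (by decide),
        fun c d => ?_⟩
      have : ¬ (v, q[d]) = es[e] := fun h => hb (congrArg Prod.fst h).symm
      simp only [hm, this, or_false]
  · rw [hE.length]; simp; omega
  · rintro M₁ - ⟨L, hL, hLM, hm⟩
    rw [hE.length, List.take_length] at hm
    exact ⟨L, hL, hLM, hm⟩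

/-- List the edge that leaves the vertex with number `13` and copy the weights of this vertex. -/
def copyVertex : Cmd :=
  .setNat 34 (.const 0) (.get 27 (.sub (.get 4 (.get 26 (.var 13))) (.const 1))) ;;
  pushEdge (.var 13) (.var 34) ;;
  .setReal 2 (.var 13) (.get 0 (.get 26 (.var 13))) ;;
  .setReal 3 (.var 13) (.get 1 (.get 26 (.var 13))) ;;
  .setReal 4 (.var 34) (.add (.get 4 (.var 34)) (.get 0 (.get 26 (.var 13))))

/-- Numbers `0` and `1` are the ends of the block and are skipped: the edges of the source are
already listed, the sink has none in the block, and the weights of both are set in `finish`. -/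
def innerEdges : Cmd := .for 13 20 0 (.ite (.natLt (.const 1) (.var 13)) copyVertex .skip)

open Classical in
/-- The weights of the first `j` vertices have been copied. -/
structure Copied (G : CompGraph (Fin n)) (q : List (Fin n)) (j : ℕ) (M : Mem) : Prop where
  size : ∀ c (h : c < q.length), M.real 2 c = if 2 ≤ c ∧ c < j then G.size q[c] else 0
  scratch : ∀ c (h : c < q.length), M.real 3 c = if 2 ≤ c ∧ c < j then G.scratch q[c] else 0
  release : ∀ d (h : d < q.length), M.real 4 d =
    ∑ c ∈ Finset.univ.filter (fun c : Fin q.length =>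
      (2 ≤ (c : ℕ) ∧ (c : ℕ) < j) ∧ G.graph.Adj q[c] q[d]), G.size q[c]

theorem run_innerEdges {G : CompGraph (Fin n)} {t : Fin n} {P : Fin n → Prop} {q : List (Fin n)}
    (hn : q.Nodup) (hq : Enumerated q M) (hN : NextMem G.graph.Adj t P M)
    (hout : ∀ c (h : c < q.length), 2 ≤ c → P q[c] ∧ ∃ d, ∃ h' : d < q.length,
      ∀ w, G.graph.Adj q[c] w ↔ w = q[d])
    (hsize : ∀ u : Fin n, M.real 0 u = G.size u) (hscr : ∀ u : Fin n, M.real 1 u = G.scratch u)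
    (h2 : M.real 2 = fun _ => 0) (h3 : M.real 3 = fun _ => 0) (h4 : M.real 4 = fun _ => 0)
    {L : List (Fin q.length × Fin q.length)} (hL : L.Nodup) (hLM : Listed L M)
    (hL0 : ∀ c d, (c, d) ∈ L → (c : ℕ) < 2) :
    Run innerEdges M (100 * q.length + 9) fun M' =>
      Copied G q q.length M' ∧ ∃ L' : List (Fin q.length × Fin q.length),
      L'.Nodup ∧ Listed L' M' ∧
      ∀ c d, (c, d) ∈ L' ↔ (c, d) ∈ L ∨ 2 ≤ (c : ℕ) ∧ G.graph.Adj q[c] q[d] := by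
  classical
  refine (Run.for (by decide) (by decide) (fun j M' => Copied G q j M' ∧
    ∃ L' : List (Fin q.length × Fin q.length), L'.Nodup ∧ Listed L' M' ∧
      ∀ c d, (c, d) ∈ L' ↔ (c, d) ∈ L ∨ (2 ≤ (c : ℕ) ∧ (c : ℕ) < j) ∧ G.graph.Adj q[c] q[d])
    (fun _ => 80) ?_ ?_).mono ?_ ?_
  · refine ⟨⟨fun c _ => by simp [h2], fun c _ => by simp [h3], fun d _ => by simp [h4]⟩, L, hL,
      hLM.frame (frame_storeNat _ _ _ _) (by decide) (by decide) (by decide), by simp⟩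
  · rintro j hj M₁ hF hx ⟨hC, L', hL', hLM', hm⟩
    rw [hq.length] at hj
    have hq₁ := hq.frame hF (by decide) (by decide) (by decide)
    have hN₁ := hN.frame hF (by decide)
    refine Run.straight (by decide) (by decide) ?_
    simp only [Cmd.effect, BExp.eval, NExp.eval, hx]
    by_cases hj2 : 1 < j
    · rw [if_pos hj2]
      obtain ⟨hPj, d, hd, hjd⟩ := hout j hj hj2
      have hnext := hN₁.next _ _ hPj ((hjd _).2 rfl)
      have hinj : ∀ (c c' : ℕ) (h : c < q.length) (h' : c' < q.length),
          q[c] = q[c'] ↔ c = c' := fun c c' h h' => List.Nodup.getElem_inj_iff hn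
      have h34 : M₁.nat 27 (M₁.nat 4 q[j] - 1) = d := by
        rw [hnext, Nat.add_sub_cancel, hq₁.pos d hd]
      have hs : ∀ u : Fin n, M₁.real 0 u = G.size u := fun u => by
        rw [hF.real 0 (by decide), hsize]
      have hs' : ∀ u : Fin n, M₁.real 1 u = G.scratch u := fun u => by
        rw [hF.real 1 (by decide), hscr]
      refine ⟨⟨fun c hc => ?_, fun c hc => ?_, fun d' hd' => ?_⟩, L' ++ [(⟨j, hj⟩, ⟨d, hd⟩)],
        nodup_append_singleton hL' ?_, ?_, fun c d' => ?_⟩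
      · simp only [copyVertex, pushEdge, Cmd.effect, NExp.eval, RExp.eval, hx, Mem.storeNat_nat,
          Mem.storeNat_real, Mem.storeReal_nat, Mem.storeReal_real, Nat.reduceEqDiff, false_and,
          true_and, if_false, hq₁.get j hj, hs, hC.size c hc]
        by_cases hcj : c = j
        · subst hcj; rw [if_pos rfl, if_pos (by omega)]
        · rw [if_neg hcj]
          exact if_congr (by omega) rfl rfl
      · simp only [copyVertex, pushEdge, Cmd.effect, NExp.eval, RExp.eval, hx, Mem.storeNat_nat,
          Mem.storeNat_real, Mem.storeReal_nat, Mem.storeReal_real, Nat.reduceEqDiff, false_and,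
          true_and, if_false, hq₁.get j hj, hs', hC.scratch c hc]
        by_cases hcj : c = j
        · subst hcj; rw [if_pos rfl, if_pos (by omega)]
        · rw [if_neg hcj]
          exact if_congr (by omega) rfl rfl
      -- Vertex number `j` has a single out-neighbour, number `d`, so only the sum of incoming sizes
      -- at `d` changes.
      · have hset : (Finset.univ.filter fun c : Fin q.length =>
            (2 ≤ (c : ℕ) ∧ (c : ℕ) < j + 1) ∧ G.graph.Adj q[c] q[d']) =
            (if d' = d then {⟨j, hj⟩} else ∅) ∪ (Finset.univ.filter fun c : Fin q.length =>
            (2 ≤ (c : ℕ) ∧ (c : ℕ) < j) ∧ G.graph.Adj q[c] q[d']) := by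
          ext c
          simp only [Finset.mem_filter, Finset.mem_univ, true_and, Finset.mem_union]
          by_cases hcj : c = ⟨j, hj⟩
          · subst hcj
            simp only [Fin.getElem_fin, hjd, hinj]
            split_ifs with h
            · simp [h]; omega
            · simp [h]
          · have : (c : ℕ) ≠ j := fun h => hcj (Fin.ext h)
            have h1 : (c : ℕ) < j + 1 ↔ (c : ℕ) < j := by omega
            rw [h1]
            split_ifs <;> simp [hcj]
        have hdisj : Disjoint (if d' = d then {⟨j, hj⟩} else ∅ : Finset (Fin q.length))
            (Finset.univ.filter fun c : Fin q.length =>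
            (2 ≤ (c : ℕ) ∧ (c : ℕ) < j) ∧ G.graph.Adj q[c] q[d']) := by
          split_ifs <;> simp
        rw [hset, Finset.sum_union hdisj]
        simp only [copyVertex, pushEdge, Cmd.effect, NExp.eval, RExp.eval, hx, h34, Mem.storeNat_nat,
          Mem.storeNat_real, Mem.storeReal_nat, Mem.storeReal_real, Nat.reduceEqDiff, false_and,
          true_and, and_self, if_true, if_false, hq₁.get j hj, hs]
        by_cases h : d' = d
        · subst h
          simp only [if_true, hC.release d' hd', Finset.sum_singleton, Fin.getElem_fin]
          rw [add_comm]
        · simp only [h, if_false, hC.release d' hd', Finset.sum_empty, zero_add]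
      · intro h
        rcases (hm _ _).1 h with h | h
        · have := hL0 _ _ h
          simp at this; omega
        · simp at h
      · have hLM₂ : Listed L' (M₁.storeNat 34 0 d) := hLM'.frame (frame_storeNat _ _ _ _)
          (by decide) (by decide) (by decide)
        have hLM₃ := hLM₂.push (c := ⟨j, hj⟩) (d := ⟨d, hd⟩) (x := .var 13) (y := .var 34)
          (by simp [NExp.eval, hx]) (by intro i z; simp [NExp.eval])
        have e1 : (copyVertex.effect M₁).nat =
            ((pushEdge (.var 13) (.var 34)).effect (M₁.storeNat 34 0 d)).nat := by
          simp only [copyVertex, Cmd.effect, Mem.storeReal_nat, NExp.eval, hx, hq₁.get j hj, h34]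
        obtain ⟨a1, a2, a3⟩ := hLM₃
        rw [← e1] at a1 a2 a3
        exact (Listed.mk a1 a2 a3).frame (frame_storeNat _ _ _ _) (by decide) (by decide)
          (by decide)
      · rw [List.mem_append, List.mem_singleton, hm, Prod.mk.injEq]
        by_cases hcj : c = ⟨j, hj⟩
        · subst hcj
          have hnL : (⟨j, hj⟩, d') ∉ L := fun h => absurd (hL0 _ _ h) (by simp; omega)
          have hqd : q[(d' : ℕ)] = q[d] ↔ d' = ⟨d, hd⟩ :=
            (hinj _ _ _ _).trans (Fin.ext_iff (b := ⟨d, hd⟩)).symm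
          simp only [Fin.getElem_fin, hjd, hqd, hnL, lt_irrefl, and_false, false_and, false_or,
            true_and, Nat.lt_succ_self, and_true, show 2 ≤ j from hj2]
        · have : (c : ℕ) ≠ j := fun h => hcj (Fin.ext h)
          have h1 : (c : ℕ) < j + 1 ↔ (c : ℕ) < j := by omega
          simp [hcj, h1]
    · rw [if_neg hj2]
      have h1 : ∀ c : ℕ, (2 ≤ c ∧ c < j + 1) ↔ (2 ≤ c ∧ c < j) := by intro c; omega
      refine ⟨⟨fun c hc => ?_, fun c hc => ?_, fun d hd => ?_⟩, L', hL',
        hLM'.frame (frame_storeNat _ _ _ _) (by decide) (by decide) (by decide), ?_⟩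
      · simp only [h1]; exact hC.size c hc
      · simp only [h1]; exact hC.scratch c hc
      · simp only [h1]; exact hC.release d hd
      · simp only [h1]; exact hm
  · rw [hq.length]; simp; omega
  · rintro M₁ - ⟨hC, L', hL', hLM', hm⟩
    rw [hq.length] at hC hm
    refine ⟨hC, L', hL', hLM', fun c d => ?_⟩
    rw [hm]
    simp [c.2]

end Step

end PeakMem

/-! ### The block as a computation graph and the call of the given algorithm -/

namespace PeakMem

open Relation

-- The special weights at the ends must satisfy the conditions on `scratch`. The sink may have
-- scratch `-rel` because, by `huniq`, each in-neighbour of `p` in `I` has `p` as its only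
-- out-neighbour and is released by it. For an inner vertex, `hv` says that it is never the only
-- out-neighbour of `v`, so everything it releases in `G` lies in `I` and has the same size in the
-- block graph.
open Classical in
theorem exists_blockGraph {V W : Type*} [Fintype V] [Fintype W] (G : CompGraph V) {v p : V}
    {I : Finset V} (hI : IsBlock G.graph.Adj v p I)
    (huniq : ∀ x ∈ I, ∀ y z, G.graph.Adj x y → G.graph.Adj x z → y = z)
    (hv : ∀ x ∈ I, ∃ w, G.graph.Adj v w ∧ w ≠ x) {e : W → V} (inj : Function.Injective e) {a b : W}
    (map_a : e a = v) (map_b : e b = p) (range : ∀ x ∈ I, ∃ c, e c = x)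
    (mem : ∀ c, c ≠ a → c ≠ b → e c ∈ I) :
    ∃ H : CompGraph W, IsBlockGraph G v p I H e a b ∧ H.scratch a = 0 := by
  have hab : a ≠ b := by rintro rfl; exact hI.ne (map_a.symm.trans map_b)
  let rel : ℝ := ∑ y ∈ I with G.graph.Adj y p, G.size y
  have hrel : 0 ≤ rel := Finset.sum_nonneg fun y _ => G.size_nonneg y
  let sz : W → ℝ := fun c => if c = a then (if G.graph.Adj v p then 0 else G.size v)
    else if c = b then rel else G.size (e c)
  have hsz : ∀ c, e c ∈ I → sz c = G.size (e c) := by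
    intro c hc
    have h1 : c ≠ a := by rintro rfl; exact hI.v_notMem (map_a ▸ hc)
    have h2 : c ≠ b := by rintro rfl; exact hI.p_notMem (map_b ▸ hc)
    simp [sz, h1, h2]
  have hsz0 : ∀ c, 0 ≤ sz c := by
    intro c
    simp only [sz]
    split_ifs
    exacts [le_rfl, G.size_nonneg v, hrel, G.size_nonneg _]
  -- Outputs of `I` consumed only by `e c` in `G` are consumed only by `c` in the block graph;
  -- further outputs released there can only help.
  have key : ∀ c, ∀ S : Finset V, S ⊆ I → (∀ y ∈ S, ∀ w, G.graph.Adj y w ↔ w = e c) →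
      ∑ y ∈ S, G.size y ≤ ∑ u with {w | G.graph.Adj (e u) (e w)} = {c}, sz u := by
    intro c S hSI hS
    have hsub : S ⊆ ((Finset.univ.filter fun u => {w | G.graph.Adj (e u) (e w)} = {c}).filter
        fun u => e u ∈ I).image e := by
      intro y hy
      obtain ⟨u, rfl⟩ := range y (hSI hy)
      refine Finset.mem_image.2 ⟨u, ?_, rfl⟩
      simp only [Finset.mem_filter, Finset.mem_univ, true_and]
      refine ⟨?_, hSI hy⟩
      ext w
      rw [Set.mem_ofPred_eq, hS _ hy, Set.mem_singleton_iff, inj.eq_iff]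
    refine (Finset.sum_le_sum_of_subset_of_nonneg hsub fun y _ _ => G.size_nonneg y).trans ?_
    rw [Finset.sum_image fun x _ y _ h => inj h]
    refine le_trans (le_of_eq (Finset.sum_congr rfl fun u hu => ?_))
      (Finset.sum_le_sum_of_subset_of_nonneg (Finset.filter_subset _ _) fun u _ _ => hsz0 u)
    exact (hsz u (Finset.mem_filter.1 hu).2).symm
  refine ⟨⟨⟨fun c d => G.graph.Adj (e c) (e d)⟩, fun c hc => G.acyclic (e c)
      (hc.lift e fun _ _ h => h), sz,
      fun c => if c = a then 0 else if c = b then -rel else G.scratch (e c), hsz0, ?_, ?_⟩,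
    ⟨inj, map_a, map_b, range, mem, fun _ _ => Iff.rfl, hsz, ?_, ?_, ?_, ?_⟩, ?_⟩
  · intro c
    have h0 := hsz0 c
    by_cases hca : c = a
    · simp only [hca, if_true]; rw [hca] at h0; linarith
    by_cases hcb : c = b
    · simp [hcb, hab.symm, sz]
    · simp only [hca, hcb, if_false, sz]
      exact G.neg_size_le_scratch _
  · intro c
    simp only
    split_ifs with hca hcb
    · rw [neg_nonpos]
      exact Finset.sum_nonneg fun u _ => hsz0 u
    · rw [neg_le_neg_iff]
      refine key c _ (Finset.filter_subset _ _) fun y hy w => ?_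
      rw [Finset.mem_filter] at hy
      rw [hcb, map_b]
      exact ⟨fun h => huniq y hy.1 _ _ h hy.2, by rintro rfl; exact hy.2⟩
    · have hcI := mem c hca hcb
      refine le_trans (neg_le_neg ?_) (G.neg_release_le_scratch (e c))
      refine key c _ (fun y hy => ?_) fun y hy w => ?_
      all_goals
        rw [Finset.mem_filter] at hy
        have hyw : ∀ w, G.graph.Adj y w ↔ w = e c := fun w => by
          have : w ∈ {w | G.graph.Adj y w} ↔ w ∈ ({e c} : Set V) := by rw [hy.2]
          simpa using this
      · rcases hI.in_mem _ hcI y ((hyw _).2 rfl) with h | rfl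
        · exact h
        · obtain ⟨w, hw, hwc⟩ := hv _ hcI
          exact absurd ((hyw w).1 hw) hwc
      · exact hyw w
  · intro c hc
    have h1 : c ≠ a := by rintro rfl; exact hI.v_notMem (map_a ▸ hc)
    have h2 : c ≠ b := by rintro rfl; exact hI.p_notMem (map_b ▸ hc)
    simp [h1, h2]
  · simp [sz]
  · simp only [sz, if_neg hab.symm, if_true, rel]
  · simp [sz, hab.symm]
  · simp

variable {n : ℕ} {es : List (Fin n × Fin n)} {M M' : Mem}

theorem Mem.eq_of_eq (hn : M.nat = M'.nat) (hr : M.real = M'.real) : M = M' := by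
  cases M; cases M'; simp_all

namespace Step

/-- The graph `H` with the edge list `L` is stored as an input for the solver. -/
structure Loaded {k : ℕ} (H : CompGraph (Fin k)) (L : List (Fin k × Fin k)) (M : Mem) : Prop where
  order : M.nat 20 0 = k
  length : M.nat 20 1 = L.length
  tail : ∀ i (h : i < L.length), M.nat 21 i = L[i].1
  head : ∀ i (h : i < L.length), M.nat 22 i = L[i].2
  size : ∀ c : Fin k, M.real 2 c = H.size c
  scratch : ∀ c : Fin k, M.real 3 c = H.scratch c

/-- Number `1` receives the total size of the in-neighbours of `p` in the block, and minus this
amount as scratch. Number `0` receives the size of `v` unless `p` is an out-neighbour; in that case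
its size stays zero, as its scratch always does. -/
def finish : Cmd :=
  .setReal 2 (.const 1) (.get 4 (.const 1)) ;;
  .setReal 3 (.const 1) (.sub (.const 0) (.get 4 (.const 1))) ;;
  .ite (.natEq (.get 25 (.var 33)) (.const 0)) (.setReal 2 (.const 0) (.get 0 (.var 10))) .skip ;;
  .setNat 20 (.const 1) (.var 28)

/-- Run the algorithm `A` on the block. -/
def solve (A : Cmd) : Cmd :=
  .call A [⟨20, 0, .const 2⟩, ⟨21, 1, .get 20 (.const 1)⟩, ⟨22, 2, .get 20 (.const 1)⟩]
    [⟨2, 0, .var 20⟩, ⟨3, 1, .var 20⟩] [⟨3, 23, .var 20⟩] []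

/-- The given algorithm is only known to work on `inputMem`, where all other cells are zero. A call
with private memory provides exactly this memory, independently of leftovers in the caller. -/
theorem Loaded.copy_eq {k : ℕ} {H : CompGraph (Fin k)} {L : List (Fin k × Fin k)}
    (h : Loaded H L M) :
    copyReal M M [⟨2, 0, .var 20⟩, ⟨3, 1, .var 20⟩] (copyNat M M
      [⟨20, 0, .const 2⟩, ⟨21, 1, .get 20 (.const 1)⟩, ⟨22, 2, .get 20 (.const 1)⟩] Mem.zero) =
    inputMem H L := by
  have hnat : (copyNat M M [⟨20, 0, .const 2⟩, ⟨21, 1, .get 20 (.const 1)⟩,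
      ⟨22, 2, .get 20 (.const 1)⟩] Mem.zero).nat = (inputMem H L).nat := by
    funext a i
    simp only [copyNat, List.foldl_cons, List.foldl_nil, NExp.eval, h.length, Mem.zero, inputMem]
    by_cases ha0 : a = 0
    · subst ha0
      simp only [OfNat.zero_ne_ofNat, zero_ne_one, false_and, if_false, true_and, if_true]
      rcases i with _ | _ | i
      · simp [h.order]
      · simp [h.length]
      · simp
    by_cases ha1 : a = 1
    · subst ha1
      simp only [OfNat.one_ne_ofNat, one_ne_zero, false_and, if_false, true_and, if_true]
      split_ifs with hi
      · rw [h.tail i hi, List.getD_eq_getElem _ _ (by simpa using hi), List.getElem_map]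
      · rw [List.getD_eq_default _ _ (by simpa using hi)]
    by_cases ha2 : a = 2
    · subst ha2
      simp only [OfNat.ofNat_ne_zero, OfNat.ofNat_ne_one, false_and, if_false,
        true_and, if_true]
      split_ifs with hi
      · rw [h.head i hi, List.getD_eq_getElem _ _ (by simpa using hi), List.getElem_map]
      · rw [List.getD_eq_default _ _ (by simpa using hi)]
    simp [ha0, ha1, ha2]
  have hreal : (copyReal M M [⟨2, 0, .var 20⟩, ⟨3, 1, .var 20⟩] (copyNat M M
      [⟨20, 0, .const 2⟩, ⟨21, 1, .get 20 (.const 1)⟩, ⟨22, 2, .get 20 (.const 1)⟩]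
      Mem.zero)).real = (inputMem H L).real := by
    funext a i
    simp only [copyReal, List.foldl_cons, List.foldl_nil, NExp.eval, h.order, inputMem,
      copyNat_real]
    by_cases hi : i < k
    · have h1 := h.size ⟨i, hi⟩
      have h2 := h.scratch ⟨i, hi⟩
      simp only at h1 h2
      by_cases ha0 : a = 0
      · subst ha0; simp [hi, h1]
      by_cases ha1 : a = 1
      · subst ha1; simp [hi, h2]
      simp [ha0, ha1, Mem.zero]
    · simp [hi, Mem.zero]
  exact Mem.eq_of_eq ((copyReal_nat _ _ _ _).trans hnat) hreal

theorem run_solve {A : Cmd} {k : ℕ} {H : CompGraph (Fin k)} {L : List (Fin k × Fin k)} {T : ℕ}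
    (h : Loaded H L M)
    (hA : ∃ (l : ℕ) (M' : Mem) (σ : List (Fin k)), Exec A (inputMem H L) l M' ∧ l ≤ T ∧
      H.IsDominant σ ∧ ∀ i : Fin σ.length, M'.nat 3 i = (σ[i] : ℕ)) :
    Run (solve A) M (T + 3 * k + 2 * L.length + 30) fun M' => ∃ σ : List (Fin k),
      H.IsDominant σ ∧ ∀ i (h : i < σ.length), M'.nat 23 i = σ[i] := by
  obtain ⟨l, M', σ, h1, h2, h3, h4⟩ := hA
  rw [← h.copy_eq] at h1
  refine ⟨_, _, .call A _ _ _ _ M M' l h1, ?_, σ, h3, fun i hi => ?_⟩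
  · simp only [copyCost, List.map_cons, List.map_nil, List.sum_cons, List.sum_nil, NExp.cost,
      NExp.eval, h.order, h.length]
    omega
  · have hlen : σ.length = k := by
      rw [← List.toFinset_card_of_nodup h3.isSchedule.nodup,
        show σ.toFinset = Finset.univ by ext x; simp [h3.isSchedule.complete x], Finset.card_univ,
        Fintype.card_fin]
    have := h4 ⟨i, hi⟩
    simp only [Fin.getElem_fin] at this
    simp only [copyReal, copyNat, List.foldl_cons, List.foldl_nil, NExp.eval, h.order, true_and]
    rw [if_pos (by omega), this]

end Step

end PeakMem

/-! ### Replacing the block by the path in memory -/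

namespace PeakMem

open Relation

section BlockMem

variable {V : Type*} [DecidableEq V] {Adj : V → V → Prop} {v p : V} {I : Finset V} {l : List V}

open Classical in
/-- The change of the memory in use by executing `x`, apart from the output of the source. -/
noncomputable def gain (Adj : V → V → Prop) (size : V → ℝ) (I : Finset V) (x : V) : ℝ :=
  size x - ∑ y ∈ I with Adj y x, size y

-- An inner output leaves the memory exactly when its unique out-neighbour is executed, so the
-- contribution of `I` is a sum of gains and can be kept up to date at constant cost per operation.
-- Only the output of `v`, which may have many consumers, needs separate treatment: it stays until
-- all of them have been executed.
open Classical in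
theorem blockMem_eq (hI : IsBlock Adj v p I) (hirr : ∀ x, ¬ Adj x x)
    (huniq : ∀ x ∈ I, ∀ y z, Adj x y → Adj x z → y = z) (hl : IsOrder Adj I l) (size : V → ℝ)
    (i : ℕ) : blockMem Adj size v l i = ∑ x ∈ (l.take i).toFinset, gain Adj size I x +
      if ∃ w, Adj v w ∧ w ∉ l.take i then size v else 0 := by
  have hSI : ∀ x ∈ l.take i, x ∈ I := fun x hx => (hl.mem_iff x).1 (List.mem_of_mem_take hx)
  have hclosed : ∀ x ∈ l.take i, ∀ y ∈ I, Adj y x → y ∈ l.take i := by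
    intro x hx y hy hyx
    obtain ⟨b, hb, rfl⟩ := List.mem_take_iff_getElem.1 hx
    obtain ⟨a, ha, rfl⟩ := List.getElem_of_mem ((hl.mem_iff y).2 hy)
    refine List.mem_take_iff_getElem.2 ⟨a, ?_, rfl⟩
    by_contra h
    have hba : b < a ∨ b = a := by omega
    rcases hba with hba | rfl
    · exact (List.pairwise_iff_getElem.1 hl.topological b a _ _ hba) hyx
    · exact hirr _ hyx
  have hnv : ∀ x ∈ I, ¬ Adj x v := fun x hx h => by
    rcases hI.out_mem x hx v h with h | h
    exacts [hI.v_notMem h, hI.ne h]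
  rw [blockMem, mem, Finset.sum_filter, Finset.sum_union, Finset.sum_singleton, add_comm]
  swap
  · rw [Finset.disjoint_singleton_left, List.mem_toFinset]
    exact fun h => hI.v_notMem (hSI v h)
  congr 1
  · simp only [gain, Finset.sum_sub_distrib]
    have h1 : ∑ x ∈ (l.take i).toFinset, ∑ y ∈ I with Adj y x, size y =
        ∑ y ∈ (l.take i).toFinset, if ∃ x ∈ l.take i, Adj y x then size y else 0 := by
      simp only [Finset.sum_filter]
      rw [Finset.sum_comm]
      have h2 : ∀ y ∈ I, (∑ x ∈ (l.take i).toFinset, if Adj y x then size y else 0) =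
          if ∃ x ∈ l.take i, Adj y x then size y else 0 := by
        intro y hy
        split_ifs with h
        · obtain ⟨x, hx, hyx⟩ := h
          rw [Finset.sum_eq_single x, if_pos hyx]
          · intro z _ hz
            rw [if_neg fun h => hz (huniq y hy z x h hyx)]
          · intro h; exact absurd (List.mem_toFinset.2 hx) h
        · push Not at h
          exact Finset.sum_eq_zero fun x hx => if_neg (h x (List.mem_toFinset.1 hx))
      rw [Finset.sum_congr rfl h2]
      refine (Finset.sum_subset (fun x hx => hSI x (List.mem_toFinset.1 hx)) ?_).symm
      intro y hy hyS
      rw [if_neg]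
      rintro ⟨x, hx, hyx⟩
      exact hyS (List.mem_toFinset.2 (hclosed x hx y hy hyx))
    rw [h1, ← Finset.sum_sub_distrib]
    refine Finset.sum_congr rfl fun u hu => ?_
    have huI := hSI u (List.mem_toFinset.1 hu)
    obtain ⟨z, hz, -⟩ := TransGen.head'_iff.1 (hI.reach_p u huI)
    by_cases hzS : z ∈ l.take i
    · rw [if_neg, if_pos ⟨z, hzS, hz⟩, sub_self]
      rintro (h | ⟨w, hw, huw⟩)
      · exact h
      · rw [huniq u huI w z huw hz] at hw
        simp [hzS] at hw
    · rw [if_pos, if_neg, sub_zero]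
      · rintro ⟨x, hx, hux⟩
        rw [huniq u huI x z hux hz] at hx
        exact hzS hx
      · refine Or.inr ⟨z, ?_, hz⟩
        simp only [Finset.mem_union, Finset.mem_singleton, List.mem_toFinset, hzS, or_false]
        rintro rfl; exact hnv u huI hz
  · refine ite_congr (propext ?_) (fun _ => rfl) fun _ => rfl
    simp only [false_or, Finset.mem_union, Finset.mem_singleton, List.mem_toFinset, not_or]
    refine exists_congr fun w => ?_
    constructor
    · rintro ⟨⟨-, h1⟩, h2⟩; exact ⟨h2, h1⟩
    · rintro ⟨h1, h2⟩
      exact ⟨⟨by rintro rfl; exact hirr _ h1, h2⟩, h1⟩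

end BlockMem

theorem Cmd.effect_skip (M : Mem) : Cmd.skip.effect M = M := rfl

theorem Cmd.effect_ite_pos {b : BExp} {c d : Cmd} {M : Mem} (h : b.eval M) :
    (Cmd.ite b c d).effect M = c.effect M := if_pos h

theorem Cmd.effect_ite_neg {b : BExp} {c d : Cmd} {M : Mem} (h : ¬ b.eval M) :
    (Cmd.ite b c d).effect M = d.effect M := if_neg h

variable {n : ℕ} {M M' : Mem} {Adj₀ : Fin n → Fin n → Prop} {s t v p : Fin n} {P : Fin n → Prop}

namespace Step

/-- The vertex with position `13` in the solution. -/
def current : NExp := .get 26 (.get 23 (.var 13))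

/-- Update the weights of the current vertex. -/
def weigh : Cmd :=
  .ite (.natEq (.get 25 current) (.const 1)) (.setNat 34 (.const 0) (.sub (.var 34) (.const 1)))
    .skip ;;
  .setReal 5 (.const 0) (.sub (.add (.get 5 (.const 0)) (.get 0 current))
    (.get 4 (.get 23 (.var 13)))) ;;
  .ite (.natEq (.var 34) (.const 0)) (.setReal 6 (.const 0) (.get 5 (.const 0)))
    (.setReal 6 (.const 0) (.add (.get 5 (.const 0)) (.get 0 (.var 10)))) ;;
  .setReal 1 current (.sub (.add (.get 0 current) (.get 1 current)) (.get 6 (.const 0))) ;;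
  .setReal 0 current (.get 6 (.const 0))

/-- Let the current vertex follow its predecessor. -/
def link : Cmd :=
  .setNat 4 (.get 26 (.get 23 (.sub (.var 13) (.const 1)))) (.add current (.const 1))

/-- Position `0` is the source, which follows nothing. The last position is `p`, which is linked to
its predecessor but keeps its weights. -/
def updateVertex : Cmd :=
  .ite (.natLt (.const 0) (.var 13))
    (link ;; .ite (.natLt (.add (.var 13) (.const 1)) (.var 20)) weigh .skip) .skip

/-- Replace the block by the path that is described by the solution. -/
def update : Cmd := .setNat 34 (.const 0) (.var 30) ;; .for 13 20 0 updateVertex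

/-- Here `r` counts the out-neighbours of the source still to come and `T` is the running sum of
gains. The output of the source is added to `T` exactly as long as `r` is nonzero. -/
theorem weigh_effect {x : ℕ} (hx : M.nat 26 (M.nat 23 (M.nat 13 0)) = x) :
    let r := M.nat 34 0 - if M.nat 25 x = 1 then 1 else 0
    let T := M.real 5 0 + M.real 0 x - M.real 4 (M.nat 23 (M.nat 13 0))
    let T' := if r = 0 then T else T + M.real 0 (M.nat 10 0)
    (weigh.effect M).nat 34 0 = r ∧ (weigh.effect M).real 5 0 = T ∧
      (∀ y, (weigh.effect M).real 0 y = if y = x then T' else M.real 0 y) ∧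
      ∀ y, (weigh.effect M).real 1 y =
        if y = x then M.real 0 x + M.real 1 x - T' else M.real 1 y := by
  intro r T T'
  by_cases h1 : M.nat 25 x = 1
  · by_cases h2 : M.nat 34 0 - 1 = 0
    · simp [weigh, current, Cmd.effect, BExp.eval, NExp.eval, RExp.eval, hx, h1, h2, r, T, T']
    · simp [weigh, current, Cmd.effect, BExp.eval, NExp.eval, RExp.eval, hx, h1, h2, r, T, T']
  · by_cases h2 : M.nat 34 0 = 0
    · simp [weigh, current, Cmd.effect, BExp.eval, NExp.eval, RExp.eval, hx, h1, h2, r, T, T']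
    · simp [weigh, current, Cmd.effect, BExp.eval, NExp.eval, RExp.eval, hx, h1, h2, r, T, T']

open Classical in
/-- The memory when the solver has returned the path `v, l, p`. -/
structure Solved (G : CompGraph (Fin n)) (v p : Fin n) (I : Finset (Fin n)) (l : List (Fin n))
    (M : Mem) : Prop where
  order : M.nat 20 0 = l.length + 2
  path : ∀ (j : ℕ) (u : Fin n), (v :: (l ++ [p]))[j]? = some u → M.nat 26 (M.nat 23 j) = u
  release : ∀ j (h : j < l.length), M.real 4 (M.nat 23 (j + 1)) =
    ∑ y ∈ I with G.graph.Adj y l[j], G.size y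
  out : ∀ u : Fin n, M.nat 25 u = if G.graph.Adj v u then 1 else 0
  deg : M.nat 30 0 = (Finset.univ.filter fun u => G.graph.Adj v u).card
  source : M.nat 10 0 = v
  size : ∀ u : Fin n, M.real 0 u = G.size u
  scratch : ∀ u : Fin n, M.real 1 u = G.scratch u
  acc : M.real 5 0 = 0

open Classical in
/-- The state after the vertices of `l.take i` have been treated. -/
structure Updated (G : CompGraph (Fin n)) (v p : Fin n) (I : Finset (Fin n)) (l : List (Fin n))
    (M₀ : Mem) (i : ℕ) (M : Mem) : Prop where
  next : ∀ (j : ℕ) (u w : Fin n), j < i → (v :: (l ++ [p]))[j]? = some u → (v :: (l ++ [p]))[j + 1]? = some w →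
    M.nat 4 u = w + 1
  same : ∀ u : Fin n, u ≠ v → u ∉ I → M.nat 4 u = M₀.nat 4 u
  size : ∀ u : Fin n, M.real 0 u = if u ∈ l.take i then G.relinkSize v I l u else G.size u
  scratch : ∀ u : Fin n, M.real 1 u =
    if u ∈ l.take i then G.size u + G.scratch u - G.relinkSize v I l u else G.scratch u
  acc : M.real 5 0 = ∑ x ∈ (l.take i).toFinset, gain G.graph.Adj G.size I x
  rem : M.nat 34 0 + ((l.take i).toFinset.filter fun u => G.graph.Adj v u).card =
    (Finset.univ.filter fun u => G.graph.Adj v u).card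

theorem Updated.storeNat {G : CompGraph (Fin n)} {I : Finset (Fin n)} {l : List (Fin n)} {M₀ : Mem}
    {i y : ℕ} (h : Updated G v p I l M₀ i M) : Updated G v p I l M₀ i (M.storeNat 13 0 y) :=
  ⟨fun j u w => by simpa using h.next j u w, fun u => by simpa using h.same u, h.size, h.scratch,
    h.acc, by simpa using h.rem⟩

-- The new size of each vertex of the path is the block memory after it, evaluated incrementally by
-- `blockMem_eq`: real cell `5` holds the sum of gains, and natural cell `34` decides whether the
-- output of `v` is still in use. The weights read for a vertex are the old ones because each vertex
-- is rewritten only once.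
open Classical in
theorem run_update {G : CompGraph (Fin n)} {I : Finset (Fin n)} {l : List (Fin n)}
    (hI : IsBlock G.graph.Adj v p I)
    (huniq : ∀ x ∈ I, ∀ y z, G.graph.Adj x y → G.graph.Adj x z → y = z)
    (hl : IsOrder G.graph.Adj I l) (hS : Solved G v p I l M) :
    Run update M (170 * (l.length + 3)) (Updated G v p I l M (l.length + 1)) := by
  have hnd := hI.nodup_path hl
  refine (Run.seq (K₁ := 4) (Q := fun M' => M' = M.storeNat 34 0 (M.nat 30 0))
    (Run.straight (by decide) (by decide) rfl) fun M₁ hF₁ hM₁ =>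
    -- Position `j` of the path holds `l[j - 1]`, and round `0` does nothing; hence the shift in the
    -- invariant, with truncated subtraction at `0`.
    (Run.for (by decide) (by decide) (fun j => Updated G v p I l M (j - 1)) (fun _ => 150) ?_
      ?_).mono (K := 162 * (l.length + 2) + 9) ?_ ?_).mono (by omega) fun _ _ h => h
  · refine Updated.storeNat ⟨fun j u w h => by simp at h, fun u _ _ => ?_, fun u => ?_, fun u => ?_,
      ?_, ?_⟩
    · rw [hF₁.nat 4 (by decide)]
    · simpa [hF₁.real 0 (by decide)] using hS.size u
    · simpa [hF₁.real 1 (by decide)] using hS.scratch u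
    · simpa [hF₁.real 5 (by decide)] using hS.acc
    · simp [hM₁, hS.deg]
  · intro j hj M₂ hF₂ hx hU
    rw [hF₁.nat 20 (by decide), hS.order] at hj
    refine Run.straight (by decide) (by decide) (Updated.storeNat ?_)
    have h20 : M₂.nat 20 0 = l.length + 2 := by
      rw [hF₂.nat 20 (by decide), hF₁.nat 20 (by decide), hS.order]
    have hpath : ∀ (j : ℕ) (u : Fin n), (v :: (l ++ [p]))[j]? = some u → M₂.nat 26 (M₂.nat 23 j) = u := by
      intro j u h
      rw [hF₂.nat 26 (by decide), hF₁.nat 26 (by decide), hF₂.nat 23 (by decide),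
        hF₁.nat 23 (by decide), hS.path j u h]
    rcases j with _ | i
    · rw [updateVertex, Cmd.effect_ite_neg (by simp [BExp.eval, NExp.eval, hx])]
      exact hU
    rw [updateVertex, Cmd.effect_ite_pos (by simp [BExp.eval, NExp.eval, hx]), Cmd.effect]
    simp only [Nat.add_sub_cancel] at hU ⊢
    have hlen : (v :: (l ++ [p])).length = l.length + 2 := by simp
    obtain ⟨a, ha⟩ : ∃ a, (v :: (l ++ [p]))[i]? = some a :=
      ⟨_, List.getElem?_eq_getElem (by omega)⟩
    obtain ⟨b, hb⟩ : ∃ b, (v :: (l ++ [p]))[i + 1]? = some b :=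
      ⟨_, List.getElem?_eq_getElem (by omega)⟩
    have hinj : ∀ (j k : ℕ) (u : Fin n), (v :: (l ++ [p]))[j]? = some u → (v :: (l ++ [p]))[k]? = some u → j = k := by
      intro j k u h1 h2
      obtain ⟨h3, h4⟩ := List.getElem?_eq_some_iff.1 h1
      obtain ⟨h5, h6⟩ := List.getElem?_eq_some_iff.1 h2
      exact (List.Nodup.getElem_inj_iff hnd).1 (h4.trans h6.symm)
    have haI : a = v ∨ a ∈ I := by
      rcases i with _ | i
      · simp at ha; exact Or.inl ha.symm
      · have hil : i < l.length := by omega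
        rw [getElem?_path_getElem hil] at ha
        exact Or.inr ((hl.mem_iff a).1 (Option.some.inj ha ▸ List.getElem_mem hil))
    have hlink : ∀ y, (link.effect M₂).nat 4 y = if y = a then (b : ℕ) + 1 else M₂.nat 4 y := by
      intro y
      simp [link, current, Cmd.effect, NExp.eval, hx, hpath _ _ ha, hpath _ _ hb]
    have hFl : Frame [4] [] M₂ (link.effect M₂) := frame_storeNat _ _ _ _
    have hcond : (BExp.natLt (.add (.var 13) (.const 1)) (.var 20)).eval (link.effect M₂) ↔
        i < l.length := by
      simp only [BExp.eval, NExp.eval]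
      rw [hFl.nat 20 (by decide), hFl.nat 13 (by decide), hx, h20]
      omega
    have hnext : ∀ M₃ : Mem, M₃.nat 4 = (link.effect M₂).nat 4 →
        (∀ (j : ℕ) (u w : Fin n), j < i + 1 → (v :: (l ++ [p]))[j]? = some u → (v :: (l ++ [p]))[j + 1]? = some w →
          M₃.nat 4 u = w + 1) ∧ ∀ u : Fin n, u ≠ v → u ∉ I → M₃.nat 4 u = M.nat 4 u := by
      intro M₃ hM₃
      constructor
      · intro j u w hji hu hw
        rw [hM₃, hlink]
        split_ifs with h
        · rw [Fin.ext h] at hu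
          obtain rfl := hinj _ _ _ hu ha
          rw [hb] at hw
          rw [Option.some.inj hw]
        · refine hU.next j u w ?_ hu hw
          rcases Nat.lt_succ_iff_lt_or_eq.1 hji with h1 | rfl
          · exact h1
          · rw [ha] at hu
            exact absurd (congrArg Fin.val (Option.some.inj hu)).symm h
      · intro u huv huI
        rw [hM₃, hlink, if_neg, hU.same u huv huI]
        intro h
        rcases haI with h1 | h1
        · exact huv ((Fin.ext h).trans h1)
        · exact huI (Fin.ext h ▸ h1)
    by_cases hil : i < l.length
    · rw [Cmd.effect_ite_pos (hcond.2 hil)]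
      have hbl : b = l[i] := by
        rw [getElem?_path_getElem hil] at hb
        exact (Option.some.inj hb).symm
      have hxb : (link.effect M₂).nat 26 ((link.effect M₂).nat 23 ((link.effect M₂).nat 13 0)) =
          (b : ℕ) := by
        rw [hFl.nat 26 (by decide), hFl.nat 23 (by decide), hFl.nat 13 (by decide), hx,
          hpath _ _ hb]
      obtain ⟨e1, e2, e3, e4⟩ := weigh_effect hxb
      have hFw := (Cmd.exists_exec (c := weigh) (by decide) (link.effect M₂)).choose_spec.2.frame
      have hbt : b ∉ l.take i := by
        rw [hbl]
        intro h
        obtain ⟨j, hj, he⟩ := List.mem_take_iff_getElem.1 h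
        have := (List.Nodup.getElem_inj_iff hl.nodup).1 he
        omega
      have htake : (l.take (i + 1)).toFinset = insert b (l.take i).toFinset := by
        rw [List.take_succ_eq_append_getElem hil, List.toFinset_append, ← hbl]
        ext y; simp
      have hmem : ∀ u, u ∈ l.take (i + 1) ↔ u = b ∨ u ∈ l.take i := by
        intro u
        rw [← List.mem_toFinset, htake, Finset.mem_insert, List.mem_toFinset]
      have hsb : M₂.real 0 b = G.size b := by rw [hU.size, if_neg hbt]
      have hsb' : M₂.real 1 b = G.scratch b := by rw [hU.scratch, if_neg hbt]
      have hvt : v ∉ l.take i := fun h =>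
        hI.v_notMem ((hl.mem_iff v).1 (List.mem_of_mem_take h))
      have hsv : M₂.real 0 v = G.size v := by rw [hU.size, if_neg hvt]
      have h10 : M₂.nat 10 0 = v := by
        rw [hF₂.nat 10 (by decide), hF₁.nat 10 (by decide), hS.source]
      have h25 : M₂.nat 25 b = if G.graph.Adj v b then 1 else 0 := by
        rw [hF₂.nat 25 (by decide), hF₁.nat 25 (by decide), hS.out]
      have h4 : M₂.real 4 (M₂.nat 23 (i + 1)) = ∑ y ∈ I with G.graph.Adj y b, G.size y := by
        rw [hF₂.real 4 (by decide), hF₁.real 4 (by decide), hF₂.nat 23 (by decide),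
          hF₁.nat 23 (by decide), hS.release i hil]
        simp only [hbl]
      simp only [hFl.nat 34 (by decide), hFl.nat 25 (by decide), hFl.real 5 (by decide),
        hFl.real 0 (by decide), hFl.real 4 (by decide), hFl.nat 23 (by decide),
        hFl.nat 13 (by decide), hFl.nat 10 (by decide), hFl.real 1 (by decide), hx, hsb, hsb', h10,
        hsv, h25, h4, hU.acc] at e1 e2 e3 e4
      have hacc : ∑ x ∈ (l.take i).toFinset, gain G.graph.Adj G.size I x + G.size b -
          ∑ y ∈ I with G.graph.Adj y b, G.size y =
          ∑ x ∈ (l.take (i + 1)).toFinset, gain G.graph.Adj G.size I x := by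
        rw [htake, Finset.sum_insert (by simpa using hbt), gain]; ring
      have hcard : ((l.take (i + 1)).toFinset.filter fun u => G.graph.Adj v u).card =
          ((l.take i).toFinset.filter fun u => G.graph.Adj v u).card +
            if G.graph.Adj v b then 1 else 0 := by
        rw [htake, Finset.filter_insert]
        split_ifs
        · rw [Finset.card_insert_of_notMem (by simp [hbt])]
        · rfl
      have hle : ((l.take (i + 1)).toFinset.filter fun u => G.graph.Adj v u).card ≤
          (Finset.univ.filter fun u => G.graph.Adj v u).card :=
        Finset.card_le_card (Finset.filter_subset_filter _ (Finset.subset_univ _))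
      have hrem := hU.rem
      set r := M₂.nat 34 0 - if (if G.graph.Adj v b then 1 else 0) = 1 then 1 else 0 with hr
      have hr' : r + ((l.take (i + 1)).toFinset.filter fun u => G.graph.Adj v u).card =
          (Finset.univ.filter fun u => G.graph.Adj v u).card := by
        by_cases h : G.graph.Adj v b
        · simp only [h, if_true] at hr hcard
          omega
        · simp only [h, if_false] at hr hcard
          simp at hr
          omega
      -- By `hr'`, the remaining count is zero iff the executed out-neighbours of `v` are all of
      -- them.
      have hrz : r = 0 ↔ ¬ ∃ w, G.graph.Adj v w ∧ w ∉ l.take (i + 1) := by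
        constructor
        · rintro h ⟨w, hvw, hw⟩
          have h1 := Finset.eq_of_subset_of_card_le (Finset.filter_subset_filter
            (fun u => G.graph.Adj v u) (Finset.subset_univ (l.take (i + 1)).toFinset)) (by omega)
          have h2 : w ∈ Finset.univ.filter fun u => G.graph.Adj v u := by simpa using hvw
          rw [← h1, Finset.mem_filter, List.mem_toFinset] at h2
          exact hw h2.1
        · intro h
          push Not at h
          have h1 : (Finset.univ.filter fun u => G.graph.Adj v u) ⊆
              (l.take (i + 1)).toFinset.filter fun u => G.graph.Adj v u := by
            intro w hw
            simp only [Finset.mem_filter, Finset.mem_univ, true_and] at hw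
            exact Finset.mem_filter.2 ⟨List.mem_toFinset.2 (h w hw), hw⟩
          have := Finset.card_le_card h1
          omega
      have hT : (if r = 0 then ∑ x ∈ (l.take (i + 1)).toFinset, gain G.graph.Adj G.size I x
          else ∑ x ∈ (l.take (i + 1)).toFinset, gain G.graph.Adj G.size I x + G.size v) =
          G.relinkSize v I l b := by
        rw [hbl, G.relinkSize_getElem hl hil, blockMem_eq hI
          (fun x hx => G.acyclic x (.single hx)) huniq hl]
        by_cases h : r = 0
        · rw [if_pos h, if_neg (hrz.1 h), add_zero]
        · rw [if_neg h, if_pos (by by_contra h'; exact h (hrz.2 h'))]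
      rw [hacc] at e2 e3 e4
      rw [hT] at e3 e4
      obtain ⟨n1, n2⟩ := hnext (weigh.effect (link.effect M₂)) (hFw.nat 4 (by decide))
      refine ⟨n1, n2, fun u => ?_, fun u => ?_, e2, by rw [e1, hr']⟩
      · rw [e3]
        by_cases hub : u = b
        · rw [if_pos (congrArg Fin.val hub), if_pos ((hmem u).2 (Or.inl hub)), hub]
        · rw [if_neg fun h => hub (Fin.ext h), hU.size]
          exact if_congr (by rw [hmem]; simp [hub]) rfl rfl
      · rw [e4]
        by_cases hub : u = b
        · rw [if_pos (congrArg Fin.val hub), if_pos ((hmem u).2 (Or.inl hub)), hub]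
        · rw [if_neg fun h => hub (Fin.ext h), hU.scratch]
          exact if_congr (by rw [hmem]; simp [hub]) rfl rfl
    -- The last round only links `p`; `l.take` no longer grows.
    · rw [Cmd.effect_ite_neg fun h => hil (hcond.1 h), Cmd.effect_skip]
      have htake : l.take (i + 1) = l.take i := by
        rw [List.take_of_length_le (by omega), List.take_of_length_le (by omega)]
      obtain ⟨n1, n2⟩ := hnext (link.effect M₂) rfl
      refine ⟨n1, n2, ?_, ?_, ?_, ?_⟩
      · rw [htake, hFl.real 0 (by decide)]; exact hU.size
      · rw [htake, hFl.real 1 (by decide)]; exact hU.scratch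
      · rw [htake, hFl.real 5 (by decide)]; exact hU.acc
      · rw [htake, hFl.nat 34 (by decide)]; exact hU.rem
  · rw [hF₁.nat 20 (by decide), hS.order]; simp; omega
  · intro M₂ _ h
    rw [hF₁.nat 20 (by decide), hS.order] at h
    exact h

end Step

end PeakMem

/-! ### Preparing the input of the solver -/

namespace PeakMem

open Relation

variable {n : ℕ} {es : List (Fin n × Fin n)} {M M' : Mem} {Adj₀ : Fin n → Fin n → Prop}
  {s t v p : Fin n} {P : Fin n → Prop}

namespace Step

-- Numbers from `2` on enumerate exactly the inner vertices, so sums over numbers, as accumulated by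
-- the program, become sums over `I`.
open Classical in
theorem sum_block {I : Finset (Fin n)} {l : List (Fin n)} (hn : (v :: p :: l).Nodup)
    (hl : ∀ x, x ∈ l ↔ x ∈ I) (B : Fin n → Prop) (size : Fin n → ℝ) :
    ∑ c ∈ Finset.univ.filter (fun c : Fin (v :: p :: l).length =>
      (2 ≤ (c : ℕ) ∧ (c : ℕ) < (v :: p :: l).length) ∧ B (v :: p :: l)[c]),
      size (v :: p :: l)[c] = ∑ y ∈ I with B y, size y := by
  have hinj : Function.Injective fun c : Fin (v :: p :: l).length => (v :: p :: l)[c] := by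
    intro c d h
    exact Fin.ext ((List.Nodup.getElem_inj_iff hn).1 h)
  rw [← Finset.sum_image (f := size) (g := fun c : Fin (v :: p :: l).length => (v :: p :: l)[c])
    fun x _ y _ h => hinj h]
  refine Finset.sum_congr ?_ fun _ _ => rfl
  ext y
  simp only [Finset.mem_image, Finset.mem_filter, Finset.mem_univ, true_and]
  constructor
  · rintro ⟨⟨c, hc⟩, ⟨⟨h1, -⟩, h2⟩, rfl⟩
    refine ⟨?_, h2⟩
    rcases c with _ | _ | c
    · simp at h1
    · simp at h1
    · simp only [Fin.getElem_fin, List.getElem_cons_succ]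
      exact (hl _).1 (List.getElem_mem _)
  · rintro ⟨hy, hB⟩
    obtain ⟨c, hc, rfl⟩ := List.getElem_of_mem ((hl y).2 hy)
    exact ⟨⟨c + 2, by simpa using hc⟩, ⟨⟨by simp, by simpa using hc⟩, hB⟩, rfl⟩

theorem run_finish {G : CompGraph (Fin n)} {I : Finset (Fin n)}
    {l : List (Fin n)} (hn : (v :: p :: l).Nodup) (hl : ∀ x, x ∈ l ↔ x ∈ I)
    {H : CompGraph (Fin (v :: p :: l).length)}
    (hH : IsBlockGraph G v p I H (fun c => (v :: p :: l)[c]) ⟨0, by simp⟩ ⟨1, by simp⟩)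
    (hH0 : H.scratch ⟨0, by simp⟩ = 0)
    {L : List (Fin (v :: p :: l).length × Fin (v :: p :: l).length)} (hv : M.nat 10 0 = v)
    (hp : M.nat 33 0 = p) (h25 : open Classical in M.nat 25 p = if G.graph.Adj v p then 1 else 0)
    (hsize : ∀ u : Fin n, M.real 0 u = G.size u) (hq : Enumerated (v :: p :: l) M)
    (hL : Listed L M) (hC : Copied G (v :: p :: l) (v :: p :: l).length M) :
    Run finish M 40 fun M' => Loaded H L M' ∧ Enumerated (v :: p :: l) M' := by
  classical
  have hrel : M.real 4 1 = H.size ⟨1, by simp⟩ := by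
    rw [hH.size_b]
    have h1 := sum_block hn hl (fun y => G.graph.Adj y p) G.size
    have h2 := hC.release 1 (by simp)
    rw [h2, ← h1]
    refine Finset.sum_congr ?_ fun _ _ => rfl
    ext c; simp
  refine Run.straight (by decide) (by decide) ⟨⟨?_, ?_, ?_, ?_, ?_, ?_⟩, ⟨?_, ?_, ?_⟩⟩
  · by_cases h : G.graph.Adj v p <;>
      simp [finish, Cmd.effect, BExp.eval, NExp.eval, hp, h25, h, hq.length]
  · by_cases h : G.graph.Adj v p <;>
      simp [finish, Cmd.effect, BExp.eval, NExp.eval, hp, h25, h, hL.length]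
  · intro i hi
    by_cases h : G.graph.Adj v p <;>
      simp [finish, Cmd.effect, BExp.eval, NExp.eval, hp, h25, h, hL.tail i hi]
  · intro i hi
    by_cases h : G.graph.Adj v p <;>
      simp [finish, Cmd.effect, BExp.eval, NExp.eval, hp, h25, h, hL.head i hi]
  · rintro ⟨c, hc⟩
    have hsc := hC.size c hc
    rcases c with _ | _ | c
    · rw [hH.size_a]
      have h0 : M.real 2 0 = 0 := by rw [hsc]; simp
      by_cases h : G.graph.Adj v p <;>
        simp [finish, Cmd.effect, BExp.eval, NExp.eval, RExp.eval, hp, hv, h25, h, h0, hsize]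
    · by_cases h : G.graph.Adj v p <;>
        simp [finish, Cmd.effect, BExp.eval, NExp.eval, RExp.eval, hp, hv, h25, h, hrel]
    · rw [if_pos ⟨by omega, hc⟩] at hsc
      rw [hH.size _ ((hl _).1 (by simp)), Fin.getElem_fin, ← hsc]
      by_cases h : G.graph.Adj v p <;>
        simp [finish, Cmd.effect, BExp.eval, NExp.eval, RExp.eval, hp, h25, h]
  · rintro ⟨c, hc⟩
    have hsc := hC.scratch c hc
    rcases c with _ | _ | c
    · have h0 : M.real 3 0 = 0 := by rw [hsc]; simp
      rw [show H.scratch ⟨0, hc⟩ = 0 from hH0, ← h0]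
      by_cases h : G.graph.Adj v p <;>
        simp [finish, Cmd.effect, BExp.eval, NExp.eval, RExp.eval, hp, h25, h]
    · rw [show H.scratch ⟨0 + 1, hc⟩ = -H.size ⟨1, by simp⟩ from hH.scratch_b, ← hrel]
      by_cases h : G.graph.Adj v p <;>
        simp [finish, Cmd.effect, BExp.eval, NExp.eval, RExp.eval, hp, h25, h]
    · rw [if_pos ⟨by omega, hc⟩] at hsc
      rw [hH.scratch _ ((hl _).1 (by simp)), Fin.getElem_fin, ← hsc]
      by_cases h : G.graph.Adj v p <;>
        simp [finish, Cmd.effect, BExp.eval, NExp.eval, RExp.eval, hp, h25, h]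
  · by_cases h : G.graph.Adj v p <;>
      simp [finish, Cmd.effect, BExp.eval, NExp.eval, hp, h25, h, hq.length]
  · intro i hi
    rw [← hq.get i hi]
    by_cases h : G.graph.Adj v p <;>
      simp [finish, Cmd.effect, BExp.eval, NExp.eval, hp, h25, h]
  · intro i hi
    have := hq.pos i hi
    by_cases h : G.graph.Adj v p <;>
      simpa [finish, Cmd.effect, BExp.eval, NExp.eval, hp, h25, h] using this

/-- Prepare the input for the solver. -/
def setup : Cmd := findMerge ;; enumerate ;; sourceEdges ;; innerEdges ;; finish

open Classical in
theorem run_setup {G : CompGraph (Fin n)} (hR : Reduced Adj₀ G.graph.Adj s t P) (hvt : v ≠ t)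
    (hv : ¬ P v) (hvP : ∀ w, G.graph.Adj v w → P w) (hes : es.Nodup)
    (hadj : ∀ w, (v, w) ∈ es ↔ G.graph.Adj v w) (hN : NextMem G.graph.Adj t P M)
    (hE : EdgeMem es M) (h10 : M.nat 10 0 = v) (hsize : ∀ u : Fin n, M.real 0 u = G.size u)
    (hscr : ∀ u : Fin n, M.real 1 u = G.scratch u) (hS : Scanned G.graph.Adj v es M)
    (h27 : M.nat 27 = fun _ => 0) (h28 : M.nat 28 = fun _ => 0) (h2 : M.real 2 = fun _ => 0)
    (h3 : M.real 3 = fun _ => 0) (h4 : M.real 4 = fun _ => 0) :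
    Run setup M (300 * (n + 1) + 60 * es.length) fun M' => ∃ p l, IsMerge G.graph.Adj v p ∧
      (v :: p :: l).Nodup ∧ (∀ x, x ∈ l ↔ x ∈ inner G.graph.Adj v) ∧
      ∃ (H : CompGraph (Fin (v :: p :: l).length))
        (L : List (Fin (v :: p :: l).length × Fin (v :: p :: l).length)),
        IsBlockGraph G v p (inner G.graph.Adj v) H (fun c => (v :: p :: l)[c]) ⟨0, by simp⟩
          ⟨1, by simp⟩ ∧ ListsEdges H.graph L ∧ Loaded H L M' ∧ Enumerated (v :: p :: l) M' ∧
        ∀ d (h : d < (v :: p :: l).length), M'.real 4 d =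
          ∑ y ∈ inner G.graph.Adj v with G.graph.Adj y (v :: p :: l)[d], G.size y := by
  classical
  have hac := G.acyclic
  have hex := hR.exists_adj v hvt
  obtain ⟨p, hp⟩ := hR.exists_merge hac hvt hvP
  have hI := hR.isBlock hac hvt hv hvP hp
  set I := inner G.graph.Adj v with hIdef
  have hIP : ∀ x ∈ I, P x := by
    intro x hx
    obtain ⟨⟨w, hw, hwx⟩, -⟩ := mem_inner.1 hx
    exact hR.closed_reach (hvP w hw) hwx
  have huniq : ∀ x ∈ I, ∀ y z, G.graph.Adj x y → G.graph.Adj x z → y = z :=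
    fun x hx y z => hR.unique x y z (hIP x hx)
  have hIv : ∀ x ∈ I, ∃ w, G.graph.Adj v w ∧ w ≠ x := by
    intro x hx
    obtain ⟨-, w, hw, hwx⟩ := mem_inner.1 hx
    exact ⟨w, hw, by rintro rfl; exact hwx .refl⟩
  -- The test used by `enumerate`: some but not all out-neighbours of `v` reach `u`.
  have hmemI : ∀ u, u ∈ I ↔ 0 < M.nat 24 u ∧ M.nat 24 u < M.nat 30 0 := by
    intro u
    rw [hS.cnt, hS.deg, countOut_pos, countOut_lt, hIdef, mem_inner]
    simp only [hadj]
  refine (Run.seq (run_findMerge hR hac hN hadj hvP hp hS hex) fun M₁ hF₁ h33 => ?_).mono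
    (K₁ := 20 * (n + 1) + (60 * (n + 1) + (60 * es.length + 9 + (100 * n + 9 + 40)))) (by omega)
    fun _ _ h => h
  have hE₁ := hE.frame hF₁ (by decide) (by decide) (by decide)
  refine Run.seq (run_enumerate (I := I) hE₁ (by rw [hF₁.nat 10 (by decide), h10]) h33 hI.ne
    hI.v_notMem hI.p_notMem (fun u => by
      rw [hF₁.nat 24 (by decide), hF₁.nat 30 (by decide), hmemI])
    (by rw [hF₁.nat 27 (by decide), h27])) fun M₂ hF₂ h => ?_
  obtain ⟨l, hn, hl, hq⟩ := h
  have hE₂ := hE₁.frame hF₂ (by decide) (by decide) (by decide)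
  have hlen : (v :: p :: l).length ≤ n := by
    have := hn.length_le_card
    rwa [Fintype.card_fin] at this
  have hmq : ∀ x, x ∈ v :: p :: l ↔ x = v ∨ x = p ∨ x ∈ I := by
    intro x; simp only [List.mem_cons, hl]
  refine Run.seq (run_sourceEdges hn hes hE₂
    (by rw [hF₂.nat 10 (by decide), hF₁.nat 10 (by decide), h10]) hq (by simp)
    (fun w hw => (hmq w).2 ?_)
    (by rw [hF₂.nat 28 (by decide), hF₁.nat 28 (by decide), h28])) fun M₃ hF₃ h => ?_
  · rcases hI.out_v w ((hadj w).1 hw) with h | h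
    exacts [Or.inr (Or.inr h), Or.inr (Or.inl h)]
  obtain ⟨L₀, hL₀, hLM₀, hm₀⟩ := h
  refine Run.seq ((run_innerEdges (G := G) (t := t) (P := P) hn
    (hq.frame hF₃ (by decide) (by decide) (by decide))
    (((hN.frame hF₁ (by decide)).frame hF₂ (by decide)).frame hF₃ (by decide)) ?_ ?_ ?_ ?_ ?_ ?_ hL₀
    hLM₀ ?_).mono (K := 100 * n + 9) (by omega) fun _ _ h => h) fun M₄ hF₄ h => ?_
  · intro c hc h2c
    rcases c with _ | _ | c
    · omega
    · omega
    · have hc' : c < l.length := by simpa using hc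
      simp only [List.getElem_cons_succ]
      have hxI : l[c] ∈ I := (hl _).1 (List.getElem_mem _)
      refine ⟨hIP _ hxI, ?_⟩
      obtain ⟨w, hw, -⟩ := TransGen.head'_iff.1 (hI.reach_p _ hxI)
      obtain ⟨d, hd, hdw⟩ := List.getElem_of_mem ((hmq w).2 (by
        rcases hI.out_mem _ hxI w hw with h | h
        exacts [Or.inr (Or.inr h), Or.inr (Or.inl h)]))
      refine ⟨d, hd, fun w' => ?_⟩
      rw [hdw]
      exact ⟨fun h => huniq _ hxI _ _ h hw, by rintro rfl; exact hw⟩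
  · intro u
    rw [hF₃.real 0 (by decide), hF₂.real 0 (by decide), hF₁.real 0 (by decide), hsize]
  · intro u
    rw [hF₃.real 1 (by decide), hF₂.real 1 (by decide), hF₁.real 1 (by decide), hscr]
  · rw [hF₃.real 2 (by decide), hF₂.real 2 (by decide), hF₁.real 2 (by decide), h2]
  · rw [hF₃.real 3 (by decide), hF₂.real 3 (by decide), hF₁.real 3 (by decide), h3]
  · rw [hF₃.real 4 (by decide), hF₂.real 4 (by decide), hF₁.real 4 (by decide), h4]
  · intro c d h
    rw [((hm₀ c d).1 h).1]; simp
  obtain ⟨hC, L, hL, hLM, hm⟩ := h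
  have hinj : Function.Injective fun c : Fin (v :: p :: l).length => (v :: p :: l)[c] := by
    intro c d h
    exact Fin.ext ((List.Nodup.getElem_inj_iff hn).1 h)
  obtain ⟨H, hH, hH0⟩ := exists_blockGraph G hI huniq hIv hinj (a := ⟨0, by simp⟩)
    (b := ⟨1, by simp⟩) rfl rfl (fun x hx => by
      obtain ⟨c, hc, hcx⟩ := List.getElem_of_mem ((hmq x).2 (Or.inr (Or.inr hx)))
      exact ⟨⟨c, hc⟩, hcx⟩) (by
      rintro ⟨c, hc⟩ h0 h1
      rcases c with _ | _ | c
      · exact absurd rfl h0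
      · exact absurd rfl h1
      · exact (hl _).1 (by simp))
  refine (run_finish hn hl hH hH0 ?_ ?_ ?_ ?_
    ((hq.frame hF₃ (by decide) (by decide) (by decide)).frame hF₄ (by decide) (by decide)
      (by decide)) hLM hC).mono le_rfl fun M₅ hF₅ h => ?_
  · rw [hF₄.nat 10 (by decide), hF₃.nat 10 (by decide), hF₂.nat 10 (by decide),
      hF₁.nat 10 (by decide), h10]
  · rw [hF₄.nat 33 (by decide), hF₃.nat 33 (by decide), hF₂.nat 33 (by decide), h33]
  · rw [hF₄.nat 25 (by decide), hF₃.nat 25 (by decide), hF₂.nat 25 (by decide),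
      hF₁.nat 25 (by decide), hS.out]
    simp only [hadj]
  · intro u
    rw [hF₄.real 0 (by decide), hF₃.real 0 (by decide), hF₂.real 0 (by decide),
      hF₁.real 0 (by decide), hsize]
  · refine ⟨p, l, hp, hn, hl, H, L, hH, ⟨hL, fun c d => ?_⟩, h.1, h.2, ?_⟩
    · rw [hm, hm₀, hadj, hH.adj]
      constructor
      · rintro (⟨rfl, h⟩ | h)
        exacts [h, h.2]
      · intro h
        obtain ⟨c, hc⟩ := c
        rcases c with _ | _ | c
        · exact Or.inl ⟨rfl, h⟩
        -- No edge leaves `p` inside the block, since it would close a cycle; so the listed edges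
        -- are complete.
        · exfalso
          have h' : G.graph.Adj p (v :: p :: l)[d] := h
          rcases (hmq _).1 (List.getElem_mem d.2) with hd | hd | hd
          · rw [Fin.getElem_fin, hd] at h'; exact hac v (hI.reach.tail h')
          · rw [Fin.getElem_fin, hd] at h'; exact hac p (.single h')
          · exact hac p (TransGen.head h' (hI.reach_p _ hd))
        · exact Or.inr ⟨by simp, h⟩
    · intro d hd
      rw [hF₅.real 4 (by decide), hC.release d hd,
        ← sum_block hn hl (fun y => G.graph.Adj y (v :: p :: l)[d]) G.size]

end Step

end PeakMem

/-! ### Processing one vertex -/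

namespace PeakMem

open Relation

theorem Reduced.insert_sink {V : Type*} {Adj₀ Adj : V → V → Prop} {s t : V} {P : V → Prop}
    (hR : Reduced Adj₀ Adj s t P) : Reduced Adj₀ Adj s t fun x => P x ∨ x = t where
  adj_iff v hv := hR.adj_iff v fun h => hv (Or.inl h)
  closed := by
    rintro v w (hv | rfl) hw
    exacts [Or.inl (hR.closed v w hv hw), absurd hw (hR.not_adj_sink w)]
  unique := by
    rintro v w w' (hv | rfl) hw hw'
    exacts [hR.unique v w w' hv hw hw', absurd hw (hR.not_adj_sink w)]
  not_adj_sink := hR.not_adj_sink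
  exists_adj := hR.exists_adj
  source := hR.source
  sp v hv := hR.sp v fun h => hv (Or.inl h)

theorem Dom.refl : ∀ {X : List ℝ}, X ≠ [] → Dom X X
  | [], h => absurd rfl h
  | [_], _ => .single le_rfl
  | a :: b :: X, _ => by
    have ih := Dom.refl (List.cons_ne_nil b X)
    rcases le_total a b with h | h
    · exact .right le_rfl (.left h ih)
    · exact .left le_rfl (.right h ih)

theorem CompGraph.Refines.refl {V : Type*} [Fintype V] [Nonempty V] (G : CompGraph V) :
    Refines G G := by
  refine ⟨fun _ h => ⟨h, rfl, rfl⟩, fun τ h => ⟨τ, h, .refl (List.cons_ne_nil _ _), .refl ?_⟩⟩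
  have hτ : τ ≠ [] := List.ne_nil_of_mem (h.complete (Classical.arbitrary V))
  rw [internalProfile, List.getLast?_eq_some_getLast hτ]
  simp

/-- The out-degree of a star is determined by its source. -/
theorem IsStar.maxOutDegree_le {W : Type*} [Fintype W] {D : Digraph W} {a b : W} {d : ℕ}
    (h : IsStar D.Adj a b) (hd : {w | D.Adj a w}.ncard ≤ d) (h1 : 1 ≤ d) : maxOutDegree D ≤ d := by
  refine Finset.sup_le fun x _ => ?_
  by_cases hx : x = a
  · rw [hx]; exact hd
  · refine le_trans ?_ h1
    rw [Set.ncard_le_one_iff]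
    intro y z hy hz
    exact h.unique x y z hx hy hz

/-- A star has few edges. -/
theorem IsStar.length_le {k : ℕ} {D : Digraph (Fin k)} {a b : Fin k} (h : IsStar D.Adj a b)
    {L : List (Fin k × Fin k)} (hL : ListsEdges D L) : L.length ≤ 2 * k := by
  classical
  rw [← List.toFinset_card_of_nodup hL.1]
  have hsub : L.toFinset ⊆ (Finset.univ.image fun d => (a, d)) ∪
      L.toFinset.filter fun e => e.1 ≠ a := by
    rintro ⟨c, d⟩ h
    by_cases hc : c = a
    · exact Finset.mem_union_left _ (Finset.mem_image.2 ⟨d, Finset.mem_univ _, by rw [hc]⟩)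
    · exact Finset.mem_union_right _ (Finset.mem_filter.2 ⟨h, hc⟩)
  have h1 : (Finset.univ.image fun d : Fin k => (a, d)).card ≤ k :=
    Finset.card_image_le.trans (by simp)
  have h2 : (L.toFinset.filter fun e => e.1 ≠ a).card ≤ k := by
    refine (Finset.card_le_card_of_injOn (t := Finset.univ) Prod.fst (fun _ _ => by simp) ?_).trans
      (by simp)
    rintro ⟨c, d⟩ hc ⟨c', d'⟩ hc' rfl
    simp only [Finset.coe_filter, List.mem_toFinset, Set.mem_ofPred_eq] at hc hc'
    rw [h.unique c d d' hc.2 ((hL.2 _ _).1 hc.1) ((hL.2 _ _).1 hc'.1)]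
  have h3 := Finset.card_le_card hsub
  have h4 := Finset.card_union_le (Finset.univ.image fun d : Fin k => (a, d))
    (L.toFinset.filter fun e => e.1 ≠ a)
  omega

variable {n : ℕ} {es : List (Fin n × Fin n)} {M M' : Mem} {Adj₀ : Fin n → Fin n → Prop}
  {s t v p : Fin n} {P : Fin n → Prop}

/-- The current graph `G`, in which the vertices in `P` have been processed, is stored. -/
structure GraphMem (G : CompGraph (Fin n)) (t : Fin n) (P : Fin n → Prop) (M : Mem) : Prop where
  next : NextMem G.graph.Adj t P M
  size : ∀ u : Fin n, M.real 0 u = G.size u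
  scratch : ∀ u : Fin n, M.real 1 u = G.scratch u

namespace Step

/-- Replace the block behind the vertex in `10` by a path. -/
def prog (A : Cmd) : Cmd :=
  scan ;; .ite (.natLt (.const 0) (.var 30)) (setup ;; solve A ;; update) .skip

/-- Combines the algorithmic and the mathematical side. The block is a starborescence, so the given
algorithm returns a dominant schedule of it; `IsBlockGraph.isBest` makes this a best order, and
`CompGraph.exists_relink` produces the refined graph, whose edges and weights are those written by
`update`. The call costs at most `f n d` by monotonicity. -/
theorem run_block {A : Cmd} {f : ℕ → ℕ → ℕ} (hf : ∀ n n' d d' : ℕ, n ≤ n' → d ≤ d' → f n d ≤ f n' d')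
    (hA : FindsDominant (fun _ D => IsStarborescence D) A f) {G : CompGraph (Fin n)}
    (hR : Reduced Adj₀ G.graph.Adj s t P) (hvt : v ≠ t) (hv : ¬ P v)
    (hvP : ∀ w, G.graph.Adj v w → P w) (hes : es.Nodup)
    (hadj : ∀ w, (v, w) ∈ es ↔ G.graph.Adj v w) (hG : GraphMem G t P M)
    (hE : EdgeMem es M) (h10 : M.nat 10 0 = v) (hS : Scanned G.graph.Adj v es M)
    (h27 : M.nat 27 = fun _ => 0) (h28 : M.nat 28 = fun _ => 0)
    (hr : ∀ a, 2 ≤ a → M.real a = fun _ => 0) {d : ℕ} (hd : {w | G.graph.Adj v w}.ncard ≤ d) :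
    Run (setup ;; solve A ;; update) M (f n d + 600 * (n + 1) + 60 * es.length) fun M' =>
      ∃ G' : CompGraph (Fin n), CompGraph.Refines G G' ∧
        Reduced Adj₀ G'.graph.Adj s t (fun x => P x ∨ x = v) ∧
        GraphMem G' t (fun x => P x ∨ x = v) M' := by
  classical
  have hac := G.acyclic
  refine (Run.seq (run_setup hR hvt hv hvP hes hadj hG.next hE h10 hG.size hG.scratch hS h27 h28
    (hr 2 (by decide)) (hr 3 (by decide)) (hr 4 (by decide))) fun M₁ hF₁ h => ?_).mono
    (K₁ := 300 * (n + 1) + 60 * es.length + (f n d + 7 * n + 30 + 170 * (n + 1))) (by omega)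
    fun _ _ h => h
  obtain ⟨p, q, hp, hn, hq, H, L, hH, hL, hload, henum, hrel⟩ := h
  have hI := hR.isBlock hac hvt hv hvP hp
  have hstar := hR.isStar (D := H.graph) hac hvt hv hvP hp hH.inj hH.map_a hH.map_b
    (fun x => ⟨?_, ?_⟩) hH.adj
  rotate_left
  · rintro ⟨c, rfl⟩
    by_cases h0 : c = ⟨0, by simp⟩
    · exact Or.inl (by rw [h0]; rfl)
    by_cases h1 : c = ⟨1, by simp⟩
    · exact Or.inr (Or.inl (by rw [h1]; rfl))
    · exact Or.inr (Or.inr (hH.mem c h0 h1))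
  · rintro (rfl | rfl | h)
    exacts [⟨_, hH.map_a⟩, ⟨_, hH.map_b⟩, hH.range _ h]
  set I := inner G.graph.Adj v with hIdef
  have hIP : ∀ x ∈ I, P x := by
    intro x hx
    obtain ⟨⟨w, hw, hwx⟩, -⟩ := mem_inner.1 hx
    exact hR.closed_reach (hvP w hw) hwx
  have huniq : ∀ x ∈ I, ∀ y z, G.graph.Adj x y → G.graph.Adj x z → y = z :=
    fun x hx y z => hR.unique x y z (hIP x hx)
  have hlen : (v :: p :: q).length ≤ n := by
    have := hn.length_le_card
    rwa [Fintype.card_fin] at this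
  have hLlen := hstar.1.length_le hL
  have hdeg1 : 1 ≤ {w | G.graph.Adj v w}.ncard := by
    obtain ⟨w, hw⟩ := hR.exists_adj v hvt
    exact (Set.ncard_pos (Set.toFinite _)).2 ⟨w, hw⟩
  -- In a star only the source can have more than one out-neighbour, and those of the source inject
  -- into the out-neighbours of `v`. The vertex `v` is not the sink, so `1 ≤ d`.
  have hdH : maxOutDegree H.graph ≤ d := by
    refine hstar.1.maxOutDegree_le (le_trans ?_ hd) (hdeg1.trans hd)
    refine Set.ncard_le_ncard_of_injOn (fun c => (v :: p :: q)[c]) (fun c hc => ?_)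
      (fun c _ c' _ h => hH.inj h) (Set.toFinite _)
    exact (hH.adj _ _).1 hc
  obtain ⟨k, M', σ, h1, h2, h3, h4⟩ := hA _ H L (hstar.1.isStarborescence hstar.2) hL
  refine Run.seq ((run_solve hload ⟨k, M', σ, h1, h2.trans (hf _ _ _ _ hlen hdH), h3, h4⟩).mono
    (K := f n d + 7 * n + 30) (by omega) fun _ _ h => h) fun M₂ hF₂ h => ?_
  have hF₂ : Frame [23] [] M₁ M₂ := hF₂
  obtain ⟨σ, hσ, h23⟩ := h
  obtain ⟨m, hm, hl, hbest⟩ := hH.isBest hI hσ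
  set e := fun c : Fin (v :: p :: q).length => (v :: p :: q)[c] with he
  have hπ : σ.map e = v :: (m.map e ++ [p]) := by
    rw [hm]; simp [he]
  have hml : (m.map e).length + 2 = (v :: p :: q).length := by
    have e1 := hl.length
    have e2 : q.length = I.card := by
      have hqn : q.Nodup := (List.nodup_cons.1 (List.nodup_cons.1 hn).2).2
      rw [← List.toFinset_card_of_nodup hqn]
      congr 1
      ext x; rw [List.mem_toFinset, hq]
    rw [e1, ← e2]; rfl
  have hsolved : Solved G v p I (m.map e) M₂ := by
    refine ⟨?_, ?_, ?_, ?_, ?_, ?_, ?_, ?_, ?_⟩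
    · rw [hF₂.nat 20 (by decide), henum.length, hml]
    · intro j u hj
      rw [← hπ, List.getElem?_map] at hj
      obtain ⟨c, hc, rfl⟩ := Option.map_eq_some_iff.1 hj
      obtain ⟨hjσ, rfl⟩ := List.getElem?_eq_some_iff.1 hc
      rw [h23 j hjσ, hF₂.nat 26 (by decide), henum.get _ σ[j].2]
      rfl
    · intro j hj
      have hjm : j < m.length := by simpa using hj
      have hjσ : j + 1 < σ.length := by rw [hm]; simp; omega
      have hσj : σ[j + 1] = m[j] := by simp only [hm]; simp [hjm]
      rw [h23 (j + 1) hjσ, hF₂.real 4 (by decide), hrel _ σ[j + 1].2]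
      simp only [List.getElem_map, hσj]
      rfl
    · intro u
      rw [hF₂.nat 25 (by decide), show M₁.nat 25 = M.nat 25 from hF₁.nat 25 (by decide), hS.out]
      simp only [hadj]
    · rw [hF₂.nat 30 (by decide), show M₁.nat 30 = M.nat 30 from hF₁.nat 30 (by decide), hS.deg,
        countOut_eq_card hes, ← Set.ncard_coe_finset]
      congr 1
      ext w; simp [hadj]
    · rw [hF₂.nat 10 (by decide), hF₁.nat 10 (by decide), h10]
    · intro u
      rw [hF₂.real 0 (by decide), hF₁.real 0 (by decide), hG.size]
    · intro u
      rw [hF₂.real 1 (by decide), hF₁.real 1 (by decide), hG.scratch]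
    · rw [hF₂.real 5 (by decide), hF₁.real 5 (by decide), hr 5 (by decide)]
  refine (run_update hI huniq hl hsolved).mono (by omega) fun M₃ hF₃ hU => ?_
  obtain ⟨G', hG1, hG2, hG3, hG4⟩ := G.exists_relink hI hl hbest
  have htake : (m.map e).take ((m.map e).length + 1) = m.map e := List.take_of_length_le (by omega)
  have h4M : M₂.nat 4 = M.nat 4 := by rw [hF₂.nat 4 (by decide), hF₁.nat 4 (by decide)]
  refine ⟨G', hG4, ?_, ⟨⟨?_, ?_⟩, ?_, ?_⟩⟩
  · rw [hG1]; exact hR.relink hac hvt hv hvP hI hl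
  · intro u w hu huw
    rw [hG1] at huw
    by_cases huI : u ∈ I ∨ u = v
    · rw [relink_of_mem huI] at huw
      obtain ⟨i, hi, hi'⟩ := huw
      have : i + 1 < (v :: (m.map e ++ [p])).length := (List.getElem?_eq_some_iff.1 hi').1
      refine hU.next i u w ?_ hi hi'
      simp only [List.length_cons, List.length_append, List.length_nil] at this
      omega
    · rw [not_or] at huI
      rw [relink_of_notMem hI hl huI.1 huI.2] at huw
      rw [hU.same u huI.2 huI.1, h4M]
      exact hG.next.next u w (hu.resolve_right huI.2) huw
  · have htI : t ∉ I := by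
      intro h
      obtain ⟨z, hz, -⟩ := TransGen.head'_iff.1 (hI.reach_p t h)
      exact hR.not_adj_sink z hz
    rw [hU.same t hvt.symm htI, h4M, hG.next.sink]
  · intro u
    rw [hU.size, htake, hG2]
    split_ifs with h
    · rfl
    · rw [CompGraph.relinkSize, if_neg fun h' => h ((hl.mem_iff u).2 h')]
  · intro u
    rw [hU.scratch, htake, hG3]
    split_ifs with h
    · rfl
    · simp only
      rw [CompGraph.relinkSize, if_neg fun h' => h ((hl.mem_iff u).2 h')]
      ring

/-- Out-degree zero identifies the sink, which needs no change and is merely declared processed. A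
vertex with a single out-neighbour needs no separate case: its block has no inner vertices. -/
theorem run_prog {A : Cmd} {f : ℕ → ℕ → ℕ} (hf : ∀ n n' d d' : ℕ, n ≤ n' → d ≤ d' → f n d ≤ f n' d')
    (hA : FindsDominant (fun _ D => IsStarborescence D) A f) {G : CompGraph (Fin n)}
    (hR : Reduced Adj₀ G.graph.Adj s t P) (hv : ¬ P v)
    (hvP : ∀ w, G.graph.Adj v w → P w) (hes : es.Nodup)
    (hadj : ∀ w, (v, w) ∈ es ↔ G.graph.Adj v w) (hG : GraphMem G t P M)
    (hE : EdgeMem es M) (h10 : M.nat 10 0 = v) (hn : ∀ a, 20 ≤ a → M.nat a = fun _ => 0)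
    (hr : ∀ a, 2 ≤ a → M.real a = fun _ => 0) {d : ℕ} (hd : {w | G.graph.Adj v w}.ncard ≤ d) :
    Run (prog A) M (f n d + 620 * (n + 1) + 120 * es.length +
        24 * (n + 1) * countOut es v (fun _ => True)) fun M' =>
      ∃ G' : CompGraph (Fin n), CompGraph.Refines G G' ∧
        Reduced Adj₀ G'.graph.Adj s t (fun x => P x ∨ x = v) ∧
        GraphMem G' t (fun x => P x ∨ x = v) M' := by
  refine (Run.seq (run_scan hR G.acyclic hG.next hE h10 (fun w hw => hvP w ((hadj w).1 hw))
    (hn 24 (by decide)) (hn 25 (by decide)) (by rw [hn 30 (by decide)])) fun M₁ hF₁ hS =>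
    Run.ite (K := f n d + 600 * (n + 1) + 60 * es.length) ?_ ?_).mono ?_ fun _ _ h => h
  · intro hb
    have hvt : v ≠ t := by
      rintro rfl
      simp only [BExp.eval, NExp.eval, hS.deg, countOut_pos, hadj] at hb
      obtain ⟨w, hw, -⟩ := hb
      exact hR.not_adj_sink w hw
    refine run_block hf hA hR hvt hv hvP hes hadj ⟨hG.next.frame hF₁ (by decide), fun u => ?_,
      fun u => ?_⟩ (hE.frame hF₁ (by decide) (by decide) (by decide)) ?_ hS ?_ ?_ ?_ hd
    · rw [hF₁.real 0 (by decide), hG.size]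
    · rw [hF₁.real 1 (by decide), hG.scratch]
    · rw [hF₁.nat 10 (by decide), h10]
    · rw [hF₁.nat 27 (by decide), hn 27 (by decide)]
    · rw [hF₁.nat 28 (by decide), hn 28 (by decide)]
    · intro a ha
      rw [hF₁.real a (by simp [scan, scanEdge, Cmd.for, Cmd.realWrites, visit, walk]), hr a ha]
  · intro hb
    have hvt : v = t := by
      by_contra hvt
      obtain ⟨w, hw⟩ := hR.exists_adj v hvt
      refine hb ?_
      simp only [BExp.eval, NExp.eval, hS.deg, countOut_pos]
      exact ⟨w, (hadj w).2 hw, trivial⟩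
    refine Run.straight (by decide) (by simp [Cmd.bound]; omega) ⟨G, ?_, ?_, ⟨⟨?_, ?_⟩, ?_, ?_⟩⟩
    · have : Nonempty (Fin n) := ⟨v⟩
      exact .refl G
    · rw [hvt]; exact hR.insert_sink
    · rintro u w (hu | rfl) huw
      · exact (hG.next.frame hF₁ (by decide)).next u w hu huw
      · rw [hvt] at huw; exact absurd huw (hR.not_adj_sink w)
    · exact (hG.next.frame hF₁ (by decide)).sink
    · intro u
      rw [Cmd.effect_skip, hF₁.real 0 (by decide), hG.size]
    · intro u
      rw [Cmd.effect_skip, hF₁.real 1 (by decide), hG.scratch]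
  · simp only [BExp.cost, NExp.cost]; omega

end Step

end PeakMem

/-! ### The algorithm for series-parallel graphs and its running time -/

namespace PeakMem

open Relation

theorem Run.call {body : Cmd} {natIn realIn natOut realOut : List Transfer} {M : Mem} {K K' : ℕ}
    {Q Q' : Mem → Prop}
    (h : Run body (copyReal M M realIn (copyNat M M natIn Mem.zero)) K Q)
    (hK : 1 + copyCost M natIn + copyCost M realIn + copyCost M natOut + copyCost M realOut ≤ K')
    (hQ : ∀ M', Q M' → Q' (copyReal M M' realOut (copyNat M M' natOut M))) :
    Run (.call body natIn realIn natOut realOut) M (K + K') Q' := by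
  obtain ⟨k, M', h1, h2, h3⟩ := h
  exact ⟨_, _, .call body natIn realIn natOut realOut M M' k h1, by omega, hQ M' h3⟩

theorem sum_range_getElem {α : Type*} [Fintype α] [DecidableEq α] {L : List α} (hn : L.Nodup)
    (hL : ∀ x, x ∈ L) (g : α → ℕ) :
    ∑ i ∈ Finset.range L.length, (L[i]?.elim 0 g) = ∑ x, g x := by
  rw [Finset.sum_range, ← (List.Nodup.getEquivOfForallMemList L hn hL).sum_comp]
  refine Finset.sum_congr rfl fun i _ => ?_
  simp

variable {n : ℕ} {es : List (Fin n × Fin n)} {M M' : Mem}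

/-- In a graph on `n` vertices in which all vertices can be reached from `s`, a closed enumeration
ends with `s`. -/
theorem TopoSort.Closed.getElem_last {L : List (Fin n)} (hL : TopoSort.Closed es L)
    (hlen : L.length = n) {s : Fin n} (hs : ∀ x, ReflTransGen (fun a b => (a, b) ∈ es) s x)
    (h : n - 1 < L.length) : L[n - 1] = s := by
  have hmem : ∀ x, x ∈ L := by
    intro x
    have : L.toFinset = Finset.univ := by
      rw [← Finset.card_eq_iff_eq_univ, List.toFinset_card_of_nodup hL.nodup, hlen,
        Fintype.card_fin]
    rw [← List.mem_toFinset, this]; simp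
  obtain ⟨j, hj, hjs⟩ := List.getElem_of_mem (hmem s)
  have key : ∀ x, ReflTransGen (fun a b => (a, b) ∈ es) s x → x ∈ L.take (j + 1) := by
    intro x hx
    induction hx with
    | refl => exact List.mem_take_iff_getElem.2 ⟨j, by omega, hjs⟩
    | @tail b c _ hbc ih =>
      obtain ⟨i, hi, rfl⟩ := List.mem_take_iff_getElem.1 ih
      exact List.take_subset_take_left L (by omega) (hL.mem_take i (by omega) c hbc)
  obtain ⟨i, hi, hie⟩ := List.mem_take_iff_getElem.1 (key L[n - 1] (hs _))
  have := (List.Nodup.getElem_inj_iff hL.nodup).1 hie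
  subst this
  rw [← hjs]
  congr 1
  omega

/-- Process the vertex with number `15`. -/
def process (A : Cmd) : Cmd :=
  .setNat 10 (.const 0) (.get 5 (.var 15)) ;;
  .call (Step.prog A) [⟨0, 0, .const 2⟩, ⟨1, 1, .get 0 (.const 1)⟩, ⟨2, 2, .get 0 (.const 1)⟩,
    ⟨4, 4, .var 0⟩, ⟨10, 10, .const 1⟩] [⟨0, 0, .var 0⟩, ⟨1, 1, .var 0⟩] [⟨4, 4, .var 0⟩]
    [⟨0, 0, .var 0⟩, ⟨1, 1, .var 0⟩]

/-- Follow the path that starts at the last vertex of the enumeration. -/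
def output : Cmd :=
  .setNat 16 (.const 0) (.get 5 (.sub (.var 0) (.const 1))) ;;
  .for 15 0 0 (.setNat 3 (.var 15) (.var 16) ;;
    .setNat 16 (.const 0) (.sub (.get 4 (.var 16)) (.const 1)))

/-- The algorithm for series-parallel graphs, given an algorithm `A` for starborescences. -/
def schedule (A : Cmd) : Cmd := TopoSort.prog ;; .for 15 0 0 (process A) ;; output

/-- The call starts with all working arrays zero, so no counter or mark has to be cleared between
vertices; only successors and weights are copied back. As `v` is unprocessed, its edges are still
those of the original list `es`, which also bounds its out-degree by the original maximum. -/
theorem run_process {A : Cmd} {f : ℕ → ℕ → ℕ} (hf : ∀ n n' d d' : ℕ, n ≤ n' → d ≤ d' → f n d ≤ f n' d')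
    (hA : FindsDominant (fun _ D => IsStarborescence D) A f) {G₀ G : CompGraph (Fin n)}
    {s t v : Fin n} {P : Fin n → Prop} (hR : Reduced G₀.graph.Adj G.graph.Adj s t P) (hv : ¬ P v)
    (hvP : ∀ w, (v, w) ∈ es → P w) (hes : ListsEdges G₀.graph es) (hG : GraphMem G t P M)
    (hE : EdgeMem es M) (h5 : M.nat 5 (M.nat 15 0) = v) :
    Run (process A) M (f n (maxOutDegree G₀.graph) + 700 * (n + 1) + 130 * es.length +
        24 * (n + 1) * countOut es v (fun _ => True)) fun M' =>
      ∃ G' : CompGraph (Fin n), CompGraph.Refines G G' ∧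
        Reduced G₀.graph.Adj G'.graph.Adj s t (fun x => P x ∨ x = v) ∧
        GraphMem G' t (fun x => P x ∨ x = v) M' := by
  have hadj : ∀ w, (v, w) ∈ es ↔ G.graph.Adj v w := fun w => by
    rw [hes.2, hR.adj_iff v hv]
  refine (Run.seq (K₁ := 10) (Q := fun M' => M'.nat 10 0 = v) (Run.straight (by decide) (by decide)
    (by simp [Cmd.effect, NExp.eval, h5])) fun M₁ hF₁ h10 =>
    Run.call (K' := 7 * n + 2 * es.length + 60) (Step.run_prog (es := es) hf hA hR hv
      (fun w hw => hvP w ((hadj w).2 hw)) hes.1 hadj (d := maxOutDegree G₀.graph) ⟨⟨?_, ?_⟩, ?_, ?_⟩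
      ⟨?_, ?_, ?_, ?_⟩ ?_ ?_ ?_ ?_) ?_ ?_).mono (by omega) fun _ _ h => h
  all_goals
    have hE₁ := hE.frame hF₁ (by decide) (by decide) (by decide)
    have h0 := hE₁.size
  · intro u w hu huw
    simp [copyNat, copyReal_nat, NExp.eval, h0, hF₁.nat 4 (by decide), hG.next.next u w hu huw]
  · simp [copyNat, copyReal_nat, NExp.eval, h0, hF₁.nat 4 (by decide), hG.next.sink]
  · intro u
    simp [copyReal, NExp.eval, h0, hF₁.real 0 (by decide), hG.size]
  · intro u
    simp [copyReal, NExp.eval, h0, hF₁.real 1 (by decide), hG.scratch]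
  · simp [copyNat, copyReal_nat, NExp.eval, h0]
  · simp [copyNat, copyReal_nat, NExp.eval, hE₁.length]
  · intro i hi
    simp [copyNat, copyReal_nat, NExp.eval, hE₁.length, hi, hE₁.tail i hi]
  · intro i hi
    simp [copyNat, copyReal_nat, NExp.eval, hE₁.length, hi, hE₁.head i hi]
  · simp [copyNat, copyReal_nat, NExp.eval, h10]
  · intro a ha
    rw [copyReal_nat, copyNat_of_notMem]
    · rfl
    · simp; omega
  · intro a ha
    rw [copyReal_of_notMem, copyNat_real]
    · rfl
    · simp; omega
  · rw [show {w | G.graph.Adj v w} = {w | G₀.graph.Adj v w} by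
      ext w; exact hR.adj_iff v hv w]
    exact Finset.le_sup (f := fun v => Set.ncard {w | G₀.graph.Adj v w}) (Finset.mem_univ v)
  · simp only [copyCost, List.map_cons, List.map_nil, List.sum_cons, List.sum_nil, NExp.cost,
      NExp.eval, h0, hE₁.length]
    omega
  · rintro M₂ ⟨G', h1, h2, h3⟩
    refine ⟨G', h1, h2, ⟨fun u w hu huw => ?_, ?_⟩, fun u => ?_, fun u => ?_⟩
    · simp [copyNat, copyReal_nat, NExp.eval, h0, h3.next.next u w hu huw]
    · simp [copyNat, copyReal_nat, NExp.eval, h0, h3.next.sink]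
    · simp [copyReal, NExp.eval, h0, h3.size]
    · simp [copyReal, NExp.eval, h0, h3.scratch]

theorem run_output {s : Fin n} {L : List (Fin n)} (hlen : L.length = n) (hs : L.head? = some s)
    (hE : EdgeMem es M) (h5 : M.nat 5 (n - 1) = s)
    (h4 : ∀ a b, Consec L a b → M.nat 4 a = b + 1) :
    Run output M (40 * n + 30) fun M' => ∀ i (h : i < L.length), M'.nat 3 i = L[i] := by
  refine (Run.seq (K₁ := 12) (Q := fun M' => M'.nat 16 0 = s) (Run.straight (by decide) (by decide)
    (by simp [Cmd.effect, NExp.eval, hE.size, h5])) fun M₁ hF₁ h16 =>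
    (Run.for (by decide) (by decide) (fun i M' => (∀ j (h : j < L.length), j < i →
      M'.nat 3 j = L[j]) ∧ ∀ h : i < L.length, M'.nat 16 0 = L[i]) (fun _ => 20) ?_ ?_).mono
      (K := 40 * n + 9) ?_ ?_).mono (by omega) fun _ _ h => h
  · refine ⟨fun j _ h => absurd h (Nat.not_lt_zero j), fun h => ?_⟩
    rw [List.head?_eq_getElem?, List.getElem?_eq_getElem h] at hs
    simp [h16, Option.some.inj hs]
  · rintro i hi M₂ hF₂ hx ⟨h1, h2⟩
    rw [hF₁.nat 0 (by decide), hE.size, ← hlen] at hi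
    refine Run.straight (by decide) (by decide) ⟨fun j hj hji => ?_, fun hi' => ?_⟩
    · simp only [Cmd.effect, NExp.eval, hx, Mem.storeNat_nat, Nat.reduceEqDiff, false_and,
        true_and, if_false, h2 hi]
      split_ifs with h
      · subst h; rfl
      · exact h1 j hj (by omega)
    · have := h4 L[i] L[i + 1] ⟨i, List.getElem?_eq_getElem hi, List.getElem?_eq_getElem hi'⟩
      simp [Cmd.effect, NExp.eval, h2 hi, hF₂.nat 4 (by decide), hF₁.nat 4 (by decide), this]
  · rw [hF₁.nat 0 (by decide), hE.size]; simp; omega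
  · rintro M₂ - ⟨h1, -⟩ i hi
    rw [hF₁.nat 0 (by decide), hE.size] at h1
    exact h1 i hi (by omega)

/-- If the current graph is a path, this path is a dominant schedule of the original graph. -/
theorem CompGraph.Refines.isDominant {V : Type*} [Fintype V] {G G' : CompGraph V}
    (h : Refines G G') {L : List V} (hL : Topo G'.graph.Adj L)
    (hc : ∀ a b, Consec L a b → G'.graph.Adj a b) : G.IsDominant L := by
  classical
  have key : ∀ τ, G.IsSchedule τ →
      Dom (G.profile L) (G.profile τ) ∧ Dom (G.internalProfile L) (G.internalProfile τ) := by
    intro τ hτ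
    obtain ⟨τ', h1, h2⟩ := h.dom τ (G.isSchedule_iff.1 hτ)
    have : τ' = L := eq_of_consec (R := G'.graph.Adj) hL.nodup h1.nodup
      (fun x => ⟨fun _ => hL.complete x, fun _ => h1.complete x⟩) hc h1.topological
    rwa [this] at h2
  exact ⟨G.isSchedule_iff.2 (h.topo L hL).1, fun τ hτ => (key τ hτ).2.dominates,
    fun τ hτ => (key τ hτ).1.dominates⟩

/-- A series-parallel graph has few edges. -/
theorem IsSPOn.length_le {D : Digraph (Fin n)} {s t : Fin n} (h : IsSPOn Set.univ D s t)
    (hes : ListsEdges D es) : es.length ≤ 2 * n := by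
  have h1 := h.ncard_edges
  rw [Set.ncard_univ, Nat.card_eq_fintype_card, Fintype.card_fin] at h1
  rw [← List.toFinset_card_of_nodup hes.1, ← Set.ncard_coe_finset]
  have h2 : (es.toFinset : Set (Fin n × Fin n)) ⊆
      insert (s, t) {e : Fin n × Fin n | D.Adj e.1 e.2 ∧ e ≠ (s, t)} := by
    rintro ⟨a, b⟩ h
    by_cases hab : (a, b) = (s, t)
    · exact Or.inl hab
    · exact Or.inr ⟨(hes.2 a b).1 (by simpa using h), hab⟩
  have h3 := Set.ncard_le_ncard h2 (Set.toFinite _)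
  have h4 := Set.ncard_insert_le (s, t) {e : Fin n × Fin n | D.Adj e.1 e.2 ∧ e ≠ (s, t)}
  omega

theorem IsSPOn.reduced {V : Type*} {D : Digraph V} {s t : V} (h : IsSPOn Set.univ D s t) :
    Reduced D.Adj D.Adj s t fun _ => False where
  adj_iff _ _ _ := Iff.rfl
  closed _ _ h := h.elim
  unique _ _ _ h := h.elim
  not_adj_sink := h.facts.not_adj_sink
  exists_adj v hv := by
    rcases (h.facts.sink v (Set.mem_univ v)).cases_head with h | ⟨w, hw, -⟩
    exacts [absurd h hv, ⟨w, hw⟩]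
  source x := h.facts.source x (Set.mem_univ x)
  sp v _ := h.facts.sp v (Set.mem_univ v)

/-- The loop over the enumeration composes the refinements. In the end every vertex is processed,
the current graph is a path, and `Refines.isDominant` applies to it; since the enumeration lists
out-neighbours first, its last vertex is the source, where the output starts. -/
theorem findsDominant_schedule {A : Cmd} {f : ℕ → ℕ → ℕ}
    (hf : ∀ n n' d d' : ℕ, n ≤ n' → d ≤ d' → f n d ≤ f n' d')
    (hA : FindsDominant (fun _ D => IsStarborescence D) A f) :
    FindsDominant (fun _ D => IsSeriesParallel D) (schedule A)
      (fun n d => 4000 * (n ^ 2 + n * f n d)) := by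
  rintro n G es ⟨s, t, hsp⟩ hes
  have hn : 1 ≤ n := Nat.one_le_iff_ne_zero.2 fun h => (Fin.cast h s).elim0
  have hm := hsp.length_le hes
  have hadj : (fun a b => (a, b) ∈ es) = G.graph.Adj := by
    funext a b; exact propext (hes.2 a b)
  have hE : EdgeMem es (inputMem G es) := by
    refine ⟨by simp [inputMem], by simp [inputMem], fun i hi => ?_, fun i hi => ?_⟩ <;>
      simp [inputMem, hi]
  have hac := G.acyclic
  set d := maxOutDegree G.graph with hd
  suffices h : Run (schedule A) (inputMem G es) (4000 * (n ^ 2 + n * f n d)) fun M' =>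
      ∃ σ : List (Fin n), G.IsDominant σ ∧ ∀ i (h : i < σ.length), M'.nat 3 i = σ[i] by
    obtain ⟨k, M', h1, h2, σ, h3, h4⟩ := h
    exact ⟨k, M', σ, h1, h2, h3, fun i => h4 i i.2⟩
  refine (Run.seq (TopoSort.run_prog hE (by rwa [hadj]) (by simp [inputMem]) (by simp [inputMem]))
    fun M₁ hF₁ h => ?_).mono (K₁ := 35 * n * es.length + 40 * n * n + 60 * n + 9 +
      (n * f n d + n * (700 * (n + 1) + 130 * es.length + 12) + 24 * (n + 1) * es.length + 9 +
      (40 * n + 30))) ?_ fun _ _ h => h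
  swap
  -- With at most `2 * n` edges and `1 ≤ n`, every term other than `n * f n d` is a multiple of `n ^
  -- 2`; the constant `4000` is a generous bound for the sum of the coefficients.
  · have h1 : n * es.length ≤ 2 * (n * n) := by nlinarith
    have h2 : n ≤ n * n := by nlinarith
    nlinarith
  obtain ⟨L, hlen, hL, h5⟩ := h
  have hE₁ := hE.frame hF₁ (by decide) (by decide) (by decide)
  have hmem : ∀ x, x ∈ L := by
    intro x
    have : L.toFinset = Finset.univ := by
      rw [← Finset.card_eq_iff_eq_univ, List.toFinset_card_of_nodup hL.nodup, hlen,
        Fintype.card_fin]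
    rw [← List.mem_toFinset, this]; simp
  refine Run.seq ((Run.for (by simp [process, Cmd.natWrites]) (by simp [process, Cmd.natWrites])
    (fun i M' => ∃ G' : CompGraph (Fin n), CompGraph.Refines G G' ∧
      Reduced G.graph.Adj G'.graph.Adj s t (fun x => x ∈ L.take i) ∧
      GraphMem G' t (fun x => x ∈ L.take i) M')
    -- The cost of a round depends on the out-degree of its vertex. These degrees sum to the number
    -- of edges; a uniform bound per round would be too weak. The default `0` is never reached.
    (fun i => f n d + 700 * (n + 1) + 130 * es.length +
        24 * (n + 1) * (L[i]?.elim 0 fun v => countOut es v (fun _ => True))) ?_ ?_).mono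
    (K := n * f n d + n * (700 * (n + 1) + 130 * es.length + 12) + 24 * (n + 1) * es.length + 9)
    ?_ ?_) (Q := fun M' => EdgeMem es M' ∧ M'.nat 5 = M₁.nat 5 ∧ ∃ G' : CompGraph (Fin n),
      CompGraph.Refines G G' ∧ Reduced G.graph.Adj G'.graph.Adj s t (fun x => x ∈ L) ∧
      GraphMem G' t (fun x => x ∈ L) M') ?_
  · have : Nonempty (Fin n) := ⟨s⟩
    refine ⟨G, .refl G, by simpa using hsp.reduced, ⟨by simp, ?_⟩, fun u => ?_, fun u => ?_⟩
    · simp [hF₁.nat 4 (by decide), inputMem]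
    · rw [Mem.storeNat_real, hF₁.real 0 (by decide)]; simp [inputMem]
    · rw [Mem.storeNat_real, hF₁.real 1 (by decide)]; simp [inputMem]
  · rintro i hi M₂ hF₂ hx ⟨G', hG', hR, hGM⟩
    have hE₂ := hE₁.frame hF₂ (by simp [process, Cmd.natWrites]) (by simp [process, Cmd.natWrites])
      (by simp [process, Cmd.natWrites])
    rw [hE₁.size, ← hlen] at hi
    rw [List.getElem?_eq_getElem hi]
    have hLi : L[i] ∉ L.take i := by
      intro h
      obtain ⟨j, hj, he⟩ := List.mem_take_iff_getElem.1 h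
      have := (List.Nodup.getElem_inj_iff hL.nodup).1 he
      omega
    have htake : (fun x => x ∈ L.take (i + 1)) = fun x => x ∈ L.take i ∨ x = L[i] := by
      funext x
      rw [List.take_succ_eq_append_getElem hi, List.mem_append, List.mem_singleton]
    rw [htake]
    refine (run_process hf hA hR hLi (hL.mem_take i hi) hes hGM hE₂ ?_).mono le_rfl ?_
    · rw [hx, hF₂.nat 5 (by simp [process, Cmd.natWrites]), h5 i hi]
    · rintro M₃ hF₃ ⟨G'', h1, h2, h3⟩
      exact ⟨G'', hG'.trans h1, h2, ⟨fun u w hu hw => by simpa using h3.next.next u w hu hw,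
        by simpa using h3.next.sink⟩, h3.size, h3.scratch⟩
  · rw [hE₁.size]
    have h1 := sum_range_getElem hL.nodup hmem fun v => countOut es v (fun _ => True)
    rw [sum_countOut, hlen] at h1
    simp only [Finset.sum_add_distrib, ← Finset.mul_sum, h1, Finset.sum_const, Finset.card_range,
      smul_eq_mul]
    apply le_of_eq; ring
  · rintro M₂ hF₂ ⟨G', h1, h2, h3⟩
    rw [hE₁.size, List.take_of_length_le hlen.le] at h2 h3
    exact ⟨hE₁.frame hF₂ (by simp [process, Cmd.natWrites, Cmd.for])
      (by simp [process, Cmd.natWrites, Cmd.for]) (by simp [process, Cmd.natWrites, Cmd.for]),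
      hF₂.nat 5 (by simp [process, Cmd.natWrites, Cmd.for]), G', h1, h2, h3⟩
  · rintro M₂ hF₂ ⟨hE₂, h5', G', hG', hR, hGM⟩
    -- All vertices are processed, so out-neighbours are unique, and following them from the source
    -- visits everything.
    obtain ⟨σ, hσn, hσm, hσs, hσc, hσt⟩ := hR.exists_path G'.acyclic hmem
    have hσlen : σ.length = n := by
      rw [← List.toFinset_card_of_nodup hσn,
        show σ.toFinset = Finset.univ by ext x; simp [hσm x], Finset.card_univ, Fintype.card_fin]
    have hlast := hL.getElem_last hlen (s := s) (by rw [hadj]; exact hsp.reduced.source)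
      (by omega)
    refine (run_output hσlen hσs hE₂ ?_ fun a b hab => hGM.next.next a b (hmem a) (hσc a b hab)).mono
      le_rfl fun M₃ _ h => ⟨σ, hG'.isDominant hσt hσc, h⟩
    rw [h5', h5 (n - 1) (by omega), hlast]

end PeakMem

theorem mainTheorem11 :
    ∃ C : ℕ, ∀ f : ℕ → ℕ → ℕ,
      (∀ n n' d d' : ℕ, n ≤ n' → d ≤ d' → f n d ≤ f n' d') →
      ∀ A : PeakMem.Cmd,
        PeakMem.FindsDominant (fun _ D => PeakMem.IsStarborescence D) A f →
        ∃ B : PeakMem.Cmd,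
          PeakMem.FindsDominant (fun _ D => PeakMem.IsSeriesParallel D) B
            (fun n d => C * (n ^ 2 + n * f n d)) :=
  ⟨4000, fun _ hf A hA => ⟨PeakMem.schedule A, PeakMem.findsDominant_schedule hf hA⟩⟩
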